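/- Let $(M,g)$ be an oriented smooth Riemannian surface with Levi-Civita connection $\nabla$, complex structure $J$ (rotation by $+\pi/2$), area element $\Omega_2$ (so $\Omega_2(X,JX)=1$ for unit vectors $X$) and Gauss curvature $G$, and let $m\in\mathbb{R}$, $m\neq 0$. Let $F=\frac{G}{m}\,\Omega_2$ be the Gauss--Landau--Hall magnetic field, with Lorentz force $\Phi$ defined by $g(\Phi(X),Y)=F(X,Y)$. A smooth curve $\gamma$ is a normal flowline of $F$ if $\nabla_{\gamma'}\gamma'=\Phi(\gamma')$ and $\|\gamma'\|\equiv 1$. For an immersed curve $\gamma$ put $T=\gamma'/\|\gamma'\|$, $N=JT$, let $\kappa=g(\nabla_{\gamma'}\gamma',N)/\|\gamma'\|^2$ be its geodesic curvature, and let $s$ denote arc length. Let $\Lambda$ be one of the following spaces of curves. (a) (Clamped curves) For real numbers $t_1<t_2$ and unit vectors $x_1\in T_{q_1}M$, $x_2\in T_{q_2}M$, the space of smooth immersed curves $\gamma:[t_1,t_2]\to M$ with $\gamma(t_i)=q_i$ and $T(t_i)=x_i$, $i=1,2$. (b) (Closed curves) For $L>0$, the space of smooth immersed curves $\gamma:\mathbb{R}\to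 M$ that are periodic of period $L$. Consider the action $\mathcal{F}_m:\Lambda\to\mathbb{R}$, $\mathcal{F}_m(\gamma)=\int_\gamma(\kappa+m)\,ds$, where the integral is over $[t_1,t_2]$ in case (a) and over one period $[0,L]$ in case (b). A curve $\gamma\in\Lambda$ is a critical point of $\mathcal{F}_m$ if $\frac{d}{dr}\big|_{r=0}\mathcal{F}_m(\Theta(\cdot,r))=0$ for every smooth variation $\Theta(t,r)$, $|r|<\varepsilon$, of $\gamma=\Theta(\cdot,0)$ through curves $\Theta(\cdot,r)\in\Lambda$. Then for every $\gamma\in\Lambda$: 1. $\gamma$ is a normal flowline of $F$ if and only if $\gamma$ has unit speed and is a critical point of $\mathcal{F}_m$; 2. $\gamma$ becomes a normal flowline of $F$ after some smooth orientation-preserving change of parameter (in case (b), one that descends to a diffeomorphism of circles, possibly of different lengths) if and only if $\gamma$ is a critical point of $\mathcal{F}_m$; 3. $\gamma$ is a critical point of $\mathcal{F}_m$ if and only if $G|_\gamma=m\,\kappa$ along $\gamma$. -/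

import Mathlib

open Set Bundle MeasureTheory
open scoped Manifold ContDiff Topology RealInnerProductSpace

noncomputable section

namespace GaussLandauHall

/-- The model plane of a surface. -/
abbrev Plane : Type := EuclideanSpace ℝ (Fin 2)

section Charts

variable {M : Type*} [TopologicalSpace M] [ChartedSpace Plane M]

instance finrankTangentSpace (x : M) :
    Fact (Module.finrank ℝ (TangentSpace (𝓡 2) x) = 2) :=
  ⟨finrank_euclideanSpace_fin (𝕜 := ℝ) (n := 2)⟩

instance finiteDimensionalTangentSpace (x : M) :
    FiniteDimensional ℝ (TangentSpace (𝓡 2) x) :=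
  inferInstanceAs (FiniteDimensional ℝ Plane)

/-- The velocity `γ'(t)` of a curve in the surface. -/
def velocity (γ : ℝ → M) (t : ℝ) : TangentSpace (𝓡 2) (γ t) :=
  mfderiv 𝓘(ℝ, ℝ) (𝓡 2) γ t (1 : ℝ)

/-- The standard basis vector `e_i` of the plane. -/
def stdVec (i : Fin 2) : Plane := EuclideanSpace.single i (1 : ℝ)

/-- The partial derivative `∂f/∂y_i` of a real function of two real variables. -/
def partialDeriv (i : Fin 2) (f : Plane → ℝ) (y : Plane) : ℝ := fderiv ℝ f y (stdVec i)

/-- The coordinate vector `∂_i` of the preferred chart at `p`, at the point with coordinates `y`. -/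
def coordVec (p : M) (i : Fin 2) (y : Plane) :
    TangentSpace (𝓡 2) ((extChartAt (𝓡 2) p).symm y) :=
  mfderiv 𝓘(ℝ, Plane) (𝓡 2) (extChartAt (𝓡 2) p).symm y (stdVec i)

/-- An orientation of each tangent plane is continuous if, read in the chart at any point `p`, it is
constant in a neighbourhood of `p`. -/
def IsContinuousOrientation [IsManifold (𝓡 2) ∞ M]
    (o : ∀ x : M, Orientation ℝ (TangentSpace (𝓡 2) x) (Fin 2)) : Prop :=
  ∀ p : M, ∃ o' : Orientation ℝ Plane (Fin 2), ∀ᶠ x in 𝓝 p,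
    ∀ hx : x ∈ (trivializationAt Plane (TangentSpace (𝓡 2)) p).baseSet,
      Orientation.map (Fin 2)
        ((trivializationAt Plane (TangentSpace (𝓡 2)) p).continuousLinearEquivAt ℝ x
          hx).toLinearEquiv (o x) = o'

end Charts

section Riemannian

variable {M : Type*} [TopologicalSpace M] [ChartedSpace Plane M]
  [RiemannianBundle (fun x : M => TangentSpace (𝓡 2) x)]

/-! ### The Levi-Civita connection and the Gauss curvature in charts -/

/-- The matrix `g_ij = g(∂_i, ∂_j)` of the metric in the preferred chart at `p`. -/
def metricMatrix (p : M) (y : Plane) : Matrix (Fin 2) (Fin 2) ℝ :=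
  Matrix.of fun i j => ⟪coordVec p i y, coordVec p j y⟫

/-- The Christoffel symbol
`Γ^k_ij = ½ ∑_l g^kl (∂_i g_jl + ∂_j g_il - ∂_l g_ij)` in the preferred chart at `p`. -/
def christoffel (p : M) (k i j : Fin 2) (y : Plane) : ℝ :=
  (1 / 2 : ℝ) * ∑ l, (metricMatrix p y)⁻¹ k l *
    (partialDeriv i (fun z => metricMatrix p z j l) y
      + partialDeriv j (fun z => metricMatrix p z i l) y
      - partialDeriv l (fun z => metricMatrix p z i j) y)

/-- The component `R^l_kij`, defined by `R(∂_i, ∂_j) ∂_k = ∑_l R^l_kij ∂_l`, of the Riemann tensor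
`R(X, Y) Z = ∇_X ∇_Y Z - ∇_Y ∇_X Z - ∇_[X, Y] Z`, in the preferred chart at `p`. -/
def riemannComponent (p : M) (l k i j : Fin 2) (y : Plane) : ℝ :=
  partialDeriv i (christoffel p l j k) y - partialDeriv j (christoffel p l i k) y
    + ∑ n, (christoffel p l i n y * christoffel p n j k y
      - christoffel p l j n y * christoffel p n i k y)

/-- The Gauss curvature `G = g(R(∂_1, ∂_2) ∂_2, ∂_1) / det(g_ij)` at `p`. -/
def gaussCurvature (p : M) : ℝ :=
  (∑ l, riemannComponent p l 1 0 1 (extChartAt (𝓡 2) p p)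
      * metricMatrix p (extChartAt (𝓡 2) p p) l 0)
    / (metricMatrix p (extChartAt (𝓡 2) p p)).det

/-- The covariant acceleration `∇_{γ'} γ'`, whose components in the chart at `γ t` are
`x_k'' + ∑_ij Γ^k_ij x_i' x_j'`. Recall that a vector of `TangentSpace (𝓡 2) p` is given by its
components in the preferred chart at `p`. -/
def covAcceleration (γ : ℝ → M) (t : ℝ) : TangentSpace (𝓡 2) (γ t) :=
  let x : ℝ → Plane := fun s => extChartAt (𝓡 2) (γ t) (γ s)
  (WithLp.toLp 2 fun k => (deriv (deriv x) t) k
    + ∑ i, ∑ j, christoffel (γ t) k i j (x t) * (deriv x t) i * (deriv x t) j : Plane)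

/-! ### Curves -/

/-- The unit tangent `T = γ' / |γ'|`, as a point of the tangent bundle. -/
def unitTangent (γ : ℝ → M) (t : ℝ) : TangentBundle (𝓡 2) M :=
  ⟨γ t, ‖velocity γ t‖⁻¹ • velocity γ t⟩

/-- The geodesic curvature `κ = g(∇_{γ'} γ', N) / |γ'|²`, where `N = J T = J γ' / |γ'|`, of an
immersed curve in an oriented surface; `J` is the rotation by a right angle. -/
def geodesicCurvature (o : ∀ x : M, Orientation ℝ (TangentSpace (𝓡 2) x) (Fin 2))
    (γ : ℝ → M) (t : ℝ) : ℝ :=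
  ⟪covAcceleration γ t, (o (γ t)).rightAngleRotation (velocity γ t)⟫ / ‖velocity γ t‖ ^ 3

/-- The curve `γ` is smooth and immersed on the set `K` of parameters. For `K = [a, b]` this means
that `γ` restricts to a smooth immersed curve on `[a, b]`, up to the endpoints. -/
def IsImmersedOn (K : Set ℝ) (γ : ℝ → M) : Prop :=
  ∀ t ∈ K, ContMDiffAt 𝓘(ℝ, ℝ) (𝓡 2) ∞ γ t ∧ velocity γ t ≠ 0

/-- The clamped curves on `[a, b]`: the immersed curves whose unit tangents at the endpoints are the
given vectors `x₁`, `x₂`; in particular the endpoints are the base points of `x₁`, `x₂`. -/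
def clampedCurves (a b : ℝ) (x₁ x₂ : TangentBundle (𝓡 2) M) : Set (ℝ → M) :=
  {γ | IsImmersedOn (Icc a b) γ ∧ unitTangent γ a = x₁ ∧ unitTangent γ b = x₂}

/-- The immersed closed curves, as immersed curves on the line of period `L`. -/
def closedCurves (M : Type*) [TopologicalSpace M] [ChartedSpace Plane M] (L : ℝ) :
    Set (ℝ → M) :=
  {γ | IsImmersedOn univ γ ∧ Function.Periodic γ L}

/-! ### The action and its critical points -/

/-- The action `F_m(γ) = ∫_γ (κ + m) ds` of the curve `γ` on `[a, b]`. -/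
def action (o : ∀ x : M, Orientation ℝ (TangentSpace (𝓡 2) x) (Fin 2)) (m a b : ℝ)
    (γ : ℝ → M) : ℝ :=
  ∫ t in a..b, (geodesicCurvature o γ t + m) * ‖velocity γ t‖

/-- `Θ` is a smooth variation, in the space `Λ` of curves with set `K` of parameters, of the
curve `γ`: for small `|r|`, the curves `Θ(·, r)` belong to `Λ` and depend smoothly on `(t, r)`, and
`Θ(·, 0) = γ`. -/
def IsVariation (Λ : Set (ℝ → M)) (K : Set ℝ) (γ : ℝ → M) (Θ : ℝ → ℝ → M) : Prop :=
  (∀ t ∈ K, Θ t 0 = γ t) ∧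
  ∃ ε > 0, ∀ r ∈ Ioo (-ε) ε, (fun t => Θ t r) ∈ Λ ∧
    ∀ t ∈ K, ContMDiffAt 𝓘(ℝ, ℝ × ℝ) (𝓡 2) ∞ (fun q : ℝ × ℝ => Θ q.1 q.2) (t, r)

/-- `γ` is a critical point of the functional `S` on the space `Λ` of curves with set `K` of
parameters: the first variation of `S` vanishes along each smooth variation of `γ` in `Λ`. -/
def IsCriticalPoint (Λ : Set (ℝ → M)) (K : Set ℝ) (S : (ℝ → M) → ℝ) (γ : ℝ → M) : Prop :=
  ∀ Θ : ℝ → ℝ → M, IsVariation Λ K γ Θ → HasDerivAt (fun r => S fun t => Θ t r) 0 0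

/-! ### Magnetic fields and their flowlines -/

/-- The Lorentz force `Φ` of a field `F` of bilinear forms: `g(Φ(X), Y) = F(X, Y)`. -/
def lorentzForce (F : ∀ x : M, LinearMap.BilinForm ℝ (TangentSpace (𝓡 2) x)) (x : M)
    (X : TangentSpace (𝓡 2) x) : TangentSpace (𝓡 2) x :=
  (InnerProductSpace.toDual ℝ (TangentSpace (𝓡 2) x)).symm
    (LinearMap.toContinuousLinearMap (F x X))

theorem inner_lorentzForce (F : ∀ x : M, LinearMap.BilinForm ℝ (TangentSpace (𝓡 2) x)) (x : M)
    (X Y : TangentSpace (𝓡 2) x) : ⟪lorentzForce F x X, Y⟫ = F x X Y := by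
  simp [lorentzForce]

/-- The Gauss-Landau-Hall magnetic field `F = (G / m) Ω₂`, with `Ω₂` the area element. -/
def gaussMagneticField (o : ∀ x : M, Orientation ℝ (TangentSpace (𝓡 2) x) (Fin 2)) (m : ℝ)
    (x : M) : LinearMap.BilinForm ℝ (TangentSpace (𝓡 2) x) :=
  (gaussCurvature x / m) • (o x).areaForm

/-- `γ` has unit speed on `K`. -/
def HasUnitSpeedOn (K : Set ℝ) (γ : ℝ → M) : Prop :=
  ∀ t ∈ K, ‖velocity γ t‖ = 1

/-- `γ` is, on `K`, a smooth solution of the Landau-Hall equation `∇_{γ'} γ' = Φ(γ')`. -/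
def IsFlowlineOn (F : ∀ x : M, LinearMap.BilinForm ℝ (TangentSpace (𝓡 2) x)) (K : Set ℝ)
    (γ : ℝ → M) : Prop :=
  ∀ t ∈ K, ContMDiffAt 𝓘(ℝ, ℝ) (𝓡 2) ∞ γ t ∧
    covAcceleration γ t = lorentzForce F (γ t) (velocity γ t)

/-- A flowline is normal if it has unit speed. -/
def IsNormalFlowlineOn (F : ∀ x : M, LinearMap.BilinForm ℝ (TangentSpace (𝓡 2) x)) (K : Set ℝ)
    (γ : ℝ → M) : Prop :=
  IsFlowlineOn F K γ ∧ HasUnitSpeedOn K γ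

end Riemannian

/-- `φ` is a smooth increasing change of parameter from `[c, d]` onto `[a, b]`. -/
def IsIntervalReparam (c d a b : ℝ) (φ : ℝ → ℝ) : Prop :=
  c < d ∧ φ c = a ∧ φ d = b ∧ ∀ s ∈ Icc c d, ContDiffAt ℝ ∞ φ s ∧ 0 < deriv φ s

/-- `φ` is a smooth increasing change of parameter from the circle of length `ℓ` onto the circle of
length `L`, lifted to the line. -/
def IsPeriodicReparam (ℓ L : ℝ) (φ : ℝ → ℝ) : Prop :=
  0 < ℓ ∧ ContDiff ℝ ∞ φ ∧ (∀ s, φ (s + ℓ) = φ s + L) ∧ ∀ s, 0 < deriv φ s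

end GaussLandauHall

end

/-! For a variation Θ(t, r) put V = ∂_t Θ and W = ∂_r Θ. The frame T = V/|V|, N = JT along Θ has the
connection form ω(β) = Ω₂(V, ∇_β V)/|V|² (`turn`), and its value on ∂_t is exactly κ|V|. Cartan's
structure equation says that the exterior derivative of ω is the curvature: ∂_r(κ|V|) = ∂_t ω(∂_r) +
G Ω₂(V, W) (`fderiv_turn_sub`). It follows from the Ricci identity, because ∇ preserves the metric
and the area form and a skew-adjoint operator on a plane is a multiple of the rotation J.
Torsion-freeness gives the classical variation of length, ∂_r|V| = ∂_t⟨W, T⟩ - κ Ω₂(V, W)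
(`fderiv_speed_sub`). Adding the first identity to m times the second, the integrand of the action
varies by a total derivative ∂_t P, with P = ω(∂_r) + m⟨W, T⟩, plus (G - mκ) Ω₂(V, W)
(`first_variation`). Although κ contains second derivatives, no derivative of κ enters the
Euler-Lagrange equation.

The boundary values of P vanish when the unit tangent at an end is fixed, since then W = 0 and V
keeps its direction (`momentum_eq_zero_of_clamped`); for closed curves they cancel
(`momentum_eq_of_periodic`). Hence G = mκ implies criticality. Conversely, where G ≠ mκ, pushing the
curve in the normal direction by a bump function makes the first variation nonzero
(`exists_variation`). This is statement 3.

For a unit speed curve both ∇_{γ'} γ' and Φ(γ') are orthogonal to γ', and their normal components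
are κ and G/m; so the Landau-Hall equation is again G = mκ (`isNormalFlowlineOn_iff`), which gives
statement 1. The equation G = mκ is invariant under increasing reparametrization
(`geodesicCurvature_comp`), and every immersed curve has an arc length parameter
(`exists_arclength_Icc`, `exists_arclength_periodic`), which gives statement 2.

All differential identities are computed for a metric on the plane and carried to the surface by
charts; `chartD_covDeriv` shows that the chart does not matter. -/

noncomputable section

namespace GaussLandauHall

/-! ### Riemannian calculus in an open set of the plane -/

section PlaneMetric

/-- The Christoffel symbols of a metric on the plane. -/
def chr (g : Plane → Matrix (Fin 2) (Fin 2) ℝ) (k i j : Fin 2) (y : Plane) : ℝ :=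
  (1 / 2 : ℝ) * ∑ l, (g y)⁻¹ k l *
    (partialDeriv i (fun z => g z j l) y + partialDeriv j (fun z => g z i l) y
      - partialDeriv l (fun z => g z i j) y)

/-- The components of the curvature tensor of a metric on the plane. -/
def curv (g : Plane → Matrix (Fin 2) (Fin 2) ℝ) (l k i j : Fin 2) (y : Plane) : ℝ :=
  partialDeriv i (chr g l j k) y - partialDeriv j (chr g l i k) y
    + ∑ n, (chr g l i n y * chr g n j k y - chr g l j n y * chr g n i k y)

/-- The bilinear form with matrix `A`. -/
def quad (A : Matrix (Fin 2) (Fin 2) ℝ) (u v : Plane) : ℝ :=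
  A 0 0 * u 0 * v 0 + A 0 1 * u 0 * v 1 + A 1 0 * u 1 * v 0 + A 1 1 * u 1 * v 1

/-- The standard area form of the plane. -/
def cross (u v : Plane) : ℝ := u 0 * v 1 - u 1 * v 0

/-- The vector `Γ(u, v)`. -/
def chrVec (g : Plane → Matrix (Fin 2) (Fin 2) ℝ) (y u v : Plane) : Plane :=
  WithLp.toLp 2 fun k => ∑ i, ∑ j, chr g k i j y * u i * v j

variable {E : Type*} [NormedAddCommGroup E] [NormedSpace ℝ E]

/-- The covariant derivative in the direction `δ` of a vector field `X` along a map `x`. -/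
def covD (g : Plane → Matrix (Fin 2) (Fin 2) ℝ) (x X : E → Plane) (q δ : E) : Plane :=
  fderiv ℝ X q δ + chrVec g (x q) (fderiv ℝ x q δ) (X q)

variable {g : Plane → Matrix (Fin 2) (Fin 2) ℝ} {y : Plane}

/-- Lowering the index cancels the inverse matrix and leaves the Christoffel symbols of the first
kind. -/
theorem sum_mul_chr (hdet : (g y).det ≠ 0) (m i j : Fin 2) :
    ∑ k, g y m k * chr g k i j y = (1 / 2 : ℝ) * (partialDeriv i (fun z => g z j m) y
      + partialDeriv j (fun z => g z i m) y - partialDeriv m (fun z => g z i j) y) := by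
  have h : g y * (g y)⁻¹ = 1 := Matrix.mul_nonsing_inv _ (isUnit_iff_ne_zero.2 hdet)
  have h' : ∀ a b, ∑ k, g y a k * (g y)⁻¹ k b = if a = b then 1 else 0 := by
    intro a b
    rw [← Matrix.mul_apply, h, Matrix.one_apply]
  simp only [Fin.sum_univ_two, chr] at h' ⊢
  have h0 := h' m 0
  have h1 := h' m 1
  fin_cases m <;> simp at h0 h1 ⊢ <;>
  linear_combination
    (1 / 2 : ℝ) * (partialDeriv i (fun z => g z j 0) y
      + partialDeriv j (fun z => g z i 0) y - partialDeriv 0 (fun z => g z i j) y) * h0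
    + (1 / 2 : ℝ) * (partialDeriv i (fun z => g z j 1) y
      + partialDeriv j (fun z => g z i 1) y - partialDeriv 1 (fun z => g z i j) y) * h1

theorem chr_symm (hs : ∀ y i j, g y i j = g y j i) (k i j : Fin 2) : chr g k i j = chr g k j i := by
  ext y
  have : (fun z => g z i j) = fun z => g z j i := funext fun z => hs z i j
  simp only [chr, this]
  congr 1
  refine Finset.sum_congr rfl fun l _ => ?_
  ring

/-- This is ∇g = 0 in coordinates. In the sum of two Christoffel symbols of the first kind all
derivatives cancel except two equal copies of the wanted one. -/
theorem partialDeriv_metric (hs : ∀ y i j, g y i j = g y j i) (hdet : (g y).det ≠ 0)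
    (l i j : Fin 2) : partialDeriv l (fun z => g z i j) y
      = ∑ k, (g y j k * chr g k l i y + g y i k * chr g k l j y) := by
  rw [Finset.sum_add_distrib, sum_mul_chr hdet, sum_mul_chr hdet]
  have : ∀ i j, (fun z => g z i j) = fun z => g z j i := fun i j => funext fun z => hs z i j
  rw [this j i, this l i, this l j]
  ring

theorem eq_sum_stdVec (u : Plane) : u = u 0 • stdVec 0 + u 1 • stdVec 1 := by
  ext i
  fin_cases i <;> simp [stdVec]

theorem fderiv_apply_eq_partialDeriv (f : Plane → ℝ) (y u : Plane) :
    fderiv ℝ f y u = u 0 * partialDeriv 0 f y + u 1 * partialDeriv 1 f y := by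
  conv_lhs => rw [eq_sum_stdVec u]
  simp [partialDeriv]

theorem det_fin_two_eq (hs : ∀ y i j, g y i j = g y j i) :
    (g y).det = g y 0 0 * g y 1 1 - g y 0 1 * g y 0 1 := by
  rw [Matrix.det_fin_two, hs y 1 0]

theorem proj_apply (i : Fin 2) (v : Plane) :
    (EuclideanSpace.proj i : Plane →L[ℝ] ℝ) v = v i := rfl

theorem hasFDerivAt_coord {X : E → Plane} {q : E} (hX : DifferentiableAt ℝ X q) (i : Fin 2) :
    HasFDerivAt (fun p => X p i) ((EuclideanSpace.proj i : Plane →L[ℝ] ℝ) ∘L fderiv ℝ X q) q :=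
  (EuclideanSpace.proj i : Plane →L[ℝ] ℝ).hasFDerivAt.comp q hX.hasFDerivAt

theorem fderiv_coord {X : E → Plane} {q : E} (hX : DifferentiableAt ℝ X q) (i : Fin 2) (δ : E) :
    fderiv ℝ (fun p => X p i) q δ = fderiv ℝ X q δ i := by
  rw [(hasFDerivAt_coord hX i).fderiv]; rfl

theorem fderiv_comp_plane {x : E → Plane} {q : E} {f : Plane → ℝ} (hx : DifferentiableAt ℝ x q)
    (hf : DifferentiableAt ℝ f (x q)) (δ : E) :
    fderiv ℝ (fun p => f (x p)) q δ = fderiv ℝ x q δ 0 * partialDeriv 0 f (x q)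
      + fderiv ℝ x q δ 1 * partialDeriv 1 f (x q) := by
  rw [← fderiv_apply_eq_partialDeriv]
  have := (hf.hasFDerivAt.comp q hx.hasFDerivAt).fderiv
  simp only [Function.comp_def] at this
  rw [this]; rfl

theorem covD_apply (x X : E → Plane) (q δ : E) (k : Fin 2) :
    covD g x X q δ k = fderiv ℝ X q δ k + (chr g k 0 0 (x q) * fderiv ℝ x q δ 0 * X q 0
      + chr g k 0 1 (x q) * fderiv ℝ x q δ 0 * X q 1
      + (chr g k 1 0 (x q) * fderiv ℝ x q δ 1 * X q 0
      + chr g k 1 1 (x q) * fderiv ℝ x q δ 1 * X q 1)) := by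
  simp [covD, chrVec, Fin.sum_univ_two]

/-- The metric is parallel. -/
theorem fderiv_quad (hs : ∀ y i j, g y i j = g y j i) {x X Y : E → Plane} {q : E}
    (hdet : (g (x q)).det ≠ 0) (hg : ∀ i j, DifferentiableAt ℝ (fun z => g z i j) (x q))
    (hx : DifferentiableAt ℝ x q) (hX : DifferentiableAt ℝ X q) (hY : DifferentiableAt ℝ Y q)
    (δ : E) :
    fderiv ℝ (fun p => quad (g (x p)) (X p) (Y p)) q δ
      = quad (g (x q)) (covD g x X q δ) (Y q) + quad (g (x q)) (X q) (covD g x Y q δ) := by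
  have hgx : ∀ i j, HasFDerivAt (fun p => g (x p) i j) (fderiv ℝ (fun p => g (x p) i j) q) q :=
    fun i j => ((hg i j).comp q hx).hasFDerivAt
  have hgx' : ∀ i j, fderiv ℝ (fun p => g (x p) i j) q δ = _ := fun i j =>
    fderiv_comp_plane hx (hg i j) δ
  have key := fun i j => ((hgx i j).mul (hasFDerivAt_coord hX i)).mul (hasFDerivAt_coord hY j)
  have := ((((key 0 0).add (key 0 1)).add (key 1 0)).add (key 1 1)).fderiv
  simp only [quad]
  erw [this]
  simp only [_root_.add_apply, _root_.smul_apply,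
    ContinuousLinearMap.comp_apply, proj_apply, Pi.mul_apply, smul_eq_mul, hgx',
    partialDeriv_metric hs hdet, covD_apply, Fin.sum_univ_two, chr_symm hs _ 1 0, hs (x q) 1 0]
  ring

/-- The logarithmic derivative of √det g is the trace of the Christoffel symbols; this trace is what
makes the area form parallel. -/
theorem fderiv_sqrt_det (hs : ∀ y i j, g y i j = g y j i) {x : E → Plane} {q : E}
    (hdet : 0 < (g (x q)).det) (hg : ∀ i j, DifferentiableAt ℝ (fun z => g z i j) (x q))
    (hx : DifferentiableAt ℝ x q) (δ : E) :
    HasFDerivAt (fun p => √(g (x p)).det) (fderiv ℝ (fun p => √(g (x p)).det) q) q ∧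
    fderiv ℝ (fun p => √(g (x p)).det) q δ
      = √(g (x q)).det * ((chr g 0 0 0 (x q) + chr g 1 0 1 (x q)) * fderiv ℝ x q δ 0
        + (chr g 0 0 1 (x q) + chr g 1 1 1 (x q)) * fderiv ℝ x q δ 1) := by
  have hgx : ∀ i j, HasFDerivAt (fun p => g (x p) i j) (fderiv ℝ (fun p => g (x p) i j) q) q :=
    fun i j => ((hg i j).comp q hx).hasFDerivAt
  have hgx' : ∀ i j, fderiv ℝ (fun p => g (x p) i j) q δ = _ := fun i j =>
    fderiv_comp_plane hx (hg i j) δ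
  have h1 := (((hgx 0 0).mul (hgx 1 1)).sub ((hgx 0 1).mul (hgx 0 1)))
  have h2 : HasFDerivAt (fun p => (g (x p)).det) _ q :=
    h1.congr_of_eventuallyEq (Filter.Eventually.of_forall fun p => det_fin_two_eq hs)
  have h3 := h2.sqrt hdet.ne'
  refine ⟨h3.differentiableAt.hasFDerivAt, ?_⟩
  rw [h3.fderiv]
  have h4 : √(g (x q)).det ≠ 0 := (Real.sqrt_pos.2 hdet).ne'
  have h5 : √(g (x q)).det ^ 2 = (g (x q)).det := Real.sq_sqrt hdet.le
  simp only [_root_.add_apply, _root_.smul_apply,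
    _root_.sub_apply, smul_eq_mul, hgx',
    partialDeriv_metric hs hdet.ne', Fin.sum_univ_two, chr_symm hs _ 1 0, hs (x q) 1 0]
  field_simp
  rw [h5, det_fin_two_eq hs]
  ring

/-- The area form is parallel. -/
theorem fderiv_area (hs : ∀ y i j, g y i j = g y j i) {x X Y : E → Plane} {q : E}
    (hdet : 0 < (g (x q)).det) (hg : ∀ i j, DifferentiableAt ℝ (fun z => g z i j) (x q))
    (hx : DifferentiableAt ℝ x q) (hX : DifferentiableAt ℝ X q) (hY : DifferentiableAt ℝ Y q)
    (δ : E) :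
    fderiv ℝ (fun p => √(g (x p)).det * cross (X p) (Y p)) q δ
      = √(g (x q)).det * (cross (covD g x X q δ) (Y q) + cross (X q) (covD g x Y q δ)) := by
  obtain ⟨h1, h2⟩ := fderiv_sqrt_det hs hdet hg hx δ
  have := (h1.mul (((hasFDerivAt_coord hX 0).mul (hasFDerivAt_coord hY 1)).sub
    ((hasFDerivAt_coord hX 1).mul (hasFDerivAt_coord hY 0)))).fderiv
  simp only [cross]
  erw [this]
  simp only [_root_.add_apply, _root_.smul_apply,
    _root_.sub_apply, ContinuousLinearMap.comp_apply, proj_apply, Pi.mul_apply, Pi.sub_apply,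
    smul_eq_mul, h2, covD_apply, chr_symm hs _ 1 0]
  ring

theorem differentiableAt_fderiv_apply {F : Type*} [NormedAddCommGroup F] [NormedSpace ℝ F]
    {f : E → F} {q : E} (hf : ContDiffAt ℝ 2 f q) (δ : E) :
    DifferentiableAt ℝ (fun p => fderiv ℝ f p δ) q :=
  ((hf.fderiv_right (m := 1) (by norm_num)).differentiableAt (by norm_num)).clm_apply
    (differentiableAt_const δ)

theorem fderiv_fderiv_comm {F : Type*} [NormedAddCommGroup F] [NormedSpace ℝ F]
    {f : E → F} {q : E} (hf : ContDiffAt ℝ 2 f q) (α β : E) :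
    fderiv ℝ (fun p => fderiv ℝ f p α) q β = fderiv ℝ (fun p => fderiv ℝ f p β) q α := by
  have h1 : DifferentiableAt ℝ (fderiv ℝ f) q :=
    (hf.fderiv_right (m := 1) (by norm_num)).differentiableAt (by norm_num)
  rw [fderiv_clm_apply h1 (by fun_prop), fderiv_clm_apply h1 (by fun_prop)]
  simpa using hf.isSymmSndFDerivAt (by simp) β α

/-- The Levi-Civita connection is torsion free. -/
theorem covD_fderiv_comm (hs : ∀ y i j, g y i j = g y j i) {x : E → Plane} {q : E}
    (hx : ContDiffAt ℝ 2 x q) (α β : E) :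
    covD g x (fun p => fderiv ℝ x p α) q β = covD g x (fun p => fderiv ℝ x p β) q α := by
  ext k
  simp only [covD_apply, fderiv_fderiv_comm hx α β, chr_symm hs _ 1 0]
  ring

/-- The curvature operator `R(u, v)` applied to `X`, up to the factor `cross u v`. -/
def curvVec (g : Plane → Matrix (Fin 2) (Fin 2) ℝ) (y X : Plane) : Plane :=
  WithLp.toLp 2 fun l => curv g l 0 0 1 y * X 0 + curv g l 1 0 1 y * X 1

/-- The iterated derivative written out in components, before any symmetry is used; exchanging α and
β in it yields the Ricci identity. -/
theorem hasFDerivAt_covD {x X : E → Plane} {q : E}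
    (hΓ : ∀ k i j, DifferentiableAt ℝ (chr g k i j) (x q))
    (hx : ContDiffAt ℝ 2 x q) (hX : ContDiffAt ℝ 2 X q) (α β : E) :
    DifferentiableAt ℝ (fun p => covD g x X p α) q ∧ ∀ k,
    fderiv ℝ (fun p => covD g x X p α) q β k = fderiv ℝ (fun p => fderiv ℝ X p α) q β k
      + ∑ i, ∑ j, ((fderiv ℝ x q β 0 * partialDeriv 0 (chr g k i j) (x q)
          + fderiv ℝ x q β 1 * partialDeriv 1 (chr g k i j) (x q)) * fderiv ℝ x q α i * X q j
        + chr g k i j (x q) * fderiv ℝ (fun p => fderiv ℝ x p α) q β i * X q j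
        + chr g k i j (x q) * fderiv ℝ x q α i * fderiv ℝ X q β j) := by
  have hx1 : DifferentiableAt ℝ x q := hx.differentiableAt (by norm_num)
  have hX1 : DifferentiableAt ℝ X q := hX.differentiableAt (by norm_num)
  have hxα := differentiableAt_fderiv_apply hx α
  have hXα := differentiableAt_fderiv_apply hX α
  have hgx : ∀ k i j, HasFDerivAt (fun p => chr g k i j (x p))
      (fderiv ℝ (fun p => chr g k i j (x p)) q) q :=
    fun k i j => ((hΓ k i j).comp q hx1).hasFDerivAt
  have hgx' : ∀ k i j, fderiv ℝ (fun p => chr g k i j (x p)) q β = _ := fun k i j =>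
    fderiv_comp_plane hx1 (hΓ k i j) β
  have key := fun k i j => ((hgx k i j).mul (hasFDerivAt_coord hxα i)).mul (hasFDerivAt_coord hX1 j)
  have tot := fun k => (hasFDerivAt_coord hXα k).add
    (((key k 0 0).add (key k 0 1)).add ((key k 1 0).add (key k 1 1)))
  have tot' : ∀ k, HasFDerivAt (fun p => covD g x X p α k) _ q := fun k =>
    (tot k).congr_of_eventuallyEq (Filter.Eventually.of_forall fun p => by
      simp only [covD_apply]; rfl)
  have hd : DifferentiableAt ℝ (fun p => covD g x X p α) q :=
    differentiableAt_euclidean.2 fun k => (tot' k).differentiableAt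
  refine ⟨hd, fun k => ?_⟩
  rw [← fderiv_coord hd, (tot' k).fderiv]
  simp only [_root_.add_apply, _root_.smul_apply,
    ContinuousLinearMap.comp_apply, proj_apply, Pi.mul_apply, smul_eq_mul, hgx', Fin.sum_univ_two]
  ring

/-- The Ricci identity. -/
theorem covD_covD_sub (hs : ∀ y i j, g y i j = g y j i) {x X : E → Plane} {q : E}
    (hΓ : ∀ k i j, DifferentiableAt ℝ (chr g k i j) (x q))
    (hx : ContDiffAt ℝ 2 x q) (hX : ContDiffAt ℝ 2 X q) (α β : E) :
    covD g x (fun p => covD g x X p α) q β = covD g x (fun p => covD g x X p β) q α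
      + cross (fderiv ℝ x q β) (fderiv ℝ x q α) • curvVec g (x q) (X q) := by
  ext k
  simp only [PiLp.add_apply, PiLp.smul_apply, smul_eq_mul]
  -- The second derivatives of `x` and of `X` are symmetric in α, β and cancel; the derivatives of
  -- the Christoffel symbols and their products remain and assemble into `curv`.
  simp only [covD_apply, (hasFDerivAt_covD hΓ hx hX α β).2,
    (hasFDerivAt_covD hΓ hx hX β α).2, fderiv_fderiv_comm hX α β, Fin.sum_univ_two, cross, curvVec,
    curv, fderiv_fderiv_comm hx α β,
    chr_symm hs _ 1 0]
  ring

end PlaneMetric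

/-! ### Curvature and the variation of turning and speed for a plane metric -/

section PlaneVariation

variable {E : Type*} [NormedAddCommGroup E] [NormedSpace ℝ E]
  {g : Plane → Matrix (Fin 2) (Fin 2) ℝ} {y : Plane}

theorem quad_add_left (A : Matrix (Fin 2) (Fin 2) ℝ) (u v w : Plane) :
    quad A (u + v) w = quad A u w + quad A v w := by
  simp [quad]; ring

theorem quad_add_right (A : Matrix (Fin 2) (Fin 2) ℝ) (u v w : Plane) :
    quad A u (v + w) = quad A u v + quad A u w := by
  simp [quad]; ring

theorem quad_smul_left (A : Matrix (Fin 2) (Fin 2) ℝ) (c : ℝ) (u v : Plane) :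
    quad A (c • u) v = c * quad A u v := by
  simp [quad]; ring

theorem quad_smul_right (A : Matrix (Fin 2) (Fin 2) ℝ) (c : ℝ) (u v : Plane) :
    quad A u (c • v) = c * quad A u v := by
  simp [quad]; ring

theorem quad_comm (hs : ∀ y i j, g y i j = g y j i) (u v : Plane) :
    quad (g y) u v = quad (g y) v u := by
  simp only [quad, hs y 1 0]; ring

theorem contDiffAt_det {n : WithTop ℕ∞} (hg : ∀ i j, ContDiffAt ℝ n (fun z => g z i j) y) :
    ContDiffAt ℝ n (fun z => (g z).det) y := by
  simp only [Matrix.det_fin_two]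
  exact ((hg 0 0).mul (hg 1 1)).sub ((hg 0 1).mul (hg 1 0))

theorem contDiffAt_inv_entry {n : WithTop ℕ∞} (hg : ∀ i j, ContDiffAt ℝ n (fun z => g z i j) y)
    (hdet : (g y).det ≠ 0) (i j : Fin 2) : ContDiffAt ℝ n (fun z => (g z)⁻¹ i j) y := by
  simp only [Matrix.inv_def, Ring.inverse_eq_inv', Matrix.smul_apply, smul_eq_mul]
  refine ((contDiffAt_det hg).inv hdet).mul ?_
  simp only [Matrix.adjugate_fin_two]
  fin_cases i <;> fin_cases j <;> simp [hg, (hg _ _).neg]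

theorem contDiffAt_partialDeriv {f : Plane → ℝ} (hf : ContDiffAt ℝ ∞ f y) (i : Fin 2) :
    ContDiffAt ℝ ∞ (partialDeriv i f) y :=
  (hf.fderiv_right (m := ∞) (by simp)).clm_apply contDiffAt_const

theorem contDiffAt_chr (hg : ∀ i j, ContDiffAt ℝ ∞ (fun z => g z i j) y)
    (hdet : (g y).det ≠ 0) (k i j : Fin 2) : ContDiffAt ℝ ∞ (chr g k i j) y := by
  refine contDiffAt_const.mul (ContDiffAt.sum fun l _ => (contDiffAt_inv_entry hg hdet k l).mul ?_)
  exact ((contDiffAt_partialDeriv (hg _ _) _).add (contDiffAt_partialDeriv (hg _ _) _)).sub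
    (contDiffAt_partialDeriv (hg _ _) _)

theorem contDiffAt_coord {n : WithTop ℕ∞} {X : E → Plane} {q : E} (hX : ContDiffAt ℝ n X q)
    (i : Fin 2) : ContDiffAt ℝ n (fun p => X p i) q :=
  (EuclideanSpace.proj i : Plane →L[ℝ] ℝ).contDiff.contDiffAt.comp q hX

theorem contDiffAt_quad {n : WithTop ℕ∞} {x X Y : E → Plane} {q : E}
    (hg : ∀ i j, ContDiffAt ℝ n (fun z => g z i j) (x q)) (hx : ContDiffAt ℝ n x q)
    (hX : ContDiffAt ℝ n X q) (hY : ContDiffAt ℝ n Y q) :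
    ContDiffAt ℝ n (fun p => quad (g (x p)) (X p) (Y p)) q := by
  have h := fun i j => (((hg i j).comp q hx).mul (contDiffAt_coord hX i)).mul (contDiffAt_coord hY j)
  exact (((h 0 0).add (h 0 1)).add (h 1 0)).add (h 1 1)

theorem contDiffAt_cross {n : WithTop ℕ∞} {X Y : E → Plane} {q : E}
    (hX : ContDiffAt ℝ n X q) (hY : ContDiffAt ℝ n Y q) :
    ContDiffAt ℝ n (fun p => cross (X p) (Y p)) q :=
  ((contDiffAt_coord hX 0).mul (contDiffAt_coord hY 1)).sub
    ((contDiffAt_coord hX 1).mul (contDiffAt_coord hY 0))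

theorem contDiffAt_sqrt_det {n : WithTop ℕ∞} {x : E → Plane} {q : E}
    (hg : ∀ i j, ContDiffAt ℝ n (fun z => g z i j) (x q)) (hx : ContDiffAt ℝ n x q)
    (hdet : (g (x q)).det ≠ 0) : ContDiffAt ℝ n (fun p => √(g (x p)).det) q :=
  ((contDiffAt_det hg).comp q hx).sqrt hdet

theorem contDiffAt_covD {n m : WithTop ℕ∞} (hmn : m + 1 ≤ n) (hn : n ≤ ∞) {x X : E → Plane} {q : E}
    (hg : ∀ i j, ContDiffAt ℝ ∞ (fun z => g z i j) (x q)) (hdet : (g (x q)).det ≠ 0)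
    (hx : ContDiffAt ℝ n x q) (hX : ContDiffAt ℝ n X q) (δ : E) :
    ContDiffAt ℝ m (fun p => covD g x X p δ) q := by
  have hmn' : m ≤ n := le_trans le_self_add hmn
  refine contDiffAt_euclidean.2 fun k => ?_
  simp only [covD_apply]
  have hx1 : ContDiffAt ℝ m (fun p => fderiv ℝ x p δ) q :=
    (hx.fderiv_right hmn).clm_apply contDiffAt_const
  have hX1 : ContDiffAt ℝ m (fun p => fderiv ℝ X p δ) q :=
    (hX.fderiv_right hmn).clm_apply contDiffAt_const
  have h := fun i j => ((((contDiffAt_chr hg hdet k i j).of_le (hmn'.trans hn)).comp q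
    (hx.of_le hmn')).mul (contDiffAt_coord hx1 i)).mul (contDiffAt_coord (hX.of_le hmn') j)
  exact (contDiffAt_coord hX1 k).add (((h 0 0).add (h 0 1)).add ((h 1 0).add (h 1 1)))

theorem cross_stdVec : cross (stdVec 0) (stdVec 1) = 1 := by simp [cross, stdVec]

theorem eventually_det_ne_zero (hg : ∀ i j, ContDiffAt ℝ ∞ (fun z => g z i j) y)
    (hdet : (g y).det ≠ 0) : ∀ᶠ z in 𝓝 y, (g z).det ≠ 0 :=
  (contDiffAt_det hg).continuousAt.eventually_ne hdet

theorem eventually_contDiffAt_of_top {F : Type*} [NormedAddCommGroup F] [NormedSpace ℝ F]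
    {f : E → F} {q : E} (hf : ContDiffAt ℝ ∞ f q) (n : ℕ) : ∀ᶠ p in 𝓝 q, ContDiffAt ℝ n f p :=
  (hf.of_le (m := n) (by exact_mod_cast le_top)).eventually (by simp)

/-- The curvature operator is skew-adjoint. -/
theorem quad_curvVec (hs : ∀ y i j, g y i j = g y j i)
    (hg : ∀ i j, ContDiffAt ℝ ∞ (fun z => g z i j) y) (hdet : (g y).det ≠ 0) (u v : Plane) :
    quad (g y) (curvVec g y u) v + quad (g y) u (curvVec g y v) = 0 := by
  have hg1 : ∀ᶠ z in 𝓝 y, ∀ i j, DifferentiableAt ℝ (fun z => g z i j) z := by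
    simp only [Filter.eventually_all]
    exact fun i j => (eventually_contDiffAt_of_top (hg i j) 1).mono fun z hz =>
      hz.differentiableAt (by simp)
  have hid : ∀ z, ContDiffAt ℝ 2 (fun z : Plane => z) z := fun z => contDiffAt_id
  have hc : ∀ (u z : Plane), ContDiffAt ℝ 2 (fun _ : Plane => u) z := fun u z => contDiffAt_const
  have hΓ : ∀ k i j, DifferentiableAt ℝ (chr g k i j) y := fun k i j =>
    (contDiffAt_chr hg hdet k i j).differentiableAt (by simp)
  have hd1 : ∀ u δ, DifferentiableAt ℝ (fun p => covD g (fun z => z) (fun _ => u) p δ) y :=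
    fun u δ => (hasFDerivAt_covD hΓ (hid y) (hc u y) δ δ).1
  have h1 : ∀ δ, (fun z => fderiv ℝ (fun p => quad (g p) u v) z δ) =ᶠ[𝓝 y]
      fun z => quad (g z) (covD g (fun z => z) (fun _ => u) z δ) v
        + quad (g z) u (covD g (fun z => z) (fun _ => v) z δ) := fun δ => by
    filter_upwards [hg1, eventually_det_ne_zero hg hdet] with z hz hz'
    exact fderiv_quad (x := fun z => z) (X := fun _ => u) (Y := fun _ => v) hs hz' hz
      (by fun_prop) (by fun_prop) (by fun_prop) δ
  have hq : ∀ {X Y : Plane → Plane}, DifferentiableAt ℝ X y → DifferentiableAt ℝ Y y →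
      DifferentiableAt ℝ (fun z => quad (g z) (X z) (Y z)) y := fun {X Y} hX hY => by
    have h := fun i j => ((hg1.self_of_nhds i j).mul (hasFDerivAt_coord hX i).differentiableAt).mul
      (hasFDerivAt_coord hY j).differentiableAt
    exact (((h 0 0).add (h 0 1)).add (h 1 0)).add (h 1 1)
  -- The plane is its own parameter space here and `u`, `v` are constant fields. Using ∇g = 0 twice
  -- expresses the Hessian of g(u, v) by second covariant derivatives.
  have h2 : ∀ α β, fderiv ℝ (fun z => fderiv ℝ (fun p => quad (g p) u v) z α) y β = _ :=
    fun α β => by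
      rw [(h1 α).fderiv_eq, fderiv_fun_add (hq (hd1 _ _) (by fun_prop)) (hq (by fun_prop) (hd1 _ _)),
        _root_.add_apply,
        fderiv_quad (x := fun z => z) (X := fun z => covD g (fun z => z) (fun _ => u) z α)
          (Y := fun _ => v) hs hdet hg1.self_of_nhds (by fun_prop) (hd1 _ _) (by fun_prop) β,
        fderiv_quad (x := fun z => z) (X := fun _ => u)
          (Y := fun z => covD g (fun z => z) (fun _ => v) z α)
          hs hdet hg1.self_of_nhds (by fun_prop) (by fun_prop) (hd1 _ _) β]
  have h3 : ContDiffAt ℝ 2 (fun p => quad (g p) u v) y :=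
    (contDiffAt_quad (x := fun z => z) (X := fun _ => u) (Y := fun _ => v) hg contDiffAt_id
      contDiffAt_const contDiffAt_const).of_le ENat.LEInfty.out
  -- The Hessian of g(u, v) is symmetric, so the commutator of covariant derivatives acts on the
  -- pair with total zero.
  have h4 := fderiv_fderiv_comm h3 (stdVec 1) (stdVec 0)
  have h5 := fun u => covD_covD_sub (x := fun z => z) (X := fun _ => u) hs hΓ (hid y) (hc u y)
    (stdVec 1) (stdVec 0)
  rw [h2, h2, h5, h5] at h4
  simp only [quad_add_left, quad_add_right, quad_smul_left, quad_smul_right, fderiv_fun_id,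
    ContinuousLinearMap.id_apply, cross_stdVec] at h4
  linarith

/-- The Gauss curvature of a metric on the plane. -/
def gaussPlane (g : Plane → Matrix (Fin 2) (Fin 2) ℝ) (y : Plane) : ℝ :=
  (∑ l, curv g l 1 0 1 y * g y l 0) / (g y).det

/-- In dimension two a skew-adjoint operator is a multiple of the rotation by a right angle;
evaluating on the basis identifies the multiple with the Gauss curvature. -/
theorem cross_curvVec (hs : ∀ y i j, g y i j = g y j i)
    (hg : ∀ i j, ContDiffAt ℝ ∞ (fun z => g z i j) y) (hdet : (g y).det ≠ 0) (u : Plane) :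
    cross u (curvVec g y u) = - gaussPlane g y * quad (g y) u u := by
  have h := fun i j => quad_curvVec hs hg hdet (stdVec i) (stdVec j)
  have h0 : ∀ i, stdVec i 0 = if i = 0 then 1 else 0 := fun i => by fin_cases i <;> simp [stdVec]
  have h1 : ∀ i, stdVec i 1 = if i = 0 then 0 else 1 := fun i => by fin_cases i <;> simp [stdVec]
  simp only [quad, curvVec, h0, h1, hs y 1 0] at h
  have h00 := h 0 0
  have h01 := h 0 1
  have h11 := h 1 1
  simp only [if_pos, if_neg, one_ne_zero, not_false_eq_true] at h00 h01 h11
  rw [gaussPlane]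
  simp only [quad, curvVec, cross, Fin.sum_univ_two, hs y 1 0]
  field_simp
  rw [det_fin_two_eq hs]
  -- The three relations are skew-adjointness tested on the pairs (∂₁, ∂₁), (∂₁, ∂₂) and (∂₂, ∂₂).
  linear_combination (u 0 ^ 2 * g y 0 0 + u 0 * u 1 * g y 0 1) * h01
    - (u 0 ^ 2 * g y 0 1 + u 0 * u 1 * g y 1 1) / 2 * h00
    + (u 0 * u 1 * g y 0 0 + u 1 ^ 2 * g y 0 1) / 2 * h11

/-- The turning `ω(v, ∇_β v) / |v|²` in the direction `β` of the velocity `v` in the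
direction `α`. -/
def turn (g : Plane → Matrix (Fin 2) (Fin 2) ℝ) (x : E → Plane) (α β q : E) : ℝ :=
  √(g (x q)).det * cross (fderiv ℝ x q α) (covD g x (fun p => fderiv ℝ x p α) q β)
    / quad (g (x q)) (fderiv ℝ x q α) (fderiv ℝ x q α)

/-- The length of the velocity in the direction `α`. -/
def speed (g : Plane → Matrix (Fin 2) (Fin 2) ℝ) (x : E → Plane) (α q : E) : ℝ :=
  √(quad (g (x q)) (fderiv ℝ x q α) (fderiv ℝ x q α))

/-- The tangential component of the velocity in the direction `β`. -/
def tangential (g : Plane → Matrix (Fin 2) (Fin 2) ℝ) (x : E → Plane) (α β q : E) : ℝ :=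
  quad (g (x q)) (fderiv ℝ x q β) (fderiv ℝ x q α) / speed g x α q

theorem fderiv_div_apply {f h : E → ℝ} {q : E} (hf : DifferentiableAt ℝ f q)
    (hh : DifferentiableAt ℝ h q) (h0 : h q ≠ 0) (δ : E) :
    fderiv ℝ (fun p => f p / h p) q δ
      = (fderiv ℝ f q δ * h q - f q * fderiv ℝ h q δ) / h q ^ 2 := by
  simp only [div_eq_mul_inv]
  rw [fderiv_fun_mul hf (hh.fun_inv h0)]
  have h1 : HasFDerivAt (fun p => (h p)⁻¹) _ q :=
    (hasDerivAt_inv h0).comp_hasFDerivAt q hh.hasFDerivAt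
  rw [h1.fderiv]
  simp only [_root_.add_apply, _root_.smul_apply, smul_eq_mul]
  field_simp
  ring

section

variable {x : E → Plane} {q : E} (hg : ∀ i j, ContDiffAt ℝ ∞ (fun z => g z i j) (x q))
  (hx : ContDiffAt ℝ 3 x q) {α : E} (hv : 0 < quad (g (x q)) (fderiv ℝ x q α) (fderiv ℝ x q α))

include hg hx hv

theorem contDiffAt_turn (hdet : (g (x q)).det ≠ 0) (β : E) :
    ContDiffAt ℝ 1 (turn g x α β) q := by
  have hx1 : ContDiffAt ℝ 1 x q := hx.of_le (by norm_num)
  have hg1 : ∀ i j, ContDiffAt ℝ 1 (fun z => g z i j) (x q) := fun i j => (hg i j).of_le (by simp)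
  have hv2 : ContDiffAt ℝ 2 (fun p => fderiv ℝ x p α) q :=
    (hx.fderiv_right (by norm_num)).clm_apply contDiffAt_const
  have hv1 := hv2.of_le (show (1 : WithTop ℕ∞) ≤ 2 by norm_num)
  exact ((contDiffAt_sqrt_det hg1 hx1 hdet).mul (contDiffAt_cross hv1
    (contDiffAt_covD (n := 2) (by norm_num) ENat.LEInfty.out hg hdet
      (hx.of_le (by norm_num)) hv2 β))).div (contDiffAt_quad hg1 hx1 hv1 hv1) hv.ne'

theorem contDiffAt_speed : ContDiffAt ℝ 1 (speed g x α) q := by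
  have hx1 : ContDiffAt ℝ 1 x q := hx.of_le (by norm_num)
  have hg1 : ∀ i j, ContDiffAt ℝ 1 (fun z => g z i j) (x q) := fun i j => (hg i j).of_le (by simp)
  have hv1 : ContDiffAt ℝ 1 (fun p => fderiv ℝ x p α) q :=
    (hx.fderiv_right (by norm_num)).clm_apply contDiffAt_const
  exact (contDiffAt_quad hg1 hx1 hv1 hv1).sqrt hv.ne'

theorem contDiffAt_tangential (β : E) : ContDiffAt ℝ 1 (tangential g x α β) q := by
  have hx1 : ContDiffAt ℝ 1 x q := hx.of_le (by norm_num)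
  have hg1 : ∀ i j, ContDiffAt ℝ 1 (fun z => g z i j) (x q) := fun i j => (hg i j).of_le (by simp)
  have hv1 : ∀ α, ContDiffAt ℝ 1 (fun p => fderiv ℝ x p α) q := fun α =>
    (hx.fderiv_right (by norm_num)).clm_apply contDiffAt_const
  exact (contDiffAt_quad hg1 hx1 (hv1 β) (hv1 α)).div (contDiffAt_speed hg hx hv)
    (Real.sqrt_pos.2 hv).ne'

/-- The first variation of the turning. -/
theorem fderiv_turn_sub (hs : ∀ y i j, g y i j = g y j i) (hdet : 0 < (g (x q)).det) (β : E) :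
    fderiv ℝ (turn g x α α) q β - fderiv ℝ (turn g x α β) q α
      = gaussPlane g (x q) * (√(g (x q)).det * cross (fderiv ℝ x q α) (fderiv ℝ x q β)) := by
  have hx2 : ContDiffAt ℝ 2 x q := hx.of_le (by norm_num)
  have hxd : DifferentiableAt ℝ x q := hx2.differentiableAt (by norm_num)
  have hgd : ∀ i j, DifferentiableAt ℝ (fun z => g z i j) (x q) := fun i j =>
    (hg i j).differentiableAt (by simp)
  have hΓ : ∀ k i j, DifferentiableAt ℝ (chr g k i j) (x q) := fun k i j =>
    (contDiffAt_chr hg hdet.ne' k i j).differentiableAt (by simp)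
  have hv2 : ContDiffAt ℝ 2 (fun p => fderiv ℝ x p α) q :=
    (hx.fderiv_right (by norm_num)).clm_apply contDiffAt_const
  have hvd := hv2.differentiableAt (by norm_num)
  have hcd := fun δ => (hasFDerivAt_covD hΓ hx2 hv2 δ δ).1
  have hquad : DifferentiableAt ℝ
      (fun p => quad (g (x p)) (fderiv ℝ x p α) (fderiv ℝ x p α)) q :=
    (contDiffAt_quad (fun i j => (hg i j).of_le (by simp)) (hx.of_le (by norm_num))
      (hv2.of_le (by norm_num)) (hv2.of_le (by norm_num))).differentiableAt one_ne_zero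
  have harea : ∀ δ, DifferentiableAt ℝ (fun p => √(g (x p)).det * cross (fderiv ℝ x p α)
      (covD g x (fun p => fderiv ℝ x p α) p δ)) q := fun δ =>
    (fderiv_sqrt_det hs hdet hgd hxd δ).1.differentiableAt.mul
      (((hasFDerivAt_coord hvd 0).differentiableAt.mul
        (hasFDerivAt_coord (hcd δ) 1).differentiableAt).sub
      ((hasFDerivAt_coord hvd 1).differentiableAt.mul
        (hasFDerivAt_coord (hcd δ) 0).differentiableAt))
  have key := fun δ ε => fderiv_div_apply (harea δ) hquad hv.ne' ε
  have h1 := fun δ => fderiv_area hs hdet hgd hxd hvd (hcd δ)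
  simp only [h1, fderiv_quad hs hdet.ne' hgd hxd hvd hvd] at key
  change ∀ δ ε, fderiv ℝ (turn g x α δ) q ε = _ at key
  -- Exchanging the two covariant derivatives of the velocity is the only source of curvature.
  rw [key, key, covD_covD_sub hs hΓ hx2 hv2 α β]
  have h1 := cross_curvVec hs hg hdet.ne' (fderiv ℝ x q α)
  set v := fderiv ℝ x q α
  set w := fderiv ℝ x q β
  set a := covD g x (fun p => fderiv ℝ x p α) q α
  set b := covD g x (fun p => fderiv ℝ x p α) q β
  set c := covD g x (fun p => covD g x (fun p => fderiv ℝ x p α) p β) q α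
  have h2 : cross v (c + cross w v • curvVec g (x q) v)
      = cross v c + cross v w * gaussPlane g (x q) * quad (g (x q)) v v := by
    have : cross v (c + cross w v • curvVec g (x q) v)
        = cross v c + cross w v * cross v (curvVec g (x q) v) := by
      simp [cross]; ring
    rw [this, h1]
    simp only [cross]; ring
  -- The linear relation between the three plane vectors `v`, `a`, `b`, paired with `v`. It cancels
  -- the terms quadratic in first covariant derivatives: those of the area form of `a` and `b`
  -- against those from differentiating |v|².
  have h3 : cross v a * quad (g (x q)) b v - cross v b * quad (g (x q)) a v
      = quad (g (x q)) v v * cross b a := by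
    simp only [cross, quad]; ring
  rw [h2, quad_comm hs v a, quad_comm hs v b]
  have h4 : cross b a = - cross a b := by simp only [cross]; ring
  rw [h4] at h3 ⊢
  field_simp
  linear_combination (-2) * h3

/-- The first variation of the speed. -/
theorem fderiv_speed_sub (hs : ∀ y i j, g y i j = g y j i) (hdet : 0 < (g (x q)).det) (β : E) :
    fderiv ℝ (speed g x α) q β - fderiv ℝ (tangential g x α β) q α
      = - (turn g x α α q / speed g x α q)
        * (√(g (x q)).det * cross (fderiv ℝ x q α) (fderiv ℝ x q β)) := by
  have hx2 : ContDiffAt ℝ 2 x q := hx.of_le (by norm_num)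
  have hxd : DifferentiableAt ℝ x q := hx2.differentiableAt (by norm_num)
  have hgd : ∀ i j, DifferentiableAt ℝ (fun z => g z i j) (x q) := fun i j =>
    (hg i j).differentiableAt (by simp)
  have hv1 : ∀ α, ContDiffAt ℝ 1 (fun p => fderiv ℝ x p α) q := fun α =>
    (hx.fderiv_right (by norm_num)).clm_apply contDiffAt_const
  have hvd := fun α => (hv1 α).differentiableAt one_ne_zero
  have hquad : ∀ β, DifferentiableAt ℝ
      (fun p => quad (g (x p)) (fderiv ℝ x p β) (fderiv ℝ x p α)) q := fun β =>
    (contDiffAt_quad (fun i j => (hg i j).of_le (by simp)) (hx.of_le (by norm_num))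
      (hv1 β) (hv1 α)).differentiableAt one_ne_zero
  have hs1 : ∀ ε, fderiv ℝ (speed g x α) q ε = _ := fun ε => by
    have := ((hquad α).hasFDerivAt.sqrt hv.ne').fderiv
    change fderiv ℝ (speed g x α) q = _ at this
    rw [this, _root_.smul_apply, fderiv_quad hs hdet.ne' hgd hxd (hvd α) (hvd α) ε]
  have ht := fderiv_div_apply (hquad β)
    ((contDiffAt_speed hg hx hv).differentiableAt one_ne_zero) (Real.sqrt_pos.2 hv).ne' α
  rw [fderiv_quad hs hdet.ne' hgd hxd (hvd β) (hvd α) α, hs1] at ht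
  change fderiv ℝ (tangential g x α β) q α = _ at ht
  -- By torsion-freeness ∇_α of the β-velocity is ∇_β of the α-velocity, so the terms with `b`
  -- cancel and only the acceleration `a` is left.
  rw [hs1, ht, covD_fderiv_comm hs hx2 β α, turn, speed]
  set v := fderiv ℝ x q α
  set w := fderiv ℝ x q β
  set a := covD g x (fun p => fderiv ℝ x p α) q α
  set b := covD g x (fun p => fderiv ℝ x p α) q β
  -- Lagrange's identity: a Gram determinant is det g times a product of two plane areas. It leaves
  -- only the normal parts of `a` and `w`.
  have h3 : quad (g (x q)) w a * quad (g (x q)) v v - quad (g (x q)) w v * quad (g (x q)) a v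
      = (g (x q)).det * (cross v w * cross v a) := by
    rw [det_fin_two_eq hs]
    simp only [cross, quad, hs (x q) 1 0]; ring
  have h4 : √(g (x q)).det ^ 2 = (g (x q)).det := Real.sq_sqrt hdet.le
  have h5 : √(quad (g (x q)) v v) ^ 2 = quad (g (x q)) v v := Real.sq_sqrt hv.le
  have h6 : √(quad (g (x q)) v v) ≠ 0 := (Real.sqrt_pos.2 hv).ne'
  rw [← h4, ← h5] at h3
  rw [quad_comm hs v a, quad_comm hs v b]
  generalize √(quad (g (x q)) v v) = S at *
  simp only [smul_eq_mul, ← h5]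
  field_simp
  linear_combination (-2) * h3

end

end PlaneVariation

/-! ### Invariance of the Levi-Civita connection under changes of coordinates -/

section PlaneChange

variable {E : Type*} [NormedAddCommGroup E] [NormedSpace ℝ E]
  {g g' : Plane → Matrix (Fin 2) (Fin 2) ℝ} {y : Plane} {φ : Plane → Plane}

theorem quad_sub_left (A : Matrix (Fin 2) (Fin 2) ℝ) (u v w : Plane) :
    quad A (u - v) w = quad A u w - quad A v w := by
  simp [quad]; ring

theorem chrVec_symm (hs : ∀ y i j, g y i j = g y j i) (u v : Plane) :
    chrVec g y u v = chrVec g y v u := by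
  ext k
  simp only [chrVec, Fin.sum_univ_two, chr_symm hs _ 1 0]
  ring

theorem covD_const (u δ : Plane) : covD g (fun z => z) (fun _ => u) y δ = chrVec g y δ u := by
  simp [covD]

/-- The transformation law of the Christoffel symbols under a change of coordinates. -/
theorem fderiv_fderiv_add_chrVec (hs : ∀ y i j, g y i j = g y j i)
    (hs' : ∀ y i j, g' y i j = g' y j i)
    (hg : ∀ i j, DifferentiableAt ℝ (fun z => g z i j) y)
    (hg' : ∀ i j, DifferentiableAt ℝ (fun z => g' z i j) (φ y))
    (hdet : (g y).det ≠ 0) (hdet' : (g' (φ y)).det ≠ 0)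
    (hpos : ∀ u, u ≠ 0 → 0 < quad (g' (φ y)) u u)
    (hφ : ContDiffAt ℝ 2 φ y) (hsurj : Function.Surjective (fderiv ℝ φ y))
    (hpull : ∀ᶠ z in 𝓝 y, ∀ u v,
      quad (g z) u v = quad (g' (φ z)) (fderiv ℝ φ z u) (fderiv ℝ φ z v)) (δ u : Plane) :
    fderiv ℝ (fun z => fderiv ℝ φ z u) y δ + chrVec g' (φ y) (fderiv ℝ φ y δ) (fderiv ℝ φ y u)
      = fderiv ℝ φ y (chrVec g y δ u) := by
  have hφd : DifferentiableAt ℝ φ y := hφ.differentiableAt (by norm_num)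
  have hd := fun u => differentiableAt_fderiv_apply hφ u
  -- `C` is the difference of two connections; it vanishes by the argument that proves the
  -- Levi-Civita connection unique.
  set C : Plane → Plane → Plane := fun δ u =>
    covD g' φ (fun z => fderiv ℝ φ z u) y δ - fderiv ℝ φ y (chrVec g y δ u) with hC
  have hsymm : ∀ δ u, C δ u = C u δ := fun δ u => by
    simp only [hC]
    rw [covD_fderiv_comm hs' hφ u δ, chrVec_symm hs]
  have hskew : ∀ δ u w, quad (g' (φ y)) (C δ u) (fderiv ℝ φ y w)
      + quad (g' (φ y)) (C δ w) (fderiv ℝ φ y u) = 0 := fun δ u w => by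
    have h1 := fderiv_quad (x := fun z => z) (X := fun _ => u) (Y := fun _ => w) hs hdet hg
      (by fun_prop) (by fun_prop) (by fun_prop) δ
    have h2 := fderiv_quad (x := φ) hs' hdet' hg' hφd (hd u) (hd w) δ
    have h3 : (fun z => quad (g z) u w) =ᶠ[𝓝 y]
        fun z => quad (g' (φ z)) (fderiv ℝ φ z u) (fderiv ℝ φ z w) := hpull.mono fun z hz => hz u w
    rw [h3.fderiv_eq, h2, covD_const, covD_const, hpull.self_of_nhds, hpull.self_of_nhds] at h1
    simp only [hC, quad_sub_left]
    rw [quad_comm hs' (fderiv ℝ φ y u)] at h1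
    rw [quad_comm hs' (fderiv ℝ φ y u) (fderiv ℝ φ y (chrVec g y δ w))] at h1
    linarith
  -- A trilinear expression symmetric in its first two arguments and skew in its last two is zero:
  -- go round the cyclic permutations.
  have hzero : ∀ a b c, quad (g' (φ y)) (C a b) (fderiv ℝ φ y c) = 0 := fun a b c => by
    have h1 := hskew a b c
    have h2 := hskew b c a
    have h3 := hskew c a b
    rw [hsymm a c] at h1
    rw [hsymm b a] at h2
    rw [hsymm c b] at h3
    linarith
  have : C δ u = 0 := by
    by_contra hne
    obtain ⟨c, hc⟩ := hsurj (C δ u)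
    have := hpos _ hne
    nth_rewrite 2 [← hc] at this
    exact this.ne' (hzero _ _ _)
  exact sub_eq_zero.1 this

/-- Covariant derivatives do not depend on the coordinates. -/
theorem covD_comp (hs : ∀ y i j, g y i j = g y j i) (hs' : ∀ y i j, g' y i j = g' y j i)
    {x X : E → Plane} {q : E}
    (hg : ∀ i j, DifferentiableAt ℝ (fun z => g z i j) (x q))
    (hg' : ∀ i j, DifferentiableAt ℝ (fun z => g' z i j) (φ (x q)))
    (hdet : (g (x q)).det ≠ 0) (hdet' : (g' (φ (x q))).det ≠ 0)
    (hpos : ∀ u, u ≠ 0 → 0 < quad (g' (φ (x q))) u u)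
    (hφ : ContDiffAt ℝ 2 φ (x q)) (hsurj : Function.Surjective (fderiv ℝ φ (x q)))
    (hpull : ∀ᶠ z in 𝓝 (x q), ∀ u v,
      quad (g z) u v = quad (g' (φ z)) (fderiv ℝ φ z u) (fderiv ℝ φ z v))
    (hx : DifferentiableAt ℝ x q) (hX : DifferentiableAt ℝ X q) (δ : E) :
    covD g' (fun p => φ (x p)) (fun p => fderiv ℝ φ (x p) (X p)) q δ
      = fderiv ℝ φ (x q) (covD g x X q δ) := by
  have hφd : DifferentiableAt ℝ φ (x q) := hφ.differentiableAt (by norm_num)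
  have hφ1 : DifferentiableAt ℝ (fderiv ℝ φ) (x q) :=
    (hφ.fderiv_right (m := 1) (by norm_num)).differentiableAt (by norm_num)
  have h1 : fderiv ℝ (fun p => φ (x p)) q δ = fderiv ℝ φ (x q) (fderiv ℝ x q δ) := by
    have := (hφd.hasFDerivAt.comp q hx.hasFDerivAt).fderiv
    simp only [Function.comp_def] at this
    rw [this]; rfl
  have h2 : fderiv ℝ (fun p => fderiv ℝ φ (x p) (X p)) q δ
      = fderiv ℝ φ (x q) (fderiv ℝ X q δ)
        + fderiv ℝ (fun z => fderiv ℝ φ z (X q)) (x q) (fderiv ℝ x q δ) := by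
    have h3 := (hφ1.hasFDerivAt.comp q hx.hasFDerivAt).clm_apply hX.hasFDerivAt
    simp only [Function.comp_def] at h3
    rw [h3.fderiv, fderiv_clm_apply hφ1 (by fun_prop)]
    simp
  rw [covD, covD, h1, h2, map_add, ← fderiv_fderiv_add_chrVec hs hs' hg hg' hdet hdet' hpos hφ hsurj
    hpull]
  abel

end PlaneChange

/-! ### Differentials of charts and of coordinate changes -/

section ChartDerivative

variable {M : Type*} [TopologicalSpace M] [ChartedSpace Plane M]

/-- The derivative at `x` of the preferred chart at `p`. -/
def chartD (p x : M) : TangentSpace (𝓡 2) x →L[ℝ] Plane :=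
  mfderiv (𝓡 2) 𝓘(ℝ, Plane) (extChartAt (𝓡 2) p) x

/-- The derivative at `y` of the inverse of the preferred chart at `p`. -/
def chartDSymm (p : M) (y : Plane) :
    Plane →L[ℝ] TangentSpace (𝓡 2) ((extChartAt (𝓡 2) p).symm y) :=
  mfderiv 𝓘(ℝ, Plane) (𝓡 2) (extChartAt (𝓡 2) p).symm y

variable [IsManifold (𝓡 2) ∞ M]

theorem isManifold_one : IsManifold (𝓡 2) 1 M := IsManifold.of_le (n := ∞) (by simp)

theorem chartD_chartDSymm {p : M} {y : Plane} (hy : y ∈ (extChartAt (𝓡 2) p).target) (u : Plane) :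
    chartD p ((extChartAt (𝓡 2) p).symm y) (chartDSymm p y u) = u := by
  have := isManifold_one (M := M)
  have h := mfderiv_extChartAt_comp_mfderivWithin_extChartAt_symm (I := 𝓡 2) hy
  simp only [modelWithCornersSelf_coe, range_id, mfderivWithin_univ] at h
  exact DFunLike.congr_fun h u

theorem chartDSymm_chartD {p : M} {y : Plane} (hy : y ∈ (extChartAt (𝓡 2) p).target)
    (X : TangentSpace (𝓡 2) ((extChartAt (𝓡 2) p).symm y)) :
    chartDSymm p y (chartD p ((extChartAt (𝓡 2) p).symm y) X) = X := by
  have := isManifold_one (M := M)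
  have h := mfderivWithin_extChartAt_symm_comp_mfderiv_extChartAt (I := 𝓡 2) hy
  simp only [modelWithCornersSelf_coe, range_id, mfderivWithin_univ] at h
  exact DFunLike.congr_fun h X

theorem chartD_bijective {p x : M} (hx : x ∈ (extChartAt (𝓡 2) p).source) :
    Function.Bijective (chartD p x) := by
  obtain ⟨y, hy, rfl⟩ : ∃ y ∈ (extChartAt (𝓡 2) p).target, (extChartAt (𝓡 2) p).symm y = x :=
    ⟨_, (extChartAt (𝓡 2) p).map_source hx, (extChartAt (𝓡 2) p).left_inv hx⟩
  exact Function.bijective_iff_has_inverse.2 ⟨chartDSymm p y, chartDSymm_chartD hy,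
    chartD_chartDSymm hy⟩

theorem chartD_self (p : M) (X : TangentSpace (𝓡 2) p) : chartD p p X = X := by
  have := isManifold_one (M := M)
  exact DFunLike.congr_fun (mfderiv_extChartAt_self (I := 𝓡 2) (x := p)) X

theorem contMDiffAt_chart {p x : M} (hx : x ∈ (extChartAt (𝓡 2) p).source) :
    ContMDiffAt (𝓡 2) 𝓘(ℝ, Plane) ∞ (extChartAt (𝓡 2) p) x :=
  contMDiffAt_extChartAt' (by rwa [extChartAt_source] at hx)

theorem contMDiffAt_chart_symm {p : M} {y : Plane} (hy : y ∈ (extChartAt (𝓡 2) p).target) :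
    ContMDiffAt 𝓘(ℝ, Plane) (𝓡 2) ∞ (extChartAt (𝓡 2) p).symm y :=
  (contMDiffOn_extChartAt_symm p).contMDiffAt ((isOpen_extChartAt_target p).mem_nhds hy)

variable {E : Type*} [NormedAddCommGroup E] [NormedSpace ℝ E]

/-- A map into the surface, read in a chart, is smooth. -/
theorem contDiffAt_chart_comp {n : WithTop ℕ∞} (hn : n ≤ ∞) {Θ : E → M} {q : E} {p : M}
    (hΘ : ContMDiffAt 𝓘(ℝ, E) (𝓡 2) n Θ q) (hp : Θ q ∈ (extChartAt (𝓡 2) p).source) :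
    ContDiffAt ℝ n (fun z => extChartAt (𝓡 2) p (Θ z)) q :=
  contMDiffAt_iff_contDiffAt.1 (((contMDiffAt_chart hp).of_le hn).comp q hΘ)

omit [IsManifold (𝓡 2) ∞ M] in
theorem eventually_mem_source {X : Type*} [TopologicalSpace X] {Θ : X → M} {q : X} {p : M}
    (hΘ : ContinuousAt Θ q) (hp : Θ q ∈ (extChartAt (𝓡 2) p).source) :
    ∀ᶠ z in 𝓝 q, Θ z ∈ (extChartAt (𝓡 2) p).source :=
  hΘ.eventually ((isOpen_extChartAt_source p).mem_nhds hp)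

/-- The chain rule for a map into the surface, read in a chart. -/
theorem chartD_mfderiv {Θ : E → M} {q : E} {p : M}
    (hΘ : MDifferentiableAt 𝓘(ℝ, E) (𝓡 2) Θ q) (hp : Θ q ∈ (extChartAt (𝓡 2) p).source) (δ : E) :
    chartD p (Θ q) (mfderiv 𝓘(ℝ, E) (𝓡 2) Θ q δ)
      = fderiv ℝ (fun z => extChartAt (𝓡 2) p (Θ z)) q δ := by
  have h := mfderiv_comp q ((contMDiffAt_chart hp).mdifferentiableAt (by simp)) hΘ
  rw [mfderiv_eq_fderiv] at h
  exact (DFunLike.congr_fun h δ).symm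

theorem chartD_velocity {γ : ℝ → M} {t : ℝ} {p : M}
    (hγ : MDifferentiableAt 𝓘(ℝ, ℝ) (𝓡 2) γ t) (hp : γ t ∈ (extChartAt (𝓡 2) p).source) :
    chartD p (γ t) (velocity γ t) = deriv (fun z => extChartAt (𝓡 2) p (γ z)) t :=
  chartD_mfderiv hγ hp 1

/-- The change of coordinates between two charts. -/
def chartChange (p p' : M) (y : Plane) : Plane :=
  extChartAt (𝓡 2) p' ((extChartAt (𝓡 2) p).symm y)

theorem contDiffAt_chartChange {p p' : M} {y : Plane} (hy : y ∈ (extChartAt (𝓡 2) p).target)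
    (hy' : (extChartAt (𝓡 2) p).symm y ∈ (extChartAt (𝓡 2) p').source) :
    ContDiffAt ℝ ∞ (chartChange p p') y :=
  contDiffAt_chart_comp le_rfl (contMDiffAt_chart_symm hy) hy'

theorem fderiv_chartChange {p p' : M} {y : Plane} (hy : y ∈ (extChartAt (𝓡 2) p).target)
    (hy' : (extChartAt (𝓡 2) p).symm y ∈ (extChartAt (𝓡 2) p').source)
    (X : TangentSpace (𝓡 2) ((extChartAt (𝓡 2) p).symm y)) :
    fderiv ℝ (chartChange p p') y (chartD p _ X) = chartD p' _ X := by
  have := chartD_mfderiv ((contMDiffAt_chart_symm hy).mdifferentiableAt (by simp)) hy'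
    (chartD p _ X)
  have hX : mfderiv 𝓘(ℝ, Plane) (𝓡 2) (extChartAt (𝓡 2) p).symm y (chartD p _ X) = X :=
    chartDSymm_chartD hy X
  rw [hX] at this
  exact this.symm

end ChartDerivative

/-! ### The metric read in a chart -/

section ChartMetric

variable {M : Type*} [TopologicalSpace M] [ChartedSpace Plane M]
  [RiemannianBundle (fun x : M => TangentSpace (𝓡 2) x)]

theorem metricMatrix_symm (p : M) (y : Plane) (i j : Fin 2) :
    metricMatrix p y i j = metricMatrix p y j i :=
  real_inner_comm (coordVec p j y) (coordVec p i y)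

theorem quad_metricMatrix (p : M) (y u v : Plane) :
    quad (metricMatrix p y) u v = ⟪chartDSymm p y u, chartDSymm p y v⟫ := by
  have h : ∀ u, chartDSymm p y u = u 0 • coordVec p 0 y + u 1 • coordVec p 1 y := fun u => by
    conv_lhs => rw [eq_sum_stdVec u]
    rw [map_add, map_smul, map_smul]; rfl
  rw [h, h]
  simp only [quad, metricMatrix, Matrix.of_apply, inner_add_left, inner_add_right,
    real_inner_smul_left, real_inner_smul_right]
  ring

variable [IsManifold (𝓡 2) ∞ M]

theorem inner_eq_quad {p x : M} (hx : x ∈ (extChartAt (𝓡 2) p).source)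
    (X Y : TangentSpace (𝓡 2) x) :
    ⟪X, Y⟫ = quad (metricMatrix p (extChartAt (𝓡 2) p x)) (chartD p x X) (chartD p x Y) := by
  obtain ⟨y, hy, rfl⟩ : ∃ y ∈ (extChartAt (𝓡 2) p).target, (extChartAt (𝓡 2) p).symm y = x :=
    ⟨_, (extChartAt (𝓡 2) p).map_source hx, (extChartAt (𝓡 2) p).left_inv hx⟩
  rw [(extChartAt (𝓡 2) p).right_inv hy, quad_metricMatrix, chartDSymm_chartD hy,
    chartDSymm_chartD hy]

theorem quad_metricMatrix_pos {p : M} {y : Plane} (hy : y ∈ (extChartAt (𝓡 2) p).target)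
    {u : Plane} (hu : u ≠ 0) : 0 < quad (metricMatrix p y) u u := by
  rw [quad_metricMatrix]
  refine real_inner_self_pos.2 fun h => hu ?_
  rw [← chartD_chartDSymm hy u, h, map_zero]

theorem det_metricMatrix_pos {p : M} {y : Plane} (hy : y ∈ (extChartAt (𝓡 2) p).target) :
    0 < (metricMatrix p y).det := by
  have h0 : 0 < metricMatrix p y 0 0 := by
    have := quad_metricMatrix_pos hy (u := stdVec 0) (fun h => by
      have := congrArg (fun v : Plane => v 0) h
      simp [stdVec] at this)
    simpa [quad, stdVec] using this
  -- The test vector -g₀₁ ∂₀ + g₀₀ ∂₁ is orthogonal to ∂₀, and its squared length is g₀₀ det g.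
  have h1 := quad_metricMatrix_pos hy (u := (-metricMatrix p y 0 1) • stdVec 0
      + metricMatrix p y 0 0 • stdVec 1) (fun h => by
    have := congrArg (fun v : Plane => v 1) h
    simp [stdVec] at this
    exact h0.ne' this)
  have h2 : 0 < metricMatrix p y 0 0 * (metricMatrix p y).det := by
    rw [det_fin_two_eq (metricMatrix_symm p)]
    simp [quad, stdVec, metricMatrix_symm p y 1 0] at h1
    linarith
  exact (pos_iff_pos_of_mul_pos h2).1 h0

theorem metricMatrix_chartChange {p p' : M} {y : Plane} (hy : y ∈ (extChartAt (𝓡 2) p).target)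
    (hy' : (extChartAt (𝓡 2) p).symm y ∈ (extChartAt (𝓡 2) p').source) (u v : Plane) :
    quad (metricMatrix p y) u v = quad (metricMatrix p' (chartChange p p' y))
      (fderiv ℝ (chartChange p p') y u) (fderiv ℝ (chartChange p p') y v) := by
  rw [quad_metricMatrix, inner_eq_quad hy', ← fderiv_chartChange hy hy',
    ← fderiv_chartChange hy hy', chartD_chartDSymm hy, chartD_chartDSymm hy]
  rfl

/-- Each coordinate field is the tangent map of the inverse chart applied to a constant field, hence
a smooth section; the smooth bundle metric then gives smooth inner products. -/
theorem contDiffAt_metricMatrix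
    [IsContMDiffRiemannianBundle (𝓡 2) ∞ Plane (fun x : M => TangentSpace (𝓡 2) x)]
    {p : M} {y : Plane} (hy : y ∈ (extChartAt (𝓡 2) p).target) (i j : Fin 2) :
    ContDiffAt ℝ ∞ (fun z => metricMatrix p z i j) y := by
  have hopen := isOpen_extChartAt_target (I := 𝓡 2) p
  have h1 := (contMDiffOn_extChartAt_symm (I := 𝓡 2) (n := ∞) p).contMDiffOn_tangentMapWithin
    (m := ∞) (by simp) hopen.uniqueMDiffOn
  have h2 : ∀ i, ContMDiffAt 𝓘(ℝ, Plane) ((𝓡 2).prod 𝓘(ℝ, Plane)) ∞ (fun z : Plane =>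
      (⟨(extChartAt (𝓡 2) p).symm z, coordVec p i z⟩ : TangentBundle (𝓡 2) M)) y := fun i => by
    have h3 : ContMDiff 𝓘(ℝ, Plane) (𝓘(ℝ, Plane).prod 𝓘(ℝ, Plane)) ∞ (fun z : Plane =>
        (⟨z, stdVec i⟩ : TangentBundle 𝓘(ℝ, Plane) Plane)) := by
      intro z
      rw [contMDiffAt_totalSpace]
      exact ⟨contMDiffAt_id, by simpa using contMDiffAt_const⟩
    have h4 := (h1.comp (f := fun z : Plane => (⟨z, stdVec i⟩ : TangentBundle 𝓘(ℝ, Plane) Plane))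
      (s := (extChartAt (𝓡 2) p).target) h3.contMDiffOn fun z hz => hz).contMDiffAt (hopen.mem_nhds hy)
    refine h4.congr_of_eventuallyEq ?_
    filter_upwards [hopen.mem_nhds hy] with z hz
    simp only [Function.comp_def, tangentMapWithin, coordVec]
    rw [mfderivWithin_of_isOpen hopen hz]
  exact contMDiffAt_iff_contDiffAt.1 ((h2 i).inner_bundle (h2 j))

end ChartMetric

/-! ### The area form read in a chart -/

section OrientedSurface

variable {M : Type*} [TopologicalSpace M] [ChartedSpace Plane M]
  [RiemannianBundle (fun x : M => TangentSpace (𝓡 2) x)] [IsManifold (𝓡 2) ∞ M]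

/-- The standard basis of the plane. -/
def planeBasis : Module.Basis (Fin 2) ℝ Plane := (EuclideanSpace.basisFun (Fin 2) ℝ).toBasis

theorem planeBasis_apply (i : Fin 2) : planeBasis i = stdVec i := by
  simp [planeBasis, stdVec]

/-- The area form is the determinant with respect to a positively oriented orthonormal basis, so its
sign decides the orientation of `b`. -/
theorem areaForm_basis_pos_iff {V : Type*} [NormedAddCommGroup V] [InnerProductSpace ℝ V]
    [Fact (Module.finrank ℝ V = 2)] (o : Orientation ℝ V (Fin 2)) (b : Module.Basis (Fin 2) ℝ V) :
    b.orientation = o ↔ 0 < o.areaForm (b 0) (b 1) := by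
  set e := o.finOrthonormalBasis two_pos Fact.out
  have he : e.toBasis.orientation = o := o.finOrthonormalBasis_orientation two_pos Fact.out
  rw [o.areaForm_to_volumeForm, o.volumeForm_robust e he, eq_comm, ← he,
    Module.Basis.orientation_eq_iff_det_pos]
  have : ![b 0, b 1] = b := by ext i; fin_cases i <;> rfl
  rw [this]

theorem areaForm_eq_of_basis {V : Type*} [NormedAddCommGroup V] [InnerProductSpace ℝ V]
    [Fact (Module.finrank ℝ V = 2)] (o : Orientation ℝ V (Fin 2)) (a b : V) (u v : Plane) :
    o.areaForm (u 0 • a + u 1 • b) (v 0 • a + v 1 • b) = cross u v * o.areaForm a b := by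
  simp only [map_add, map_smul, LinearMap.add_apply, LinearMap.smul_apply, smul_eq_mul,
    o.areaForm_apply_self, cross]
  rw [o.areaForm_swap b a]
  ring

/-- In the chart at `p`, the area element is `± √(det g)` times the area element of the plane, with
a constant sign near `p`. -/
theorem exists_areaForm_eq {o : ∀ x : M, Orientation ℝ (TangentSpace (𝓡 2) x) (Fin 2)}
    (ho : IsContinuousOrientation o) (p : M) :
    ∃ s : ℝ, s ^ 2 = 1 ∧ ∀ᶠ x in 𝓝 p, ∀ X Y, (o x).areaForm X Y
      = s * (√(metricMatrix p (extChartAt (𝓡 2) p x)).det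
        * cross (chartD p x X) (chartD p x Y)) := by
  classical
  obtain ⟨o', ho'⟩ := ho p
  refine ⟨if o' = planeBasis.orientation then 1 else -1, by split_ifs <;> norm_num, ?_⟩
  have hsource : ∀ᶠ x in 𝓝 p, x ∈ (extChartAt (𝓡 2) p).source :=
    (isOpen_extChartAt_source p).mem_nhds (mem_extChartAt_source p)
  filter_upwards [ho', hsource] with x hx hxs X Y
  have := isManifold_one (M := M)
  have hxc : x ∈ (chartAt Plane p).source := by rwa [extChartAt_source] at hxs
  have hxb : x ∈ (trivializationAt Plane (TangentSpace (𝓡 2)) p).baseSet := by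
    simpa using hxc
  specialize hx hxb
  set D := ((trivializationAt Plane (TangentSpace (𝓡 2)) p).continuousLinearEquivAt ℝ x
    hxb).toLinearEquiv
  -- The orientation is controlled in the trivialization, the metric in the chart; the two agree
  -- because the trivialization of the tangent bundle is the differential of the chart.
  have hD : ∀ X, D X = chartD p x X := fun X => by
    have h1 := DFunLike.congr_fun (TangentBundle.continuousLinearMapAt_trivializationAt
      (𝕜 := ℝ) (I := 𝓡 2) hxc) X
    rw [chartD, ← h1]
    exact congr_fun ((trivializationAt Plane
      (TangentSpace (𝓡 2)) p).coe_continuousLinearEquivAt_eq (R := ℝ) hxb) X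
  set b := planeBasis.map D.symm
  have hb : ∀ i, chartD p x (b i) = stdVec i := fun i => by
    rw [← hD]; simp [b, planeBasis_apply]
  have hX : ∀ X, X = (chartD p x X) 0 • b 0 + (chartD p x X) 1 • b 1 := fun X => by
    apply (chartD_bijective hxs).1
    rw [map_add, map_smul, map_smul, hb, hb]
    exact eq_sum_stdVec _
  have hdet : 0 < (metricMatrix p (extChartAt (𝓡 2) p x)).det :=
    det_metricMatrix_pos ((extChartAt (𝓡 2) p).map_source hxs)
  -- Size: ⟨a, b⟩² + Ω₂(a, b)² = |a|²|b|² makes Ω₂ of the coordinate vectors a square root of the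
  -- Gram determinant.
  have hsq : (o x).areaForm (b 0) (b 1) ^ 2 = (metricMatrix p (extChartAt (𝓡 2) p x)).det := by
    have h1 := (o x).inner_sq_add_areaForm_sq (b 0) (b 1)
    rw [← real_inner_self_eq_norm_sq, ← real_inner_self_eq_norm_sq, inner_eq_quad hxs,
      inner_eq_quad hxs, inner_eq_quad hxs, hb, hb] at h1
    rw [det_fin_two_eq (metricMatrix_symm p)]
    generalize metricMatrix p (extChartAt (𝓡 2) p x) = A at h1 ⊢
    simp [quad, stdVec] at h1
    linarith
  -- Sign: near `p` the orientation is carried to the fixed `o'`, so whether the coordinate basis is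
  -- positive does not depend on `x`.
  have horient : b.orientation = o x ↔ o' = planeBasis.orientation := by
    rw [Module.Basis.orientation_map, ← Orientation.map_symm, Equiv.symm_apply_eq, hx, eq_comm]
  have hval : (o x).areaForm (b 0) (b 1) = (if o' = planeBasis.orientation then 1 else -1)
      * √(metricMatrix p (extChartAt (𝓡 2) p x)).det := by
    rw [← hsq, Real.sqrt_sq_eq_abs]
    have h1 := areaForm_basis_pos_iff (o x) b
    split_ifs with h
    · rw [abs_of_pos (h1.1 (horient.2 h)), one_mul]
    · rw [abs_of_nonpos (not_lt.1 fun h2 => h (horient.1 (h1.2 h2)))]; ring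
  conv_lhs => rw [hX X, hX Y]
  rw [areaForm_eq_of_basis, hval]
  ring

end OrientedSurface

/-! ### Covariant derivatives along maps into the surface -/

section CovariantDerivative

variable {M : Type*} [TopologicalSpace M] [ChartedSpace Plane M]
  [RiemannianBundle (fun x : M => TangentSpace (𝓡 2) x)]
  {E : Type*} [NormedAddCommGroup E] [NormedSpace ℝ E]

/-- The covariant derivative, in the direction `β`, of the velocity in the direction `α` of a map
into the surface. -/
def covDeriv (Θ : E → M) (q α β : E) : TangentSpace (𝓡 2) (Θ q) :=
  (covD (metricMatrix (Θ q)) (fun z => extChartAt (𝓡 2) (Θ q) (Θ z))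
    (fun z => fderiv ℝ (fun z => extChartAt (𝓡 2) (Θ q) (Θ z)) z α) q β : Plane)

theorem covD_congr {g : Plane → Matrix (Fin 2) (Fin 2) ℝ} {x x' X X' : E → Plane} {q : E}
    (hx : x =ᶠ[𝓝 q] x') (hX : X =ᶠ[𝓝 q] X') (δ : E) : covD g x X q δ = covD g x' X' q δ := by
  rw [covD, covD, hx.fderiv_eq, hX.fderiv_eq, hx.eq_of_nhds, hX.eq_of_nhds]

/-- Makes the acceleration of a curve a special case of the covariant derivative along a map, to
which independence of the chart applies. -/
theorem covAcceleration_eq (γ : ℝ → M) (t : ℝ) : covAcceleration γ t = covDeriv γ t 1 1 := by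
  refine (WithLp.ext_iff 2).2 ?_
  funext k
  simp only [covAcceleration, covDeriv, covD, chrVec]
  rfl

variable [IsManifold (𝓡 2) ∞ M]

omit [RiemannianBundle (fun x : M => TangentSpace (𝓡 2) x)] in
theorem fderiv_chartChange' {p p' x : M} (hx : x ∈ (extChartAt (𝓡 2) p).source)
    (hx' : x ∈ (extChartAt (𝓡 2) p').source) (X : TangentSpace (𝓡 2) x) :
    fderiv ℝ (chartChange p p') (extChartAt (𝓡 2) p x) (chartD p x X) = chartD p' x X := by
  obtain ⟨y, hy, rfl⟩ : ∃ y ∈ (extChartAt (𝓡 2) p).target, (extChartAt (𝓡 2) p).symm y = x :=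
    ⟨_, (extChartAt (𝓡 2) p).map_source hx, (extChartAt (𝓡 2) p).left_inv hx⟩
  rw [(extChartAt (𝓡 2) p).right_inv hy]
  exact fderiv_chartChange hy hx' X

variable [IsContMDiffRiemannianBundle (𝓡 2) ∞ Plane (fun x : M => TangentSpace (𝓡 2) x)]

/-- The covariant derivative read in a chart. -/
theorem chartD_covDeriv {Θ : E → M} {q : E} {p : M} (hΘ : ContMDiffAt 𝓘(ℝ, E) (𝓡 2) 2 Θ q)
    (hp : Θ q ∈ (extChartAt (𝓡 2) p).source) (α β : E) :
    chartD p (Θ q) (covDeriv Θ q α β) = covD (metricMatrix p) (fun z => extChartAt (𝓡 2) p (Θ z))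
      (fun z => fderiv ℝ (fun z => extChartAt (𝓡 2) p (Θ z)) z α) q β := by
  set p₀ := Θ q
  set x : E → Plane := fun z => extChartAt (𝓡 2) p₀ (Θ z)
  have hp₀ : Θ q ∈ (extChartAt (𝓡 2) p₀).source := mem_extChartAt_source p₀
  have hy : x q ∈ (extChartAt (𝓡 2) p₀).target := (extChartAt (𝓡 2) p₀).map_source hp₀
  have hy0 : (extChartAt (𝓡 2) p₀).symm (x q) = Θ q := (extChartAt (𝓡 2) p₀).left_inv hp₀
  have hy' : (extChartAt (𝓡 2) p₀).symm (x q) ∈ (extChartAt (𝓡 2) p).source := by rwa [hy0]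
  have h2 : (2 : WithTop ℕ∞) ≤ ∞ := ENat.LEInfty.out
  have hx : ContDiffAt ℝ 2 x q := contDiffAt_chart_comp h2 hΘ hp₀
  have hφ : ContDiffAt ℝ 2 (chartChange p₀ p) (x q) := (contDiffAt_chartChange hy hy').of_le h2
  -- `covDeriv` is defined in the chart at Θ q; coordinates in the chart at `p` are obtained from it
  -- by the coordinate change, to which `covD_comp` applies.
  have h1 : (fun z => extChartAt (𝓡 2) p (Θ z)) =ᶠ[𝓝 q] fun z => chartChange p₀ p (x z) := by
    filter_upwards [eventually_mem_source hΘ.continuousAt hp₀] with z hz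
    rw [chartChange, (extChartAt (𝓡 2) p₀).left_inv hz]
  have h3 : (fun z => fderiv ℝ (fun z => extChartAt (𝓡 2) p (Θ z)) z α) =ᶠ[𝓝 q]
      fun z => fderiv ℝ (chartChange p₀ p) (x z) (fderiv ℝ x z α) := by
    filter_upwards [h1.eventuallyEq_nhds, hx.eventually (by simp),
      hx.continuousAt.eventually (hφ.eventually (by simp))] with z hz hxz hφz
    rw [hz.fderiv_eq]
    have := ((hφz.differentiableAt (by simp)).hasFDerivAt.comp z
      (hxz.differentiableAt (by simp)).hasFDerivAt).fderiv
    simp only [Function.comp_def] at this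
    rw [this]; rfl
  have hsurj : Function.Surjective (fderiv ℝ (chartChange p₀ p) (x q)) := fun w => by
    obtain ⟨X, hX⟩ := (chartD_bijective hp).2 w
    exact ⟨_, (fderiv_chartChange' hp₀ hp X).trans hX⟩
  have hmem : chartChange p₀ p (x q) ∈ (extChartAt (𝓡 2) p).target :=
    (extChartAt (𝓡 2) p).map_source hy'
  rw [covD_congr h1 h3, covD_comp (metricMatrix_symm p₀) (metricMatrix_symm p)
    (fun i j => (contDiffAt_metricMatrix hy i j).differentiableAt (by simp))
    (fun i j => (contDiffAt_metricMatrix hmem i j).differentiableAt (by simp))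
    (det_metricMatrix_pos hy).ne' (det_metricMatrix_pos hmem).ne'
    (fun u hu => quad_metricMatrix_pos hmem hu) hφ hsurj ?_ (hx.differentiableAt (by simp))
    (differentiableAt_fderiv_apply hx α), ← fderiv_chartChange' hp₀ hp, chartD_self]
  · rfl
  · have hopen : ∀ᶠ z in 𝓝 (x q), z ∈ (extChartAt (𝓡 2) p₀).target :=
      (isOpen_extChartAt_target p₀).mem_nhds hy
    have hcont : ContinuousAt (extChartAt (𝓡 2) p₀).symm (x q) :=
      (contMDiffAt_chart_symm hy).continuousAt
    filter_upwards [hopen, eventually_mem_source hcont hy'] with z hz hz' u v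
    exact metricMatrix_chartChange hz hz' u v

end CovariantDerivative

/-! ### The first variation of the integrand -/

section FirstVariation

variable {M : Type*} [TopologicalSpace M] [ChartedSpace Plane M]
  [RiemannianBundle (fun x : M => TangentSpace (𝓡 2) x)]

/-- The integrand `(κ + m) |γ'|` of the action. -/
def density (o : ∀ x : M, Orientation ℝ (TangentSpace (𝓡 2) x) (Fin 2)) (m : ℝ) (γ : ℝ → M)
    (t : ℝ) : ℝ :=
  (geodesicCurvature o γ t + m) * ‖velocity γ t‖

/-- The boundary term of the first variation of the action. -/
def momentum (o : ∀ x : M, Orientation ℝ (TangentSpace (𝓡 2) x) (Fin 2)) (m : ℝ) (Θ : ℝ → ℝ → M)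
    (q : ℝ × ℝ) : ℝ :=
  (o (Θ q.1 q.2)).areaForm (velocity (fun t => Θ t q.2) q.1)
      (covDeriv (fun q : ℝ × ℝ => Θ q.1 q.2) q (1, 0) (0, 1)) / ‖velocity (fun t => Θ t q.2) q.1‖ ^ 2
    + m * (⟪velocity (fun r => Θ q.1 r) q.2, velocity (fun t => Θ t q.2) q.1⟫
      / ‖velocity (fun t => Θ t q.2) q.1‖)

/-- The integrand of the first variation of the action. -/
def eulerLagrange (o : ∀ x : M, Orientation ℝ (TangentSpace (𝓡 2) x) (Fin 2)) (m : ℝ)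
    (Θ : ℝ → ℝ → M) (t : ℝ) (r : ℝ) : ℝ :=
  (gaussCurvature (Θ t r) - m * geodesicCurvature o (fun t => Θ t r) t)
    * (o (Θ t r)).areaForm (velocity (fun t => Θ t r) t) (velocity (fun r => Θ t r) r)

theorem deriv_slice_fst {F : Type*} [NormedAddCommGroup F] [NormedSpace ℝ F] {f : ℝ × ℝ → F}
    {t r : ℝ} (hf : DifferentiableAt ℝ f (t, r)) :
    HasDerivAt (fun s => f (s, r)) (fderiv ℝ f (t, r) (1, 0)) t :=
  HasFDerivAt.comp_hasDerivAt (f := fun s : ℝ => (s, r)) t hf.hasFDerivAt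
    ((hasDerivAt_id t).prodMk (hasDerivAt_const t r))

theorem deriv_slice_snd {F : Type*} [NormedAddCommGroup F] [NormedSpace ℝ F] {f : ℝ × ℝ → F}
    {t r : ℝ} (hf : DifferentiableAt ℝ f (t, r)) :
    HasDerivAt (fun s => f (t, s)) (fderiv ℝ f (t, r) (0, 1)) r :=
  HasFDerivAt.comp_hasDerivAt (f := fun s : ℝ => (t, s)) r hf.hasFDerivAt
    ((hasDerivAt_const r t).prodMk (hasDerivAt_id r))

theorem eventually_fst {P : ℝ × ℝ → Prop} {t r : ℝ} (h : ∀ᶠ z in 𝓝 (t, r), P z) :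
    ∀ᶠ s in 𝓝 t, P (s, r) :=
  (Continuous.prodMk_left r).continuousAt.eventually h

section

omit [RiemannianBundle (fun x : M => TangentSpace (𝓡 2) x)]

theorem contMDiffAt_slice_fst {n : WithTop ℕ∞} {Θ : ℝ → ℝ → M} {t r : ℝ}
    (hΘ : ContMDiffAt 𝓘(ℝ, ℝ × ℝ) (𝓡 2) n (fun q : ℝ × ℝ => Θ q.1 q.2) (t, r)) :
    ContMDiffAt 𝓘(ℝ, ℝ) (𝓡 2) n (fun t => Θ t r) t :=
  ContMDiffAt.comp (g := fun q : ℝ × ℝ => Θ q.1 q.2) (f := fun s : ℝ => (s, r)) t hΘ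
    (contMDiffAt_iff_contDiffAt.2 (contDiffAt_id.prodMk contDiffAt_const))

theorem contMDiffAt_slice_snd {n : WithTop ℕ∞} {Θ : ℝ → ℝ → M} {t r : ℝ}
    (hΘ : ContMDiffAt 𝓘(ℝ, ℝ × ℝ) (𝓡 2) n (fun q : ℝ × ℝ => Θ q.1 q.2) (t, r)) :
    ContMDiffAt 𝓘(ℝ, ℝ) (𝓡 2) n (fun r => Θ t r) r :=
  ContMDiffAt.comp (g := fun q : ℝ × ℝ => Θ q.1 q.2) (f := fun s : ℝ => (t, s)) r hΘ
    (contMDiffAt_iff_contDiffAt.2 (contDiffAt_const.prodMk contDiffAt_id))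

variable [IsManifold (𝓡 2) ∞ M] {Θ : ℝ → ℝ → M} {t r : ℝ} {p : M}

theorem eventually_contMDiffAt {E : Type*} [NormedAddCommGroup E] [NormedSpace ℝ E] {n : ℕ}
    {f : E → M} {q : E} (hf : ContMDiffAt 𝓘(ℝ, E) (𝓡 2) n f q) :
    ∀ᶠ z in 𝓝 q, ContMDiffAt 𝓘(ℝ, E) (𝓡 2) n f z := by
  have : IsManifold (𝓡 2) n M := IsManifold.of_le (n := ∞) (by exact_mod_cast le_top)
  exact (contMDiffAt_iff_contMDiffAt_nhds (by simp)).1 hf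

theorem chartD_velocity_fst
    (hΘ : ContMDiffAt 𝓘(ℝ, ℝ × ℝ) (𝓡 2) 2 (fun q : ℝ × ℝ => Θ q.1 q.2) (t, r))
    (hp : Θ t r ∈ (extChartAt (𝓡 2) p).source) :
    chartD p (Θ t r) (velocity (fun t => Θ t r) t)
      = fderiv ℝ (fun q : ℝ × ℝ => extChartAt (𝓡 2) p (Θ q.1 q.2)) (t, r) (1, 0) := by
  have h := chartD_velocity (γ := fun t => Θ t r)
    ((contMDiffAt_slice_fst hΘ).mdifferentiableAt (by simp)) hp
  rw [h]
  exact (deriv_slice_fst ((contDiffAt_chart_comp ENat.LEInfty.out hΘ hp).differentiableAt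
    (by simp))).deriv

theorem chartD_velocity_snd
    (hΘ : ContMDiffAt 𝓘(ℝ, ℝ × ℝ) (𝓡 2) 2 (fun q : ℝ × ℝ => Θ q.1 q.2) (t, r))
    (hp : Θ t r ∈ (extChartAt (𝓡 2) p).source) :
    chartD p (Θ t r) (velocity (fun r => Θ t r) r)
      = fderiv ℝ (fun q : ℝ × ℝ => extChartAt (𝓡 2) p (Θ q.1 q.2)) (t, r) (0, 1) := by
  have h := chartD_velocity (γ := fun r => Θ t r)
    ((contMDiffAt_slice_snd hΘ).mdifferentiableAt (by simp)) hp
  rw [h]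
  exact (deriv_slice_snd ((contDiffAt_chart_comp ENat.LEInfty.out hΘ hp).differentiableAt
    (by simp))).deriv

end

variable [IsManifold (𝓡 2) ∞ M]
  [IsContMDiffRiemannianBundle (𝓡 2) ∞ Plane (fun x : M => TangentSpace (𝓡 2) x)]
  {Θ : ℝ → ℝ → M} {t r : ℝ} {p : M}

/-- Identifies the acceleration of a single curve of the variation with a covariant derivative along
the two-parameter map, where it can be differentiated in `r` as well. -/
theorem chartD_covAcceleration_fst
    (hΘ : ContMDiffAt 𝓘(ℝ, ℝ × ℝ) (𝓡 2) 2 (fun q : ℝ × ℝ => Θ q.1 q.2) (t, r))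
    (hp : Θ t r ∈ (extChartAt (𝓡 2) p).source) :
    chartD p (Θ t r) (covAcceleration (fun t => Θ t r) t)
      = covD (metricMatrix p) (fun q : ℝ × ℝ => extChartAt (𝓡 2) p (Θ q.1 q.2))
        (fun z => fderiv ℝ (fun q : ℝ × ℝ => extChartAt (𝓡 2) p (Θ q.1 q.2)) z (1, 0))
        (t, r) (1, 0) := by
  have hx := contDiffAt_chart_comp ENat.LEInfty.out hΘ hp
  rw [covAcceleration_eq, chartD_covDeriv (Θ := fun t => Θ t r) (contMDiffAt_slice_fst hΘ) hp]
  have h1 : ∀ᶠ s in 𝓝 t, fderiv ℝ (fun s => extChartAt (𝓡 2) p (Θ s r)) s 1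
      = fderiv ℝ (fun q : ℝ × ℝ => extChartAt (𝓡 2) p (Θ q.1 q.2)) (s, r) (1, 0) := by
    filter_upwards [eventually_fst (hx.eventually (by simp))] with s hs
    rw [fderiv_apply_one_eq_deriv]
    exact (deriv_slice_fst (hs.differentiableAt (by simp))).deriv
  have h2 := (deriv_slice_fst (differentiableAt_fderiv_apply hx (1, 0))).deriv
  rw [covD_congr Filter.EventuallyEq.rfl h1, covD, covD, h1.self_of_nhds,
    fderiv_apply_one_eq_deriv, h2]

omit [IsContMDiffRiemannianBundle (𝓡 2) ∞ Plane (fun x : M => TangentSpace (𝓡 2) x)] in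
theorem norm_sq_eq_quad {x : M} (hx : x ∈ (extChartAt (𝓡 2) p).source) (X : TangentSpace (𝓡 2) x) :
    ‖X‖ ^ 2 = quad (metricMatrix p (extChartAt (𝓡 2) p x)) (chartD p x X) (chartD p x X) := by
  rw [← real_inner_self_eq_norm_sq, inner_eq_quad hx]

omit [IsManifold (𝓡 2) ∞ M]
  [IsContMDiffRiemannianBundle (𝓡 2) ∞ Plane (fun x : M => TangentSpace (𝓡 2) x)] in
-- Since ⟨A, JV⟩ = Ω₂(V, A), the curvature times the speed is the connection form on ∂_t; the factor
-- |V| lowers the cube to a square.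
theorem geodesicCurvature_mul_norm (o : ∀ x : M, Orientation ℝ (TangentSpace (𝓡 2) x) (Fin 2))
    {γ : ℝ → M} (hv : velocity γ t ≠ 0) :
    geodesicCurvature o γ t * ‖velocity γ t‖
      = (o (γ t)).areaForm (velocity γ t) (covAcceleration γ t) / ‖velocity γ t‖ ^ 2 := by
  have : ‖velocity γ t‖ ≠ 0 := norm_ne_zero_iff.2 hv
  rw [geodesicCurvature, real_inner_comm, Orientation.inner_rightAngleRotation_left]
  field_simp

variable {o : ∀ x : M, Orientation ℝ (TangentSpace (𝓡 2) x) (Fin 2)} {m s : ℝ}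

section

variable (hΘ : ContMDiffAt 𝓘(ℝ, ℝ × ℝ) (𝓡 2) 2 (fun q : ℝ × ℝ => Θ q.1 q.2) (t, r))
  (hv : velocity (fun t => Θ t r) t ≠ 0) (hp : Θ t r ∈ (extChartAt (𝓡 2) p).source)
  (hs : ∀ X Y, (o (Θ t r)).areaForm X Y
      = s * (√(metricMatrix p (extChartAt (𝓡 2) p (Θ t r))).det
        * cross (chartD p (Θ t r) X) (chartD p (Θ t r) Y)))

include hΘ hp

omit [IsContMDiffRiemannianBundle (𝓡 2) ∞ Plane (fun x : M => TangentSpace (𝓡 2) x)] in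
theorem norm_velocity_eq_speed : ‖velocity (fun t => Θ t r) t‖
    = speed (metricMatrix p) (fun q : ℝ × ℝ => extChartAt (𝓡 2) p (Θ q.1 q.2)) (1, 0) (t, r) := by
  rw [speed, ← chartD_velocity_fst hΘ hp, ← norm_sq_eq_quad hp, Real.sqrt_sq (norm_nonneg _)]

include hv hs

theorem geodesicCurvature_eq_turn : geodesicCurvature o (fun t => Θ t r) t
      * ‖velocity (fun t => Θ t r) t‖ = s * turn (metricMatrix p)
        (fun q : ℝ × ℝ => extChartAt (𝓡 2) p (Θ q.1 q.2)) (1, 0) (1, 0) (t, r) := by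
  rw [geodesicCurvature_mul_norm o hv, hs, turn, ← chartD_velocity_fst hΘ hp,
    ← chartD_covAcceleration_fst hΘ hp, norm_sq_eq_quad hp, mul_div_assoc]

theorem density_eq : density o m (fun t => Θ t r) t
    = s * turn (metricMatrix p) (fun q : ℝ × ℝ => extChartAt (𝓡 2) p (Θ q.1 q.2))
        (1, 0) (1, 0) (t, r)
      + m * speed (metricMatrix p) (fun q : ℝ × ℝ => extChartAt (𝓡 2) p (Θ q.1 q.2))
        (1, 0) (t, r) := by
  rw [density, add_mul, geodesicCurvature_eq_turn hΘ hv hp hs, norm_velocity_eq_speed hΘ hp]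

omit hv in
theorem momentum_eq : momentum o m Θ (t, r)
    = s * turn (metricMatrix p) (fun q : ℝ × ℝ => extChartAt (𝓡 2) p (Θ q.1 q.2))
        (1, 0) (0, 1) (t, r)
      + m * tangential (metricMatrix p) (fun q : ℝ × ℝ => extChartAt (𝓡 2) p (Θ q.1 q.2))
        (1, 0) (0, 1) (t, r) := by
  have h1 := chartD_covDeriv (Θ := fun q : ℝ × ℝ => Θ q.1 q.2) hΘ hp (1, 0) (0, 1)
  rw [momentum, tangential, ← norm_velocity_eq_speed hΘ hp]
  simp only
  rw [hs, turn, ← chartD_velocity_fst hΘ hp, ← chartD_velocity_snd hΘ hp, ← h1,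
    norm_sq_eq_quad hp, mul_div_assoc, inner_eq_quad hp]

end

/-- The first variation formula for the integrand of the action. -/
theorem first_variation (ho : IsContinuousOrientation o) (m : ℝ)
    (hΘ : ContMDiffAt 𝓘(ℝ, ℝ × ℝ) (𝓡 2) 3 (fun q : ℝ × ℝ => Θ q.1 q.2) (t, r))
    (hv : velocity (fun t => Θ t r) t ≠ 0) :
    ContDiffAt ℝ 1 (fun q : ℝ × ℝ => density o m (fun t => Θ t q.2) q.1) (t, r) ∧
    ContDiffAt ℝ 1 (momentum o m Θ) (t, r) ∧
    fderiv ℝ (fun q : ℝ × ℝ => density o m (fun t => Θ t q.2) q.1) (t, r) (0, 1)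
      = fderiv ℝ (momentum o m Θ) (t, r) (1, 0) + eulerLagrange o m Θ t r := by
  set p := Θ t r with hpdef
  have hp : Θ t r ∈ (extChartAt (𝓡 2) p).source := mem_extChartAt_source p
  have h23 : (2 : WithTop ℕ∞) ≤ 3 := by norm_num
  obtain ⟨s, hs1, hs⟩ := exists_areaForm_eq ho p
  set x : ℝ × ℝ → Plane := fun q => extChartAt (𝓡 2) p (Θ q.1 q.2)
  have hx : ContDiffAt ℝ 3 x (t, r) := contDiffAt_chart_comp ENat.LEInfty.out hΘ hp
  have hy : x (t, r) ∈ (extChartAt (𝓡 2) p).target := (extChartAt (𝓡 2) p).map_source hp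
  have hg := fun i j => contDiffAt_metricMatrix (M := M) hy i j
  have hdet := det_metricMatrix_pos hy
  have hq : 0 < quad (metricMatrix p (x (t, r))) (fderiv ℝ x (t, r) (1, 0))
      (fderiv ℝ x (t, r) (1, 0)) := by
    rw [← chartD_velocity_fst (hΘ.of_le h23) hp, ← norm_sq_eq_quad hp]
    positivity
  have hcont : ContinuousAt (fun q : ℝ × ℝ => Θ q.1 q.2) (t, r) := hΘ.continuousAt
  -- The chart expressions with the sign `s` are needed on a whole neighbourhood, since they are
  -- about to be differentiated.
  have hnear : ∀ᶠ q : ℝ × ℝ in 𝓝 (t, r),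
      ContMDiffAt 𝓘(ℝ, ℝ × ℝ) (𝓡 2) 2 (fun q : ℝ × ℝ => Θ q.1 q.2) q ∧
      Θ q.1 q.2 ∈ (extChartAt (𝓡 2) p).source ∧
      velocity (fun t => Θ t q.2) q.1 ≠ 0 ∧
      ∀ X Y, (o (Θ q.1 q.2)).areaForm X Y
        = s * (√(metricMatrix p (extChartAt (𝓡 2) p (Θ q.1 q.2))).det
          * cross (chartD p (Θ q.1 q.2) X) (chartD p (Θ q.1 q.2) Y)) := by
    have h1 : ContinuousAt (fun q => quad (metricMatrix p (x q)) (fderiv ℝ x q (1, 0))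
        (fderiv ℝ x q (1, 0))) (t, r) := by
      have hd : ContDiffAt ℝ 1 (fun q => fderiv ℝ x q (1, 0)) (t, r) :=
        (hx.fderiv_right (by norm_num)).clm_apply contDiffAt_const
      exact (contDiffAt_quad (fun i j => (hg i j).of_le (by simp)) (hx.of_le (by norm_num))
        hd hd).continuousAt
    filter_upwards [eventually_contMDiffAt (hΘ.of_le h23), eventually_mem_source hcont hp,
      h1.eventually (lt_mem_nhds hq), hcont.eventually hs] with q h1 h2 h3 h4
    refine ⟨h1, h2, fun h0 => ?_, h4⟩
    have h5 : fderiv ℝ x q (1, 0) = 0 := by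
      rw [← chartD_velocity_fst h1 h2, h0, map_zero]
    rw [h5] at h3
    simp [quad] at h3
  have hden : (fun q : ℝ × ℝ => density o m (fun t => Θ t q.2) q.1) =ᶠ[𝓝 (t, r)] fun q =>
      s * turn (metricMatrix p) x (1, 0) (1, 0) q + m * speed (metricMatrix p) x (1, 0) q :=
    hnear.mono fun q ⟨h1, h2, h3, h4⟩ => density_eq h1 h3 h2 h4
  have hmom : momentum o m Θ =ᶠ[𝓝 (t, r)] fun q =>
      s * turn (metricMatrix p) x (1, 0) (0, 1) q
        + m * tangential (metricMatrix p) x (1, 0) (0, 1) q :=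
    hnear.mono fun q ⟨h1, h2, h3, h4⟩ => momentum_eq h1 h2 h4
  have c1 := fun β => contDiffAt_turn hg hx hq hdet.ne' β
  have c2 := contDiffAt_speed hg hx hq
  have c3 := fun β => contDiffAt_tangential hg hx hq β
  refine ⟨((contDiffAt_const.mul (c1 _)).add (contDiffAt_const.mul c2)).congr_of_eventuallyEq hden,
    ((contDiffAt_const.mul (c1 _)).add (contDiffAt_const.mul (c3 _))).congr_of_eventuallyEq hmom,
    ?_⟩
  have d1 := fun β => (c1 β).differentiableAt one_ne_zero
  have d2 := c2.differentiableAt one_ne_zero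
  have d3 := fun β => (c3 β).differentiableAt one_ne_zero
  rw [hden.fderiv_eq, hmom.fderiv_eq, fderiv_fun_add ((d1 _).const_mul s) (d2.const_mul m),
    fderiv_fun_add ((d1 _).const_mul s) ((d3 _).const_mul m), fderiv_const_mul (d1 _),
    fderiv_const_mul (d1 _), fderiv_const_mul d2, fderiv_const_mul (d3 _)]
  simp only [_root_.add_apply, _root_.smul_apply, smul_eq_mul]
  have e1 := fderiv_turn_sub hg hx hq (metricMatrix_symm p) hdet (0, 1)
  have e2 := fderiv_speed_sub hg hx hq (metricMatrix_symm p) hdet (0, 1)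
  obtain ⟨n1, n2, n3, n4⟩ := hnear.self_of_nhds
  have e3 := geodesicCurvature_eq_turn n1 n3 n2 n4
  have e4 := norm_velocity_eq_speed n1 n2
  -- `gaussCurvature` at a point uses the preferred chart there, so with the chart centred at Θ t r
  -- the equality is definitional.
  have e5 : gaussCurvature p = gaussPlane (metricMatrix p) (x (t, r)) := rfl
  have e6 : speed (metricMatrix p) x (1, 0) (t, r) ≠ 0 := (Real.sqrt_pos.2 hq).ne'
  rw [eulerLagrange, n4, ← hpdef, chartD_velocity_fst n1 hp, chartD_velocity_snd n1 hp, e5]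
  rw [e4, ← eq_div_iff e6] at e3
  rw [e3]
  -- In the length term the sign occurs twice, in κ and in the area element, while `e2` carries
  -- none; s² = 1 removes it.
  linear_combination s * e1 + m * e2 + m * √(metricMatrix p (x (t, r))).det
    * cross (fderiv ℝ x (t, r) (1, 0)) (fderiv ℝ x (t, r) (0, 1))
    * turn (metricMatrix p) x (1, 0) (1, 0) (t, r)
    * (speed (metricMatrix p) x (1, 0) (t, r))⁻¹ * hs1

end FirstVariation

/-! ### Integrals depending on a parameter -/

section ParametricIntegral

variable {F : ℝ × ℝ → ℝ} {a b ε : ℝ}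

theorem continuousAt_fderiv_apply {q : ℝ × ℝ} (hF : ContDiffAt ℝ 1 F q) (δ : ℝ × ℝ) :
    ContinuousAt (fun z => fderiv ℝ F z δ) q :=
  ((hF.fderiv_right (m := 0) (by simp)).continuousAt).clm_apply continuousAt_const

theorem hasDerivAt_integral_of_contDiffAt (hab : a ≤ b) (hε : 0 < ε)
    (hF : ∀ t ∈ Icc a b, ∀ r ∈ Ioo (-ε) ε, ContDiffAt ℝ 1 F (t, r)) :
    HasDerivAt (fun r => ∫ t in a..b, F (t, r)) (∫ t in a..b, fderiv ℝ F (t, 0) (0, 1)) 0 := by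
  -- The smaller closed rectangle is compact, so the derivative in `r` is bounded on it and a
  -- constant dominates.
  have hK : IsCompact (Icc a b ×ˢ Icc (-(ε / 2)) (ε / 2)) := isCompact_Icc.prod isCompact_Icc
  have hsub : ∀ r ∈ Icc (-(ε / 2)) (ε / 2), r ∈ Ioo (-ε) ε := fun r hr =>
    ⟨by linarith [hr.1], by linarith [hr.2]⟩
  obtain ⟨C, hC⟩ := hK.exists_bound_of_continuousOn (f := fun z => fderiv ℝ F z (0, 1))
    fun z hz => (continuousAt_fderiv_apply (hF z.1 hz.1 z.2 (hsub _ hz.2)) _).continuousWithinAt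
  have hnhds : Icc (-(ε / 2)) (ε / 2) ∈ 𝓝 (0 : ℝ) := Icc_mem_nhds (by linarith) (by linarith)
  have huI : uIoc a b ⊆ Icc a b := by
    rw [uIoc_of_le hab]; exact Ioc_subset_Icc_self
  have hslice : ∀ t : ℝ, ∀ r : ℝ, ContinuousAt (fun s : ℝ => (s, r)) t := fun t r =>
    (Continuous.prodMk_left r).continuousAt
  have hcont : ∀ r ∈ Ioo (-ε) ε, ContinuousOn (fun t => F (t, r)) (Icc a b) := fun r hr t ht =>
    (ContinuousAt.comp (f := fun s : ℝ => (s, r)) (hF t ht r hr).continuousAt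
      (hslice t r)).continuousWithinAt
  have hcont' : ContinuousOn (fun t => fderiv ℝ F (t, 0) (0, 1)) (Icc a b) := fun t ht =>
    (ContinuousAt.comp (f := fun s : ℝ => (s, (0 : ℝ)))
      (continuousAt_fderiv_apply (hF t ht 0 ⟨by linarith, hε⟩) (0, 1))
      (hslice t 0)).continuousWithinAt
  refine (intervalIntegral.hasDerivAt_integral_of_dominated_loc_of_deriv_le
    (F := fun r t => F (t, r)) (F' := fun r t => fderiv ℝ F (t, r) (0, 1)) (bound := fun _ => C)
    hnhds ?_ ?_ ?_ ?_ intervalIntegrable_const ?_).2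
  · filter_upwards [hnhds] with r hr
    exact ((hcont r (hsub r hr)).mono huI).aestronglyMeasurable measurableSet_uIoc
  · exact ContinuousOn.intervalIntegrable (by
      rw [uIcc_of_le hab]; exact hcont 0 ⟨by linarith, hε⟩)
  · exact (hcont'.mono huI).aestronglyMeasurable measurableSet_uIoc
  · exact Filter.Eventually.of_forall fun t ht r hr => hC (t, r) ⟨huI ht, hr⟩
  · exact Filter.Eventually.of_forall fun t ht r hr =>
      deriv_slice_snd ((hF t (huI ht) r (hsub r hr)).differentiableAt one_ne_zero)

theorem integral_fderiv_fst (hab : a ≤ b) (hF : ∀ t ∈ Icc a b, ContDiffAt ℝ 1 F (t, 0)) :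
    IntervalIntegrable (fun t => fderiv ℝ F (t, 0) (1, 0)) volume a b ∧
    ∫ t in a..b, fderiv ℝ F (t, 0) (1, 0) = F (b, 0) - F (a, 0) := by
  have h : IntervalIntegrable (fun t => fderiv ℝ F (t, 0) (1, 0)) volume a b := by
    refine ContinuousOn.intervalIntegrable ?_
    rw [uIcc_of_le hab]
    exact fun t ht => (ContinuousAt.comp (f := fun s : ℝ => (s, (0 : ℝ)))
      (continuousAt_fderiv_apply (hF t ht) (1, 0))
      (Continuous.prodMk_left (0 : ℝ)).continuousAt).continuousWithinAt
  refine ⟨h, intervalIntegral.integral_eq_sub_of_hasDerivAt (f := fun t => F (t, 0)) ?_ h⟩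
  rw [uIcc_of_le hab]
  exact fun t ht => deriv_slice_fst ((hF t ht).differentiableAt one_ne_zero)

end ParametricIntegral

/-! ### The first variation of the action and its boundary terms -/

section Action

variable {M : Type*} [TopologicalSpace M] [ChartedSpace Plane M]
  [RiemannianBundle (fun x : M => TangentSpace (𝓡 2) x)] [IsManifold (𝓡 2) ∞ M]
  {o : ∀ x : M, Orientation ℝ (TangentSpace (𝓡 2) x) (Fin 2)} {Θ : ℝ → ℝ → M} {t r m : ℝ}

omit [RiemannianBundle (fun x : M => TangentSpace (𝓡 2) x)] in
theorem eventually_velocity_fst_ne_zero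
    (hΘ : ContMDiffAt 𝓘(ℝ, ℝ × ℝ) (𝓡 2) 2 (fun q : ℝ × ℝ => Θ q.1 q.2) (t, r))
    (hv : velocity (fun t => Θ t r) t ≠ 0) :
    ∀ᶠ q : ℝ × ℝ in 𝓝 (t, r), velocity (fun t => Θ t q.2) q.1 ≠ 0 := by
  set p := Θ t r
  have hp : Θ t r ∈ (extChartAt (𝓡 2) p).source := mem_extChartAt_source p
  have hx := contDiffAt_chart_comp ENat.LEInfty.out hΘ hp
  have h1 := (differentiableAt_fderiv_apply hx (1, 0)).continuousAt
  have h2 : fderiv ℝ (fun q : ℝ × ℝ => extChartAt (𝓡 2) p (Θ q.1 q.2)) (t, r) (1, 0) ≠ 0 := by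
    rw [← chartD_velocity_fst hΘ hp]
    exact fun h => hv ((chartD_bijective hp).1 (h.trans (map_zero _).symm))
  have hcont : ContinuousAt (fun q : ℝ × ℝ => Θ q.1 q.2) (t, r) := hΘ.continuousAt
  filter_upwards [h1.eventually_ne h2, eventually_contMDiffAt hΘ,
    eventually_mem_source hcont hp] with q hq hq' hq'' h0
  rw [← chartD_velocity_fst hq' hq'', h0, map_zero] at hq
  exact hq rfl

variable [IsContMDiffRiemannianBundle (𝓡 2) ∞ Plane (fun x : M => TangentSpace (𝓡 2) x)]

/-- The Gauss curvature is defined with a chart that moves with the point, so its continuity is not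
visible from the definition. The first variation formula exhibits the expression as a difference of
derivatives of two C¹ functions. -/
theorem continuousAt_eulerLagrange (ho : IsContinuousOrientation o) (m : ℝ)
    (hΘ : ContMDiffAt 𝓘(ℝ, ℝ × ℝ) (𝓡 2) 3 (fun q : ℝ × ℝ => Θ q.1 q.2) (t, r))
    (hv : velocity (fun t => Θ t r) t ≠ 0) :
    ContinuousAt (fun t => eulerLagrange o m Θ t r) t := by
  obtain ⟨c1, c2, -⟩ := first_variation ho m hΘ hv
  have h1 := (continuousAt_fderiv_apply c1 (0, 1)).sub (continuousAt_fderiv_apply c2 (1, 0))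
  have h2 := ContinuousAt.comp (f := fun s : ℝ => (s, r)) h1
    (Continuous.prodMk_left r).continuousAt
  refine h2.congr ?_
  filter_upwards [eventually_fst (eventually_contMDiffAt hΘ), eventually_fst
    (eventually_velocity_fst_ne_zero (hΘ.of_le (by norm_num)) hv)] with s hs hs'
  have := (first_variation ho m hs hs').2.2
  simp only [Function.comp_def, Pi.sub_apply]
  linarith

/-- The first variation formula for the action. -/
theorem hasDerivAt_action (ho : IsContinuousOrientation o) (m : ℝ) {a b ε : ℝ} (hab : a ≤ b)
    (hε : 0 < ε)
    (hΘ : ∀ t ∈ Icc a b, ∀ r ∈ Ioo (-ε) ε,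
      ContMDiffAt 𝓘(ℝ, ℝ × ℝ) (𝓡 2) ∞ (fun q : ℝ × ℝ => Θ q.1 q.2) (t, r) ∧
      velocity (fun t => Θ t r) t ≠ 0)
    (hmom : momentum o m Θ (b, 0) = momentum o m Θ (a, 0)) :
    HasDerivAt (fun r => action o m a b fun t => Θ t r)
      (∫ t in a..b, eulerLagrange o m Θ t 0) 0 := by
  have h3 : (3 : WithTop ℕ∞) ≤ ∞ := ENat.LEInfty.out
  have h0 : (0 : ℝ) ∈ Ioo (-ε) ε := ⟨by linarith, hε⟩
  have hfv := fun t ht r hr => first_variation ho m ((hΘ t ht r hr).1.of_le h3) (hΘ t ht r hr).2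
  have h1 := hasDerivAt_integral_of_contDiffAt hab hε fun t ht r hr => (hfv t ht r hr).1
  obtain ⟨h2, h3'⟩ := integral_fderiv_fst hab fun t ht => (hfv t ht 0 h0).2.1
  rw [hmom, sub_self] at h3'
  have h4 : IntervalIntegrable (fun t => eulerLagrange o m Θ t 0) volume a b := by
    refine ContinuousOn.intervalIntegrable ?_
    rw [uIcc_of_le hab]
    exact fun t ht => (continuousAt_eulerLagrange ho m ((hΘ t ht 0 h0).1.of_le h3)
      (hΘ t ht 0 h0).2).continuousWithinAt
  refine h1.congr_deriv ?_
  rw [intervalIntegral.integral_congr (g := fun t => fderiv ℝ (momentum o m Θ) (t, 0) (1, 0)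
    + eulerLagrange o m Θ t 0), intervalIntegral.integral_add h2 h4, h3', zero_add]
  intro t ht
  rw [uIcc_of_le hab] at ht
  exact (hfv t ht 0 h0).2.2

/-- The boundary term vanishes at an end where the unit tangent is fixed. -/
theorem momentum_eq_zero_of_clamped (ho : IsContinuousOrientation o)
    (hΘ : ContMDiffAt 𝓘(ℝ, ℝ × ℝ) (𝓡 2) 2 (fun q : ℝ × ℝ => Θ q.1 q.2) (t, 0))
    {z : TangentBundle (𝓡 2) M} (hv : velocity (fun t => Θ t 0) t ≠ 0)
    (hz : ∀ᶠ r in 𝓝 (0 : ℝ), unitTangent (fun t => Θ t r) t = z) :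
    momentum o m Θ (t, 0) = 0 := by
  set p := Θ t 0
  have hp : Θ t 0 ∈ (extChartAt (𝓡 2) p).source := mem_extChartAt_source p
  obtain ⟨s, -, hs⟩ := exists_areaForm_eq ho p
  set x : ℝ × ℝ → Plane := fun q => extChartAt (𝓡 2) p (Θ q.1 q.2)
  have hx : ContDiffAt ℝ 2 x (t, 0) := contDiffAt_chart_comp ENat.LEInfty.out hΘ hp
  have hbase : ∀ᶠ r in 𝓝 (0 : ℝ), Θ t r = p := by
    have h0 : Θ t 0 = z.proj := congrArg Bundle.TotalSpace.proj hz.self_of_nhds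
    filter_upwards [hz] with r hr
    exact (congrArg Bundle.TotalSpace.proj hr).trans h0.symm
  -- The end point does not move, so W = 0 there; this kills the tangential term and the Christoffel
  -- terms.
  have hxr : fderiv ℝ x (t, 0) (0, 1) = 0 := by
    rw [← (deriv_slice_snd (hx.differentiableAt (by simp))).deriv]
    have : (fun r => x (t, r)) =ᶠ[𝓝 0] fun _ => extChartAt (𝓡 2) p p := by
      filter_upwards [hbase] with r hr
      simp only [x, hr]
    rw [this.deriv_eq, deriv_const]
  have hsnd : ∀ {P : ℝ × ℝ → Prop}, (∀ᶠ q in 𝓝 (t, (0 : ℝ)), P q) → ∀ᶠ r in 𝓝 (0 : ℝ), P (t, r) :=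
    fun h => (Continuous.prodMk_right t).continuousAt.eventually h
  set D : TangentBundle (𝓡 2) M → Plane := fun w => chartD p w.1 w.2
  -- The unit tangent does not move either: in the chart all velocities are multiples of one vector,
  -- so their derivative in `r` has no area with the velocity.
  have hDz : ∀ᶠ r in 𝓝 (0 : ℝ), ∃ c : ℝ, fderiv ℝ x (t, r) (1, 0) = c • D z := by
    filter_upwards [hz, hsnd (eventually_contMDiffAt hΘ),
      hsnd (eventually_velocity_fst_ne_zero hΘ hv), hbase] with r hr hr' hr'' hr3
    have hpr : Θ t r ∈ (extChartAt (𝓡 2) p).source := by rw [hr3]; exact mem_extChartAt_source p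
    refine ⟨‖velocity (fun t => Θ t r) t‖, ?_⟩
    rw [← hr]
    simp only [D, unitTangent]
    rw [map_smul, smul_inv_smul₀ (norm_ne_zero_iff.2 hr''), chartD_velocity_fst hr' hpr]
  have hcross : cross (fderiv ℝ x (t, 0) (1, 0))
      (fderiv ℝ (fun q => fderiv ℝ x q (1, 0)) (t, 0) (0, 1)) = 0 := by
    have h1 := deriv_slice_snd (differentiableAt_fderiv_apply hx (1, 0))
    have h2 : ∀ i, HasDerivAt (fun r => fderiv ℝ x (t, r) (1, 0) i) _ 0 := fun i =>
      (EuclideanSpace.proj i : Plane →L[ℝ] ℝ).hasFDerivAt.comp_hasDerivAt 0 h1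
    have h3 := ((h2 1).const_mul (fderiv ℝ x (t, 0) (1, 0) 0)).sub
      ((h2 0).const_mul (fderiv ℝ x (t, 0) (1, 0) 1))
    have h4 : (fun r => fderiv ℝ x (t, 0) (1, 0) 0 * fderiv ℝ x (t, r) (1, 0) 1
        - fderiv ℝ x (t, 0) (1, 0) 1 * fderiv ℝ x (t, r) (1, 0) 0) =ᶠ[𝓝 0] fun _ => 0 := by
      obtain ⟨c, hc⟩ := hDz.self_of_nhds
      filter_upwards [hDz] with r ⟨c', hc'⟩
      rw [hc, hc']
      simp only [PiLp.smul_apply, smul_eq_mul]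
      ring
    exact h3.unique ((hasDerivAt_const (0 : ℝ) (0 : ℝ)).congr_of_eventuallyEq h4)
  rw [momentum_eq hΘ hp hs.self_of_nhds, turn, tangential]
  change s * (_ * cross _ (covD (metricMatrix p) x _ _ _) / _) + m * (quad _ (fderiv ℝ x _ _) _ / _) = 0
  have h5 : covD (metricMatrix p) x (fun q => fderiv ℝ x q (1, 0)) (t, 0) (0, 1)
      = fderiv ℝ (fun q => fderiv ℝ x q (1, 0)) (t, 0) (0, 1) := by
    ext k
    rw [covD_apply, hxr]
    simp
  rw [h5, hcross, hxr]
  simp [quad]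

theorem turn_congr {E : Type*} [NormedAddCommGroup E] [NormedSpace ℝ E]
    {g : Plane → Matrix (Fin 2) (Fin 2) ℝ} {x x' : E → Plane} {q : E} (h : x =ᶠ[𝓝 q] x') (α β : E) :
    turn g x α β q = turn g x' α β q := by
  have h1 : (fun p => fderiv ℝ x p α) =ᶠ[𝓝 q] fun p => fderiv ℝ x' p α := by
    filter_upwards [h.eventuallyEq_nhds] with z hz
    rw [hz.fderiv_eq]
  rw [turn, turn, covD_congr h h1, h.fderiv_eq, h.eq_of_nhds]

theorem turn_comp_add {E : Type*} [NormedAddCommGroup E] [NormedSpace ℝ E]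
    {g : Plane → Matrix (Fin 2) (Fin 2) ℝ} (x : E → Plane) (q c α β : E) :
    turn g (fun z => x (z + c)) α β q = turn g x α β (q + c) := by
  simp only [turn, covD, fderiv_comp_add_right c]
  rw [fderiv_comp_add_right (f := fun z => fderiv ℝ x z α) c]

theorem tangential_congr {E : Type*} [NormedAddCommGroup E] [NormedSpace ℝ E]
    {g : Plane → Matrix (Fin 2) (Fin 2) ℝ} {x x' : E → Plane} {q : E} (h : x =ᶠ[𝓝 q] x') (α β : E) :
    tangential g x α β q = tangential g x' α β q := by
  rw [tangential, tangential, speed, speed, h.fderiv_eq, h.eq_of_nhds]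

theorem tangential_comp_add {E : Type*} [NormedAddCommGroup E] [NormedSpace ℝ E]
    {g : Plane → Matrix (Fin 2) (Fin 2) ℝ} (x : E → Plane) (q c α β : E) :
    tangential g (fun z => x (z + c)) α β q = tangential g x α β (q + c) := by
  simp only [tangential, speed, fderiv_comp_add_right c]

/-- The boundary terms of a variation through closed curves cancel. -/
theorem momentum_eq_of_periodic (ho : IsContinuousOrientation o) {L : ℝ}
    (hΘ : ∀ t, ContMDiffAt 𝓘(ℝ, ℝ × ℝ) (𝓡 2) 2 (fun q : ℝ × ℝ => Θ q.1 q.2) (t, 0))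
    (hper : ∀ᶠ r in 𝓝 (0 : ℝ), ∀ t, Θ (t + L) r = Θ t r) :
    momentum o m Θ (t + L, 0) = momentum o m Θ (t, 0) := by
  set p := Θ t 0
  have hp : Θ t 0 ∈ (extChartAt (𝓡 2) p).source := mem_extChartAt_source p
  -- Both ends of the period are the same point, so one chart and one sign serve for both momenta;
  -- there the maps differ by a translation of the parameter.
  have hL : Θ (t + L) 0 = p := hper.self_of_nhds t
  have hpL : Θ (t + L) 0 ∈ (extChartAt (𝓡 2) p).source := by rw [hL]; exact mem_extChartAt_source p
  obtain ⟨s, -, hs⟩ := exists_areaForm_eq ho p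
  have hs' := hs.self_of_nhds
  rw [← hL] at hs'
  rw [momentum_eq (hΘ t) hp hs.self_of_nhds, momentum_eq (hΘ (t + L)) hpL (by simpa only [hL] using hs')]
  set x : ℝ × ℝ → Plane := fun q => extChartAt (𝓡 2) p (Θ q.1 q.2)
  have hx : (fun z => x (z + (L, 0))) =ᶠ[𝓝 (t, 0)] x := by
    have : ∀ᶠ q : ℝ × ℝ in 𝓝 (t, 0), ∀ t, Θ (t + L) q.2 = Θ t q.2 :=
      (continuousAt_snd (p := (t, (0 : ℝ)))).eventually hper
    filter_upwards [this] with q hq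
    simp [x, hq]
  have h0 : ((t + L, 0) : ℝ × ℝ) = (t, 0) + (L, 0) := by simp
  rw [h0, ← turn_comp_add, ← tangential_comp_add, turn_congr hx, tangential_congr hx]

end Action

/-! ### Dependence on the germ of a curve -/

section Germs

variable {M : Type*} [TopologicalSpace M] [ChartedSpace Plane M] {γ γ' : ℝ → M} {t : ℝ}

/-- The two velocities have different tangent spaces as types; both unfold to the model plane, where
they can be compared. -/
theorem velocity_congr (h : γ =ᶠ[𝓝 t] γ') : (velocity γ t : Plane) = velocity γ' t :=
  congrArg (fun A : ℝ →L[ℝ] Plane => A 1) h.mfderiv_eq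

theorem velocity_comp {φ : ℝ → ℝ} (hγ : MDifferentiableAt 𝓘(ℝ, ℝ) (𝓡 2) γ (φ t))
    (hφ : DifferentiableAt ℝ φ t) :
    velocity (γ ∘ φ) t = deriv φ t • velocity γ (φ t) := by
  have h := mfderiv_comp t hγ hφ.mdifferentiableAt
  have h1 : mfderiv 𝓘(ℝ, ℝ) 𝓘(ℝ, ℝ) φ t (1 : ℝ) = deriv φ t • (1 : ℝ) := by
    rw [mfderiv_eq_fderiv, smul_eq_mul, mul_one, ← fderiv_apply_one_eq_deriv]; rfl
  have h2 : velocity (γ ∘ φ) t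
      = mfderiv 𝓘(ℝ, ℝ) (𝓡 2) γ (φ t) (mfderiv 𝓘(ℝ, ℝ) 𝓘(ℝ, ℝ) φ t (1 : ℝ)) :=
    DFunLike.congr_fun h (1 : ℝ)
  rw [h2, h1]
  exact map_smul _ _ _

variable [RiemannianBundle (fun x : M => TangentSpace (𝓡 2) x)]

theorem covAcceleration_congr (h : γ =ᶠ[𝓝 t] γ') :
    (covAcceleration γ t : Plane) = covAcceleration γ' t := by
  have h0 := h.eq_of_nhds
  have h1 : (fun s => extChartAt (𝓡 2) (γ t) (γ s)) =ᶠ[𝓝 t]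
      fun s => extChartAt (𝓡 2) (γ' t) (γ' s) := by
    filter_upwards [h] with s hs
    rw [hs, h0]
  simp only [covAcceleration]
  rw [h1.deriv.deriv_eq, h1.deriv_eq, h0]

/-- The area element, on vectors given by their components in the preferred chart. -/
def areaPlane (o : ∀ x : M, Orientation ℝ (TangentSpace (𝓡 2) x) (Fin 2)) (p : M) (v w : Plane) :
    ℝ :=
  (o p).areaForm (v : TangentSpace (𝓡 2) p) (w : TangentSpace (𝓡 2) p)

/-- The norm of a vector given by its components in the preferred chart. -/
def normPlane (p : M) (v : Plane) : ℝ := Norm.norm (E := TangentSpace (𝓡 2) p) v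

variable {o : ∀ x : M, Orientation ℝ (TangentSpace (𝓡 2) x) (Fin 2)}

theorem geodesicCurvature_eq_areaPlane (γ : ℝ → M) (t : ℝ) : geodesicCurvature o γ t
    = areaPlane o (γ t) (velocity γ t) (covAcceleration γ t) / normPlane (γ t) (velocity γ t) ^ 3 := by
  rw [geodesicCurvature, real_inner_comm, Orientation.inner_rightAngleRotation_left]
  rfl

theorem geodesicCurvature_congr (h : γ =ᶠ[𝓝 t] γ') :
    geodesicCurvature o γ t = geodesicCurvature o γ' t := by
  rw [geodesicCurvature_eq_areaPlane, geodesicCurvature_eq_areaPlane, velocity_congr h,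
    covAcceleration_congr h, h.eq_of_nhds]

theorem unitTangent_congr (h : γ =ᶠ[𝓝 t] γ') : unitTangent γ t = unitTangent γ' t := by
  have h1 : ∀ γ : ℝ → M, unitTangent γ t = (⟨γ t, ((normPlane (γ t) (velocity γ t))⁻¹ •
    (velocity γ t : Plane) : Plane)⟩ : TangentBundle (𝓡 2) M) := fun _ => rfl
  rw [h1, h1, velocity_congr h, h.eq_of_nhds]

/-- Separates the variation field, which alone depends on Θ, from the geometry of the curve. -/
theorem eulerLagrange_eq {Θ : ℝ → ℝ → M} {m r : ℝ} (h : (fun t => Θ t r) =ᶠ[𝓝 t] γ) :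
    eulerLagrange o m Θ t r = (gaussCurvature (γ t) - m * geodesicCurvature o γ t)
      * areaPlane o (γ t) (velocity γ t) (velocity (fun r => Θ t r) r) := by
  rw [eulerLagrange, geodesicCurvature_congr h, h.eq_of_nhds, ← velocity_congr h]
  have : Θ t r = γ t := h.eq_of_nhds
  rw [← this]
  rfl

theorem areaPlane_smul_right (p : M) (c : ℝ) (v w : Plane) :
    areaPlane o p v (c • w) = c * areaPlane o p v w :=
  map_smul ((o p).areaForm (v : TangentSpace (𝓡 2) p)) c (w : TangentSpace (𝓡 2) p)

end Germs

/-! ### Variations in a fixed coordinate direction -/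

section ChartVariation

variable {M : Type*} [TopologicalSpace M] [ChartedSpace Plane M]

/-- The variation of `γ` in the chart at `p` with variation field `f u`. -/
def chartVariation (γ : ℝ → M) (p : M) (f : ℝ → ℝ) (u : Plane) (t r : ℝ) : M :=
  (extChartAt (𝓡 2) p).symm (extChartAt (𝓡 2) p (γ t) + (r * f t) • u)

variable {γ : ℝ → M} {p : M} {f : ℝ → ℝ} {u : Plane} {t r : ℝ}

theorem chartVariation_zero (hp : γ t ∈ (extChartAt (𝓡 2) p).source) :
    chartVariation γ p f u t 0 = γ t := by
  simp only [chartVariation, zero_mul, zero_smul, add_zero]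
  exact (extChartAt (𝓡 2) p).left_inv hp

theorem chartVariation_zero_eventuallyEq (hγ : ContinuousAt γ t)
    (hp : γ t ∈ (extChartAt (𝓡 2) p).source) :
    (fun t => chartVariation γ p f u t 0) =ᶠ[𝓝 t] γ :=
  (eventually_mem_source hγ hp).mono fun _ hs => chartVariation_zero hs

variable [IsManifold (𝓡 2) ∞ M]

theorem contMDiffAt_chartVariation {n : WithTop ℕ∞} (hn : n ≤ ∞)
    (hγ : ContMDiffAt 𝓘(ℝ, ℝ) (𝓡 2) n γ t) (hf : ContDiff ℝ ∞ f)
    (hp : γ t ∈ (extChartAt (𝓡 2) p).source)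
    (htarget : extChartAt (𝓡 2) p (γ t) + (r * f t) • u ∈ (extChartAt (𝓡 2) p).target) :
    ContMDiffAt 𝓘(ℝ, ℝ × ℝ) (𝓡 2) n (fun q : ℝ × ℝ => chartVariation γ p f u q.1 q.2) (t, r) := by
  have h1 : ContDiffAt ℝ n (fun q : ℝ × ℝ => extChartAt (𝓡 2) p (γ q.1)) (t, r) :=
    ContDiffAt.comp (g := fun s => extChartAt (𝓡 2) p (γ s)) (t, r)
      (contDiffAt_chart_comp hn hγ hp) contDiffAt_fst
  have h2 : ContDiffAt ℝ n (fun q : ℝ × ℝ => f q.1) (t, r) :=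
    ContDiffAt.comp (t, r) (hf.contDiffAt.of_le hn) contDiffAt_fst
  have h3 := h1.add ((contDiffAt_snd.mul h2).smul (contDiffAt_const (c := u)))
  exact ContMDiffAt.comp (t, r) ((contMDiffAt_chart_symm htarget).of_le hn)
    (contMDiffAt_iff_contDiffAt.2 h3)

theorem contMDiffAt_chartVariation_zero {n : WithTop ℕ∞} (hn : n ≤ ∞)
    (hγ : ContMDiffAt 𝓘(ℝ, ℝ) (𝓡 2) n γ t) (hf : ContDiff ℝ ∞ f)
    (hp : γ t ∈ (extChartAt (𝓡 2) p).source) :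
    ContMDiffAt 𝓘(ℝ, ℝ × ℝ) (𝓡 2) n (fun q : ℝ × ℝ => chartVariation γ p f u q.1 q.2) (t, 0) :=
  contMDiffAt_chartVariation hn hγ hf hp (by
    simpa using (extChartAt (𝓡 2) p).map_source hp)

/-- At fixed `t` the function `f` only rescales `r` by f t, so the variation field is linear in it.
-/
theorem velocity_chartVariation_snd (hγ : ContMDiffAt 𝓘(ℝ, ℝ) (𝓡 2) 2 γ t)
    (hp : γ t ∈ (extChartAt (𝓡 2) p).source) :
    (velocity (fun r => chartVariation γ p f u t r) 0 : Plane)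
      = f t • (velocity (fun r => chartVariation γ p (fun _ => 1) u t r) 0 : Plane) := by
  have h1 : ContMDiffAt 𝓘(ℝ, ℝ) (𝓡 2) 2 (fun r => chartVariation γ p (fun _ => 1) u t r) 0 :=
    contMDiffAt_slice_snd (contMDiffAt_chartVariation_zero (n := 2) ENat.LEInfty.out hγ
      contDiff_const hp)
  have h2 := velocity_comp (γ := fun r => chartVariation γ p (fun _ => 1) u t r)
    (φ := fun r => r * f t) (t := 0)
    (by simpa only [zero_mul] using h1.mdifferentiableAt (by simp)) (by fun_prop)
  have h3 : (fun r => chartVariation γ p (fun _ => 1) u t r) ∘ (fun r => r * f t)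
      = fun r => chartVariation γ p f u t r := by
    funext r
    simp [chartVariation]
  rw [h3] at h2
  have h4 : deriv (fun r : ℝ => r * f t) 0 = f t := by simp
  have h5 : (velocity (fun r => chartVariation γ p (fun _ => 1) u t r) ((0 : ℝ) * f t) : Plane)
      = velocity (fun r => chartVariation γ p (fun _ => 1) u t r) 0 :=
    congrArg (fun s => (velocity (fun r => chartVariation γ p (fun _ => 1) u t r) s : Plane))
      (zero_mul (f t))
  rw [h4] at h2
  refine Eq.trans h2 ?_
  exact congrArg (fun w : Plane => f t • w) h5

/-- The differential of the preferred chart at its own centre is the identity, so there the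
coordinate direction is the actual variation field. -/
theorem velocity_chartVariation_self (hγ : ContMDiffAt 𝓘(ℝ, ℝ) (𝓡 2) 2 γ t) :
    (velocity (fun r => chartVariation γ (γ t) (fun _ => 1) u t r) 0 : Plane) = u := by
  have hp : γ t ∈ (extChartAt (𝓡 2) (γ t)).source := mem_extChartAt_source _
  have h1 := contMDiffAt_chartVariation_zero (n := 2) (u := u) ENat.LEInfty.out hγ
    (contDiff_const (c := (1 : ℝ))) hp
  have h0 : chartVariation γ (γ t) (fun _ => 1) u t 0 = γ t := chartVariation_zero hp
  have h2 := chartD_velocity (p := γ t)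
    ((contMDiffAt_slice_snd h1).mdifferentiableAt (by simp)) (by rw [h0]; exact hp)
  have h3 : (fun z => extChartAt (𝓡 2) (γ t) (chartVariation γ (γ t) (fun _ => 1) u t z)) =ᶠ[𝓝 0]
      fun r => extChartAt (𝓡 2) (γ t) (γ t) + r • u := by
    have hc : ContinuousAt (fun r : ℝ => extChartAt (𝓡 2) (γ t) (γ t) + r • u) 0 := by fun_prop
    have := hc.eventually ((isOpen_extChartAt_target (I := 𝓡 2) (γ t)).mem_nhds (by
      simp))
    filter_upwards [this] with r hr
    simp only [chartVariation, mul_one]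
    exact (extChartAt (𝓡 2) (γ t)).right_inv hr
  have h4 : HasDerivAt (fun r : ℝ => extChartAt (𝓡 2) (γ t) (γ t) + r • u) u 0 := by
    simpa using ((hasDerivAt_id (0 : ℝ)).smul_const u).const_add (extChartAt (𝓡 2) (γ t) (γ t))
  rw [h3.deriv_eq, h4.deriv] at h2
  refine Eq.trans ?_ h2
  have h5 : ∀ x, x = γ t → ∀ w : Plane, w = chartD (γ t) x w := by
    rintro x rfl w
    exact (chartD_self _ _).symm
  exact h5 _ h0 _

end ChartVariation

/-! ### A periodic bump function -/

section Bump

/-- A smooth periodic bump function supported near a point of the fundamental domain. -/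
theorem exists_periodic_bump {a b t₀ δ : ℝ} (h₀ : t₀ ∈ Ioo a b) (hδ : 0 < δ) :
    ∃ f : ℝ → ℝ, ContDiff ℝ ∞ f ∧ (∀ t, 0 ≤ f t) ∧ 0 < f t₀ ∧ Function.Periodic f (b - a) ∧
      ∀ t ∈ Icc a b, δ ≤ |t - t₀| → ∀ᶠ s in 𝓝 t, f s = 0 := by
  have hL : 0 < b - a := by linarith [h₀.1, h₀.2]
  -- A cosine of period b - a with its maximum 1 at t₀. As t₀ is interior, every t in [a, b] is less
  -- than a period away, so the maximum is attained only there.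
  set g : ℝ → ℝ := fun t => Real.cos (2 * Real.pi * ((t - t₀) / (b - a)))
  have hg : ContDiff ℝ ∞ g := by fun_prop
  have hgc : Continuous g := hg.continuous
  have hlt : ∀ t ∈ Icc a b, δ ≤ |t - t₀| → g t < 1 := by
    intro t ht htδ
    refine lt_of_le_of_ne (Real.cos_le_one _) fun h => ?_
    have h1 : -1 < (t - t₀) / (b - a) := by
      rw [lt_div_iff₀ hL]; linarith [ht.1, h₀.2]
    have h2 : (t - t₀) / (b - a) < 1 := by
      rw [div_lt_iff₀ hL]; linarith [ht.2, h₀.1]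
    have hpi := Real.pi_pos
    rw [Real.cos_eq_one_iff_of_lt_of_lt (by nlinarith) (by nlinarith)] at h
    have h3 : t - t₀ = 0 := by
      have : (t - t₀) / (b - a) = 0 := by
        rcases mul_eq_zero.1 h with h | h
        · linarith
        · exact h
      rcases div_eq_zero_iff.1 this with h | h
      · exact h
      · linarith
    rw [h3, abs_zero] at htδ
    linarith
  -- By compactness the cosine stays below some c < 1 away from t₀; a smooth step at level c cuts
  -- off the rest and keeps the periodicity.
  obtain ⟨c, hc1, hc⟩ : ∃ c < 1, ∀ t ∈ Icc a b, δ ≤ |t - t₀| → g t < c := by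
    have hK : IsCompact (Icc a b ∩ {t | δ ≤ |t - t₀|}) :=
      isCompact_Icc.inter_right (isClosed_le continuous_const (by fun_prop))
    rcases (Icc a b ∩ {t | δ ≤ |t - t₀|}).eq_empty_or_nonempty with he | hne
    · exact ⟨0, one_pos, fun t ht htδ => absurd (he ▸ ⟨ht, htδ⟩ : t ∈ (∅ : Set ℝ)) (by simp)⟩
    · obtain ⟨x, hx, hmax⟩ := hK.exists_isMaxOn hne hgc.continuousOn
      have hx1 := hlt x hx.1 hx.2
      refine ⟨(g x + 1) / 2, by linarith, fun t ht htδ => ?_⟩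
      have : g t ≤ g x := hmax ⟨ht, htδ⟩
      linarith
  refine ⟨fun t => Real.smoothTransition (g t - c), Real.smoothTransition.contDiff.comp
    (hg.sub contDiff_const), fun t => Real.smoothTransition.nonneg _,
    Real.smoothTransition.pos_of_pos ?_, fun t => ?_, fun t ht htδ => ?_⟩
  · simp only [g, sub_self, zero_div, mul_zero, Real.cos_zero]; linarith
  · have : g (t + (b - a)) = g t := by
      simp only [g]
      rw [show 2 * Real.pi * ((t + (b - a) - t₀) / (b - a))
        = 2 * Real.pi * ((t - t₀) / (b - a)) + 2 * Real.pi by field_simp; ring, Real.cos_add_two_pi]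
    simp only [this]
  · filter_upwards [hgc.continuousAt.eventually_lt continuousAt_const (hc t ht htδ)] with s hs
    exact Real.smoothTransition.zero_of_nonpos (by linarith)

end Bump

/-! ### The fundamental lemma of the calculus of variations -/

section Critical

variable {M : Type*} [TopologicalSpace M] [ChartedSpace Plane M]
  [RiemannianBundle (fun x : M => TangentSpace (𝓡 2) x)] [IsManifold (𝓡 2) ∞ M]
  [IsContMDiffRiemannianBundle (𝓡 2) ∞ Plane (fun x : M => TangentSpace (𝓡 2) x)]
  {o : ∀ x : M, Orientation ℝ (TangentSpace (𝓡 2) x) (Fin 2)} {γ : ℝ → M} {t₀ m : ℝ}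

/-- The Euler-Lagrange density of the variation of `γ` in the normal direction at `γ t₀`. -/
def normalDensity (o : ∀ x : M, Orientation ℝ (TangentSpace (𝓡 2) x) (Fin 2)) (m : ℝ) (γ : ℝ → M)
    (t₀ t : ℝ) : ℝ :=
  (gaussCurvature (γ t) - m * geodesicCurvature o γ t) * areaPlane o (γ t) (velocity γ t)
    (velocity (fun r => chartVariation γ (γ t₀) (fun _ => 1)
      ((o (γ t₀)).rightAngleRotation (velocity γ t₀)) t r) 0)

omit [IsContMDiffRiemannianBundle (𝓡 2) ∞ Plane (fun x : M => TangentSpace (𝓡 2) x)] in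
theorem normalDensity_self (m : ℝ) (hγ : ContMDiffAt 𝓘(ℝ, ℝ) (𝓡 2) ∞ γ t₀) :
    normalDensity o m γ t₀ t₀ = (gaussCurvature (γ t₀) - m * geodesicCurvature o γ t₀)
      * ‖velocity γ t₀‖ ^ 2 := by
  rw [← real_inner_self_eq_norm_sq]
  refine congrArg _ ((congrArg (areaPlane o (γ t₀) (velocity γ t₀))
    (velocity_chartVariation_self (hγ.of_le ENat.LEInfty.out))).trans ?_)
  exact (o (γ t₀)).areaForm_rightAngleRotation_right _ _

/-- Near t₀ it is the Euler-Lagrange integrand of the chart variation with `f` = 1, whose continuity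
is known. -/
theorem continuousAt_normalDensity (ho : IsContinuousOrientation o) (m : ℝ)
    (hγ : ContMDiffAt 𝓘(ℝ, ℝ) (𝓡 2) ∞ γ t₀) (hv : velocity γ t₀ ≠ 0) :
    ContinuousAt (normalDensity o m γ t₀) t₀ := by
  set u : Plane := (o (γ t₀)).rightAngleRotation (velocity γ t₀)
  have hp : γ t₀ ∈ (extChartAt (𝓡 2) (γ t₀)).source := mem_extChartAt_source _
  have h1 := contMDiffAt_chartVariation_zero (n := 3) (u := u) ENat.LEInfty.out
    (hγ.of_le ENat.LEInfty.out) (contDiff_const (c := (1 : ℝ))) hp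
  have h2 := chartVariation_zero_eventuallyEq (f := fun _ => 1) (u := u) hγ.continuousAt hp
  have h3 : velocity (fun t => chartVariation γ (γ t₀) (fun _ => 1) u t 0) t₀ ≠ 0 := by
    intro h
    exact hv ((velocity_congr h2).symm.trans h)
  refine (continuousAt_eulerLagrange ho m h1 h3).congr ?_
  filter_upwards [h2.eventuallyEq_nhds] with t ht
  exact eulerLagrange_eq ht

/-- Push the curve near t₀ along the normal direction, scaled by a bump: the Euler-Lagrange
integrand becomes the bump times a function of constant sign. One construction serves both spaces,
since the bump is periodic and vanishes near both ends. -/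
theorem exists_variation (ho : IsContinuousOrientation o) {a b : ℝ} (h₀ : t₀ ∈ Ioo a b)
    (hγ : IsImmersedOn (Icc a b) γ)
    (hne : gaussCurvature (γ t₀) - m * geodesicCurvature o γ t₀ ≠ 0) :
    ∃ (Θ : ℝ → ℝ → M) (ε : ℝ), 0 < ε ∧ (∀ t ∈ Icc a b, Θ t 0 = γ t) ∧
      (∀ t ∈ Icc a b, ∀ r ∈ Ioo (-ε) ε,
        ContMDiffAt 𝓘(ℝ, ℝ × ℝ) (𝓡 2) ∞ (fun q : ℝ × ℝ => Θ q.1 q.2) (t, r) ∧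
        velocity (fun t => Θ t r) t ≠ 0) ∧
      (∀ r, (fun t => Θ t r) =ᶠ[𝓝 a] γ) ∧ (∀ r, (fun t => Θ t r) =ᶠ[𝓝 b] γ) ∧
      (Function.Periodic γ (b - a) → ∀ r, Function.Periodic (fun t => Θ t r) (b - a)) ∧
      ∫ t in a..b, eulerLagrange o m Θ t 0 ≠ 0 := by
  classical
  obtain ⟨hγ₀, hv₀⟩ := hγ t₀ (Ioo_subset_Icc_self h₀)
  set p := γ t₀ with hpdef
  set u : Plane := (o p).rightAngleRotation (velocity γ t₀) with hu
  set c := normalDensity o m γ t₀ t₀ with hc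
  have hc0 : c ≠ 0 := by
    rw [hc, normalDensity_self m hγ₀]
    exact mul_ne_zero hne (pow_ne_zero _ (norm_ne_zero_iff.2 hv₀))
  have hpos : ∀ᶠ t in 𝓝 t₀, 0 < normalDensity o m γ t₀ t * c :=
    continuousAt_const.eventually_lt ((continuousAt_normalDensity ho m hγ₀ hv₀).mul
      continuousAt_const) (mul_self_pos.2 hc0)
  obtain ⟨δ', hδ', hball⟩ := Metric.eventually_nhds_iff.1
    (hpos.and ((eventually_mem_source hγ₀.continuousAt (mem_extChartAt_source p)).and
      (isOpen_Ioo.mem_nhds h₀)))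
  simp only [Real.dist_eq] at hball
  obtain ⟨f, hf, hf0, hft₀, hfper, hfz⟩ := exists_periodic_bump h₀ (half_pos hδ')
  -- Where `f` vanishes the curve may leave the chart, so it is left unchanged there. The bump lives
  -- within δ'/2 and the chart formula holds within δ', so near each parameter in [a, b] one of the
  -- two descriptions is valid.
  set Θ : ℝ → ℝ → M := fun t r => if f t = 0 then γ t else chartVariation γ p f u t r with hΘ
  have hA : ∀ t, |t - t₀| < δ' → ∀ r, Θ t r = chartVariation γ p f u t r := by
    intro t ht r
    by_cases h : f t = 0
    · simp only [hΘ, h, if_true, chartVariation, mul_zero, zero_smul, add_zero]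
      exact ((extChartAt (𝓡 2) p).left_inv (hball ht).2.1).symm
    · simp only [hΘ, h, if_false]
  have hA' : ∀ t, |t - t₀| < δ' → ∀ᶠ s in 𝓝 t, ∀ r, Θ s r = chartVariation γ p f u s r := by
    intro t ht
    have : ContinuousAt (fun s => |s - t₀|) t := by fun_prop
    filter_upwards [this.eventually_lt continuousAt_const ht] with s hs
    exact hA s hs
  have hB : ∀ t ∈ Icc a b, δ' / 2 ≤ |t - t₀| → ∀ᶠ s in 𝓝 t, ∀ r, Θ s r = γ s := by
    intro t ht htδ
    filter_upwards [hfz t ht htδ] with s hs r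
    simp only [hΘ, hs, if_true]
  have hfst : ∀ {P : ℝ → Prop} {t r : ℝ}, (∀ᶠ s in 𝓝 t, P s) → ∀ᶠ q in 𝓝 (t, r), P q.1 :=
    fun {P t r} h => (continuous_fst.tendsto (t, r)).eventually h
  have h00 : ∀ t ∈ Icc a b, (fun s => Θ s 0) =ᶠ[𝓝 t] γ := by
    intro t ht
    rcases le_or_gt (δ' / 2) |t - t₀| with h | h
    · exact (hB t ht h).mono fun s hs => hs 0
    · have h' : |t - t₀| < δ' := by linarith
      filter_upwards [hA' t h', chartVariation_zero_eventuallyEq (p := p) (f := f) (u := u)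
        (hγ t ht).1.continuousAt (hball h').2.1] with s hs hs'
      exact (hs 0).trans hs'
  have hK : IsCompact (Icc (t₀ - δ' / 2) (t₀ + δ' / 2)) := isCompact_Icc
  have habsK : ∀ t ∈ Icc (t₀ - δ' / 2) (t₀ + δ' / 2), |t - t₀| < δ' := fun t ht => by
    rw [abs_lt]; constructor <;> linarith [ht.1, ht.2]
  -- Staying in the chart and being immersed are open conditions that hold at r = 0; compactness in
  -- `t` gives one ε for all parameters.
  have hunif := hK.eventually_forall_of_forall_eventually (x₀ := (0 : ℝ))
    (P := fun r t => extChartAt (𝓡 2) p (γ t) + (r * f t) • u ∈ (extChartAt (𝓡 2) p).target ∧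
      velocity (fun t => chartVariation γ p f u t r) t ≠ 0) (by
    intro t ht
    have htδ := habsK t ht
    have htab := Ioo_subset_Icc_self (hball htδ).2.2
    have hsrc := (hball htδ).2.1
    have h1 := contMDiffAt_chartVariation_zero (n := 2) (u := u) ENat.LEInfty.out
      ((hγ t htab).1.of_le ENat.LEInfty.out) hf hsrc
    have h2 : velocity (fun t => chartVariation γ p f u t 0) t ≠ 0 := fun h =>
      (hγ t htab).2 ((velocity_congr (chartVariation_zero_eventuallyEq
        (hγ t htab).1.continuousAt hsrc)).symm.trans h)
    have h3 : ContinuousAt (fun q : ℝ × ℝ => extChartAt (𝓡 2) p (γ q.2) + (q.1 * f q.2) • u)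
        (0, t) := by
      have hx := (contDiffAt_chart_comp (n := ∞) le_rfl (hγ t htab).1 hsrc).continuousAt
      have hx' : ContinuousAt (fun q : ℝ × ℝ => extChartAt (𝓡 2) p (γ q.2)) (0, t) :=
        ContinuousAt.comp (f := Prod.snd) (g := fun t => extChartAt (𝓡 2) p (γ t)) hx
          continuousAt_snd
      have hfc := hf.continuous
      exact hx'.add (by fun_prop)
    have h4 := h3.eventually ((isOpen_extChartAt_target (I := 𝓡 2) p).mem_nhds (by
      simpa using (extChartAt (𝓡 2) p).map_source hsrc))
    have h5 := (continuous_swap.tendsto ((0 : ℝ), t)).eventually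
      (eventually_velocity_fst_ne_zero h1 h2)
    exact h4.and h5)
  obtain ⟨ε, hε, hεP⟩ := Metric.eventually_nhds_iff.1 hunif
  have hsm : ∀ t ∈ Icc a b, ∀ r ∈ Ioo (-ε) ε,
      ContMDiffAt 𝓘(ℝ, ℝ × ℝ) (𝓡 2) ∞ (fun q : ℝ × ℝ => Θ q.1 q.2) (t, r) ∧
      velocity (fun t => Θ t r) t ≠ 0 := by
    intro t ht r hr
    rcases le_or_gt (δ' / 2) |t - t₀| with h | h
    · constructor
      · have h1 : ContMDiffAt 𝓘(ℝ, ℝ × ℝ) (𝓡 2) ∞ (fun q : ℝ × ℝ => γ q.1) (t, r) :=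
          ContMDiffAt.comp (f := Prod.fst) (t, r) (hγ t ht).1
            (contMDiffAt_iff_contDiffAt.2 contDiffAt_fst)
        exact h1.congr_of_eventuallyEq ((hfst (hB t ht h)).mono fun q hq => hq q.2)
      · exact fun h0 => (hγ t ht).2
          ((velocity_congr ((hB t ht h).mono fun s hs => hs r)).symm.trans h0)
    · have h' : |t - t₀| < δ' := by linarith
      have hr' : dist r 0 < ε := by rw [Real.dist_eq, sub_zero, abs_lt]; exact hr
      have htK : t ∈ Icc (t₀ - δ' / 2) (t₀ + δ' / 2) := by
        rw [abs_lt] at h; constructor <;> linarith [h.1, h.2]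
      obtain ⟨k1, k2⟩ := hεP hr' t htK
      constructor
      · exact (contMDiffAt_chartVariation le_rfl (hγ t ht).1 hf (hball h').2.1
          k1).congr_of_eventuallyEq ((hfst (hA' t h')).mono fun q hq => hq q.2)
      · exact fun h0 => k2
          ((velocity_congr ((hA' t h').mono fun s hs => hs r)).symm.trans h0)
  have hfar : ∀ t, t ∉ Ioo a b → δ' / 2 ≤ |t - t₀| := fun t ht => by
    by_contra! h
    exact ht (hball (h.trans (by linarith))).2.2
  have hab : a < b := h₀.1.trans h₀.2
  have hEL1 : ∀ t ∈ Icc a b, |t - t₀| < δ' →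
      eulerLagrange o m Θ t 0 = f t * normalDensity o m γ t₀ t := by
    intro t ht htδ
    have h1 : (fun r => Θ t r) = fun r => chartVariation γ p f u t r := funext (hA t htδ)
    have h2 := (congrArg (areaPlane o (γ t) (velocity γ t)) (velocity_chartVariation_snd (f := f)
      (u := u) ((hγ t ht).1.of_le ENat.LEInfty.out) (hball htδ).2.1)).trans
      (areaPlane_smul_right _ _ _ _)
    rw [eulerLagrange_eq (h00 t ht), h1, h2, normalDensity]
    ring
  have hEL2 : ∀ t ∈ Icc a b, δ' / 2 ≤ |t - t₀| → eulerLagrange o m Θ t 0 = 0 := by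
    intro t ht htδ
    have h1 : (fun r => Θ t r) = fun _ => γ t := funext (hB t ht htδ).self_of_nhds
    have h2 : (velocity (fun _ : ℝ => γ t) 0 : Plane) = (0 : ℝ) • (0 : Plane) := by
      rw [zero_smul]
      exact DFunLike.congr_fun (mfderiv_const (I := 𝓘(ℝ, ℝ)) (I' := 𝓡 2) (c := γ t) (x := (0 : ℝ)))
        (1 : ℝ)
    have h3 := (congrArg (areaPlane o (γ t) (velocity γ t)) h2).trans
      (areaPlane_smul_right _ _ _ _)
    rw [eulerLagrange_eq (h00 t ht), h1, h3]
    ring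
  refine ⟨Θ, ε, hε, fun t ht => (h00 t ht).self_of_nhds, hsm,
    fun r => (hB a (left_mem_Icc.2 hab.le) (hfar a (by simp))).mono fun s hs => hs r,
    fun r => (hB b (right_mem_Icc.2 hab.le) (hfar b (by simp))).mono fun s hs => hs r,
    fun hper r t => ?_, fun h0 => ?_⟩
  -- Θ depends on `t` only through `f t` and `γ t`, both periodic.
  · simp only [hΘ, chartVariation]
    rw [hfper t, hper t]
  · have hint : 0 < ∫ t in a..b, eulerLagrange o m Θ t 0 * c := by
      refine intervalIntegral.integral_pos hab ?_ ?_ ⟨t₀, Ioo_subset_Icc_self h₀, ?_⟩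
      · intro t ht
        obtain ⟨k1, k2⟩ := hsm t ht 0 ⟨by linarith, hε⟩
        exact ((continuousAt_eulerLagrange ho m (k1.of_le ENat.LEInfty.out) k2).mul
          continuousAt_const).continuousWithinAt
      · intro t ht
        have ht' := Ioc_subset_Icc_self ht
        rcases le_or_gt (δ' / 2) |t - t₀| with h | h
        · rw [hEL2 t ht' h, zero_mul]
        · have h' : |t - t₀| < δ' := by linarith
          rw [hEL1 t ht' h', mul_assoc]
          exact mul_nonneg (hf0 t) (hball h').1.le
      · have h' : |t₀ - t₀| < δ' := by simpa using hδ'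
        rw [hEL1 t₀ (Ioo_subset_Icc_self h₀) h', mul_assoc]
        exact mul_pos hft₀ (hball h').1
    rw [intervalIntegral.integral_mul_const, h0, zero_mul] at hint
    exact lt_irrefl _ hint

end Critical

/-! ### Acceleration and curvature after a change of parameter -/

section Reparametrization

variable {M : Type*} [TopologicalSpace M] [ChartedSpace Plane M] [IsManifold (𝓡 2) ∞ M]
  {γ : ℝ → M} {φ : ℝ → ℝ} {s : ℝ}

theorem deriv_chart_eq_velocity {t : ℝ} (hγ : MDifferentiableAt 𝓘(ℝ, ℝ) (𝓡 2) γ t) :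
    deriv (fun z => extChartAt (𝓡 2) (γ t) (γ z)) t = (velocity γ t : Plane) := by
  rw [← chartD_velocity hγ (mem_extChartAt_source _), chartD_self]

variable [RiemannianBundle (fun x : M => TangentSpace (𝓡 2) x)]

omit [TopologicalSpace M] [ChartedSpace Plane M] [IsManifold (𝓡 2) ∞ M]
  [RiemannianBundle (fun x : M => TangentSpace (𝓡 2) x)] in
theorem contDiffAt_deriv {F : Type*} [NormedAddCommGroup F] [NormedSpace ℝ F] {f : ℝ → F} {t : ℝ}
    (hf : ContDiffAt ℝ 2 f t) : ContDiffAt ℝ 1 (deriv f) t :=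
  (hf.fderiv_right (m := 1) (by norm_num)).clm_apply contDiffAt_const

theorem covAcceleration_comp (hγ : ContMDiffAt 𝓘(ℝ, ℝ) (𝓡 2) 2 γ (φ s))
    (hφ : ContDiffAt ℝ 2 φ s) :
    (covAcceleration (γ ∘ φ) s : Plane) = deriv (deriv φ) s • (velocity γ (φ s) : Plane)
      + (deriv φ s) ^ 2 • (covAcceleration γ (φ s) : Plane) := by
  set x : ℝ → Plane := fun z => extChartAt (𝓡 2) (γ (φ s)) (γ z) with hxdef
  have hx : ContDiffAt ℝ 2 x (φ s) :=
    contDiffAt_chart_comp ENat.LEInfty.out hγ (mem_extChartAt_source _)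
  have hx' : ContDiffAt ℝ 1 (deriv x) (φ s) := contDiffAt_deriv hx
  have hφ' : ContDiffAt ℝ 1 (deriv φ) s := contDiffAt_deriv hφ
  have h1 : deriv (x ∘ φ) =ᶠ[𝓝 s] fun z => deriv φ z • deriv x (φ z) := by
    filter_upwards [hφ.eventually (by simp), hφ.continuousAt.eventually (hx.eventually (by simp))]
      with z hz hz'
    exact deriv.scomp z (hz'.differentiableAt (by simp)) (hz.differentiableAt (by simp))
  have h2 : deriv (deriv (x ∘ φ)) s
      = deriv φ s • deriv φ s • deriv (deriv x) (φ s) + deriv (deriv φ) s • deriv x (φ s) := by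
    rw [h1.deriv_eq]
    have k1 := (hφ'.differentiableAt one_ne_zero).hasDerivAt
    have k2 := HasDerivAt.scomp s (hx'.differentiableAt one_ne_zero).hasDerivAt
      (hφ.differentiableAt (by simp)).hasDerivAt
    exact (k1.smul k2).deriv
  have h3 : (velocity γ (φ s) : Plane) = deriv x (φ s) :=
    (deriv_chart_eq_velocity (hγ.mdifferentiableAt (by simp))).symm
  -- The curves γ ∘ φ at s and γ at φ s use the same preferred chart, so the definition applies
  -- directly.
  have h4 : (covAcceleration (γ ∘ φ) s : Plane) = WithLp.toLp 2 fun k =>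
      (deriv (deriv (x ∘ φ)) s) k + ∑ i, ∑ j, christoffel (γ (φ s)) k i j (x (φ s))
        * (deriv (x ∘ φ) s) i * (deriv (x ∘ φ) s) j := rfl
  have h5 : (covAcceleration γ (φ s) : Plane) = WithLp.toLp 2 fun k =>
      (deriv (deriv x) (φ s)) k + ∑ i, ∑ j, christoffel (γ (φ s)) k i j (x (φ s))
        * (deriv x (φ s)) i * (deriv x (φ s)) j := rfl
  have h6 : ∀ (X Y : Plane) (c : Fin 2 → Fin 2 → Fin 2 → ℝ) (α β : ℝ),
      (WithLp.toLp 2 fun k => (α • α • Y + β • X) k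
        + ∑ i, ∑ j, c k i j * (α • X) i * (α • X) j : Plane)
      = β • X + α ^ 2 • (WithLp.toLp 2 fun k => Y k + ∑ i, ∑ j, c k i j * X i * X j : Plane) := by
    intro X Y c α β
    ext k
    simp only [PiLp.add_apply, PiLp.smul_apply, smul_eq_mul, Fin.sum_univ_two]
    ring
  rw [h3, h4, h5, h1.self_of_nhds, h2]
  exact h6 _ _ _ _ _

/-- The term φ''γ' is tangential and has no area with the velocity; the remaining factors φ' · φ'²
cancel against the cube of the speed because φ' > 0. -/
theorem geodesicCurvature_comp {o : ∀ x : M, Orientation ℝ (TangentSpace (𝓡 2) x) (Fin 2)}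
    (hγ : ContMDiffAt 𝓘(ℝ, ℝ) (𝓡 2) 2 γ (φ s)) (hφ : ContDiffAt ℝ 2 φ s) (hpos : 0 < deriv φ s) :
    geodesicCurvature o (γ ∘ φ) s = geodesicCurvature o γ (φ s) := by
  have h1 : velocity (γ ∘ φ) s = deriv φ s • velocity γ (φ s) :=
    velocity_comp (hγ.mdifferentiableAt (by simp)) (hφ.differentiableAt (by simp))
  have h2 : ∀ v w : TangentSpace (𝓡 2) (γ (φ s)), ∀ a b c : ℝ, 0 < a →
      (o (γ (φ s))).areaForm (a • v) (b • v + c • w) / ‖a • v‖ ^ 3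
      = (a * c) / a ^ 3 * ((o (γ (φ s))).areaForm v w / ‖v‖ ^ 3) := by
    intro v w a b c ha
    rw [norm_smul, Real.norm_of_nonneg ha.le, mul_pow]
    simp only [map_add, map_smul, LinearMap.smul_apply, smul_eq_mul,
      Orientation.areaForm_apply_self, mul_zero, zero_add]
    rw [div_mul_div_comm]
    ring
  have h3 : geodesicCurvature o (γ ∘ φ) s = (o (γ (φ s))).areaForm (deriv φ s • velocity γ (φ s))
      (deriv (deriv φ) s • velocity γ (φ s) + (deriv φ s) ^ 2 • covAcceleration γ (φ s))
      / ‖deriv φ s • velocity γ (φ s)‖ ^ 3 := by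
    rw [geodesicCurvature_eq_areaPlane, h1]
    exact congrArg (fun w => areaPlane o (γ (φ s)) (deriv φ s • velocity γ (φ s)) w
      / normPlane (γ (φ s)) (deriv φ s • velocity γ (φ s)) ^ 3) (covAcceleration_comp hγ hφ)
  rw [h3, h2 _ _ _ _ _ hpos, geodesicCurvature_eq_areaPlane,
    show deriv φ s * deriv φ s ^ 2 / deriv φ s ^ 3 = 1 by field_simp, one_mul]
  rfl

end Reparametrization

/-! ### Critical points are the curves with G = mκ -/

section Critical

variable {M : Type*} [TopologicalSpace M] [ChartedSpace Plane M]
  [RiemannianBundle (fun x : M => TangentSpace (𝓡 2) x)] [IsManifold (𝓡 2) ∞ M]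
  [IsContMDiffRiemannianBundle (𝓡 2) ∞ Plane (fun x : M => TangentSpace (𝓡 2) x)]
  {o : ∀ x : M, Orientation ℝ (TangentSpace (𝓡 2) x) (Fin 2)} {γ : ℝ → M} {Θ : ℝ → ℝ → M}
  {m a b L t₀ : ℝ} {x₁ x₂ : TangentBundle (𝓡 2) M}

/-- The equation is a closed condition, by continuity of `normalDensity`, whose value at t₀ is (G -
mκ)|γ'|². It carries the equation from the open interval to its ends. -/
theorem curvature_eq_of_frequently (ho : IsContinuousOrientation o)
    (hγ : ContMDiffAt 𝓘(ℝ, ℝ) (𝓡 2) ∞ γ t₀) (hv : velocity γ t₀ ≠ 0)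
    (h : ∃ᶠ t in 𝓝 t₀, gaussCurvature (γ t) = m * geodesicCurvature o γ t) :
    gaussCurvature (γ t₀) = m * geodesicCurvature o γ t₀ := by
  by_contra hne
  have h1 : normalDensity o m γ t₀ t₀ ≠ 0 := by
    rw [normalDensity_self m hγ]
    exact mul_ne_zero (sub_ne_zero.2 hne) (pow_ne_zero _ (norm_ne_zero_iff.2 hv))
  refine h ?_
  filter_upwards [(continuousAt_normalDensity ho m hγ hv).eventually_ne h1] with t ht h2
  refine ht ?_
  rw [normalDensity, h2, sub_self, zero_mul]

theorem curvature_eq_Icc_of_Ioo (ho : IsContinuousOrientation o) (hab : a < b)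
    (hγ : IsImmersedOn (Icc a b) γ)
    (h : ∀ t ∈ Ioo a b, gaussCurvature (γ t) = m * geodesicCurvature o γ t) :
    ∀ t ∈ Icc a b, gaussCurvature (γ t) = m * geodesicCurvature o γ t := by
  intro t ht
  refine curvature_eq_of_frequently ho (hγ t ht).1 (hγ t ht).2 ?_
  have h1 : t ∈ closure (Ioo a b) := by rwa [closure_Ioo hab.ne]
  exact (mem_closure_iff_frequently.1 h1).mono h

omit [IsManifold (𝓡 2) ∞ M] [IsContMDiffRiemannianBundle (𝓡 2) ∞ Plane
  (fun x : M => TangentSpace (𝓡 2) x)] in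
theorem integral_eulerLagrange_eq_zero (hab : a ≤ b) (h0 : ∀ t ∈ Icc a b, Θ t 0 = γ t)
    (h : ∀ t ∈ Icc a b, gaussCurvature (γ t) = m * geodesicCurvature o γ t) :
    ∫ t in a..b, eulerLagrange o m Θ t 0 = 0 := by
  refine intervalIntegral.integral_zero_ae ?_
  -- Θ(·, 0) is known to equal γ only on [a, b], hence as a germ only at interior parameters; the
  -- end b is a null set and a is not in the half-open interval of integration.
  have hb : ∀ᵐ t : ℝ, t ≠ b := compl_mem_ae_iff.2 (measure_singleton b)
  filter_upwards [hb] with t htb ht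
  rw [uIoc_of_le hab] at ht
  have h1 : (fun t => Θ t 0) =ᶠ[𝓝 t] γ :=
    Filter.mem_of_superset (Icc_mem_nhds ht.1 (lt_of_le_of_ne ht.2 htb)) h0
  rw [eulerLagrange_eq h1, h t (Ioc_subset_Icc_self ht), sub_self, zero_mul]

theorem hasDerivAt_action_clamped (ho : IsContinuousOrientation o) (m : ℝ) (hab : a < b)
    (hΘ : IsVariation (clampedCurves a b x₁ x₂) (Icc a b) γ Θ) :
    HasDerivAt (fun r => action o m a b fun t => Θ t r)
      (∫ t in a..b, eulerLagrange o m Θ t 0) 0 := by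
  obtain ⟨-, ε, hε, hr⟩ := hΘ
  have h0 : (0 : ℝ) ∈ Ioo (-ε) ε := ⟨by linarith, hε⟩
  have hnhds : ∀ᶠ r in 𝓝 (0 : ℝ), r ∈ Ioo (-ε) ε := isOpen_Ioo.mem_nhds h0
  have ha := left_mem_Icc.2 hab.le
  have hb := right_mem_Icc.2 hab.le
  refine hasDerivAt_action ho m hab.le hε
    (fun t ht r hr' => ⟨(hr r hr').2 t ht, ((hr r hr').1.1 t ht).2⟩) ?_
  rw [momentum_eq_zero_of_clamped (z := x₂) ho (((hr 0 h0).2 b hb).of_le ENat.LEInfty.out)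
      ((hr 0 h0).1.1 b hb).2 (hnhds.mono fun r h => (hr r h).1.2.2),
    momentum_eq_zero_of_clamped (z := x₁) ho (((hr 0 h0).2 a ha).of_le ENat.LEInfty.out)
      ((hr 0 h0).1.1 a ha).2 (hnhds.mono fun r h => (hr r h).1.2.1)]

theorem hasDerivAt_action_closed (ho : IsContinuousOrientation o) (m : ℝ) (hL : 0 < L)
    (hΘ : IsVariation (closedCurves M L) univ γ Θ) :
    HasDerivAt (fun r => action o m 0 L fun t => Θ t r)
      (∫ t in (0 : ℝ)..L, eulerLagrange o m Θ t 0) 0 := by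
  obtain ⟨-, ε, hε, hr⟩ := hΘ
  have h0 : (0 : ℝ) ∈ Ioo (-ε) ε := ⟨by linarith, hε⟩
  have hnhds : ∀ᶠ r in 𝓝 (0 : ℝ), r ∈ Ioo (-ε) ε := isOpen_Ioo.mem_nhds h0
  refine hasDerivAt_action ho m hL.le hε (fun t _ r hr' =>
    ⟨(hr r hr').2 t (mem_univ t), ((hr r hr').1.1 t (mem_univ t)).2⟩) ?_
  have h1 := momentum_eq_of_periodic ho (m := m) (L := L) (Θ := Θ)
    (fun t => ((hr 0 h0).2 t (mem_univ t)).of_le ENat.LEInfty.out)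
    (hnhds.mono fun r h => (hr r h).1.2) (t := 0)
  rwa [zero_add] at h1

theorem isCriticalPoint_clamped_iff (ho : IsContinuousOrientation o) (hab : a < b)
    (hγ : γ ∈ clampedCurves a b x₁ x₂) :
    IsCriticalPoint (clampedCurves a b x₁ x₂) (Icc a b) (action o m a b) γ ↔
      ∀ t ∈ Icc a b, gaussCurvature (γ t) = m * geodesicCurvature o γ t := by
  constructor
  · intro hcrit
    refine curvature_eq_Icc_of_Ioo ho hab hγ.1 fun t₀ ht₀ => ?_
    by_contra hne
    obtain ⟨Θ, ε, hε, h0, hsm, hΘa, hΘb, -, hint⟩ :=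
      exists_variation ho ht₀ hγ.1 (sub_ne_zero.2 hne)
    have hvar : IsVariation (clampedCurves a b x₁ x₂) (Icc a b) γ Θ :=
      ⟨h0, ε, hε, fun r hr => ⟨⟨fun t ht => ⟨contMDiffAt_slice_fst (hsm t ht r hr).1,
        (hsm t ht r hr).2⟩, (unitTangent_congr (hΘa r)).trans hγ.2.1,
        (unitTangent_congr (hΘb r)).trans hγ.2.2⟩, fun t ht => (hsm t ht r hr).1⟩⟩
    exact hint ((hasDerivAt_action_clamped ho m hab hvar).unique (hcrit Θ hvar))
  · intro h Θ hΘ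
    have := hasDerivAt_action_clamped ho m hab hΘ
    rwa [integral_eulerLagrange_eq_zero hab.le hΘ.1 h] at this

omit [IsContMDiffRiemannianBundle (𝓡 2) ∞ Plane (fun x : M => TangentSpace (𝓡 2) x)] in
-- Translation by the period is a change of parameter that fixes γ.
theorem geodesicCurvature_periodic (hγ : γ ∈ closedCurves M L) :
    Function.Periodic (geodesicCurvature o γ) L := by
  intro t
  have h1 := geodesicCurvature_comp (o := o) (γ := γ) (φ := fun s => s + L) (s := t)
    ((hγ.1 _ (mem_univ _)).1.of_le ENat.LEInfty.out) (by fun_prop) (by simp)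
  have h2 : γ ∘ (fun s => s + L) = γ := funext hγ.2
  rw [h2] at h1
  exact h1.symm

theorem isCriticalPoint_closed_iff (ho : IsContinuousOrientation o) (hL : 0 < L)
    (hγ : γ ∈ closedCurves M L) :
    IsCriticalPoint (closedCurves M L) univ (action o m 0 L) γ ↔
      ∀ t, gaussCurvature (γ t) = m * geodesicCurvature o γ t := by
  have hrep : ∀ t : ℝ, ∃ k : ℤ, t + k * L ∈ Icc 0 L := by
    intro t
    obtain ⟨k, hk, -⟩ := existsUnique_add_zsmul_mem_Ico hL t 0
    refine ⟨k, ?_⟩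
    rw [zsmul_eq_mul, zero_add] at hk
    exact Ico_subset_Icc_self hk
  constructor
  · intro hcrit
    have hI : IsImmersedOn (Icc 0 L) γ := fun t _ => hγ.1 t (mem_univ t)
    have key : ∀ t ∈ Icc 0 L, gaussCurvature (γ t) = m * geodesicCurvature o γ t := by
      refine curvature_eq_Icc_of_Ioo ho hL hI fun t₀ ht₀ => ?_
      by_contra hne
      obtain ⟨Θ, ε, hε, h0, hsm, -, -, hper, hint⟩ :=
        exists_variation ho ht₀ hI (sub_ne_zero.2 hne)
      rw [sub_zero] at hper
      have hper' := fun r (k : ℤ) => (hper hγ.2 r).int_mul k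
      -- The variation is controlled over one period only; translating by a multiple of L brings
      -- every parameter there.
      have hsm' : ∀ t, ∀ r ∈ Ioo (-ε) ε,
          ContMDiffAt 𝓘(ℝ, ℝ × ℝ) (𝓡 2) ∞ (fun q : ℝ × ℝ => Θ q.1 q.2) (t, r) ∧
          velocity (fun t => Θ t r) t ≠ 0 := by
        intro t r hr
        obtain ⟨k, hk⟩ := hrep t
        obtain ⟨k1, k2⟩ := hsm _ hk r hr
        constructor
        · have e1 : (fun q : ℝ × ℝ => Θ q.1 q.2)
              = (fun q : ℝ × ℝ => Θ q.1 q.2) ∘ fun q : ℝ × ℝ => (q.1 + k * L, q.2) :=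
            funext fun q => (hper' q.2 k q.1).symm
          rw [e1]
          exact ContMDiffAt.comp (t, r) k1 (contMDiffAt_iff_contDiffAt.2 (by fun_prop))
        · have e2 : (fun t => Θ t r) ∘ (fun t => t + k * L) = fun t => Θ t r :=
            funext fun t => hper' r k t
          have e3 := velocity_comp (γ := fun t => Θ t r) (φ := fun t => t + k * L) (t := t)
            ((contMDiffAt_slice_fst k1).mdifferentiableAt (by simp)) (by fun_prop)
          have e4 : deriv (fun t => t + k * L) t = 1 := by simp
          rw [e2, e4] at e3
          exact fun h => k2 (((one_smul ℝ _).symm.trans e3.symm).trans h)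
      have hvar : IsVariation (closedCurves M L) univ γ Θ := by
        refine ⟨fun t _ => ?_, ε, hε, fun r hr => ⟨⟨fun t _ =>
          ⟨contMDiffAt_slice_fst (hsm' t r hr).1, (hsm' t r hr).2⟩, hper hγ.2 r⟩,
          fun t _ => (hsm' t r hr).1⟩⟩
        obtain ⟨k, hk⟩ := hrep t
        exact ((hper' 0 k t).symm.trans (h0 _ hk)).trans (hγ.2.int_mul k t)
      exact hint ((hasDerivAt_action_closed ho m hL hvar).unique (hcrit Θ hvar))
    intro t
    obtain ⟨k, hk⟩ := hrep t
    have := key _ hk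
    rwa [hγ.2.int_mul k t, (geodesicCurvature_periodic hγ).int_mul k t] at this
  · intro h Θ hΘ
    have := hasDerivAt_action_closed ho m hL hΘ
    rwa [integral_eulerLagrange_eq_zero hL.le (fun t _ => hΘ.1 t (mem_univ t))
      (fun t _ => h t)] at this

end Critical

/-! ### Unit speed and the Landau-Hall equation -/

section Speed

variable {M : Type*} [TopologicalSpace M] [ChartedSpace Plane M]
  [RiemannianBundle (fun x : M => TangentSpace (𝓡 2) x)] [IsManifold (𝓡 2) ∞ M]
  {γ : ℝ → M} {t : ℝ}

theorem eventually_norm_velocity_sq_eq (hγ : ContMDiffAt 𝓘(ℝ, ℝ) (𝓡 2) ∞ γ t) :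
    (fun s => ‖velocity γ s‖ ^ 2) =ᶠ[𝓝 t] fun s =>
      quad (metricMatrix (γ t) (extChartAt (𝓡 2) (γ t) (γ s)))
        (fderiv ℝ (fun z => extChartAt (𝓡 2) (γ t) (γ z)) s 1)
        (fderiv ℝ (fun z => extChartAt (𝓡 2) (γ t) (γ z)) s 1) := by
  have h1 : ContMDiffAt 𝓘(ℝ, ℝ) (𝓡 2) (1 : ℕ) γ t := hγ.of_le ENat.LEInfty.out
  filter_upwards [eventually_mem_source hγ.continuousAt (mem_extChartAt_source (γ t)),
    eventually_contMDiffAt h1] with s hs hs'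
  rw [norm_sq_eq_quad hs, chartD_velocity (hs'.mdifferentiableAt (by simp)) hs]
  rfl

variable [IsContMDiffRiemannianBundle (𝓡 2) ∞ Plane (fun x : M => TangentSpace (𝓡 2) x)]

theorem hasDerivAt_norm_velocity_sq (hγ : ContMDiffAt 𝓘(ℝ, ℝ) (𝓡 2) ∞ γ t) :
    HasDerivAt (fun s => ‖velocity γ s‖ ^ 2) (2 * ⟪velocity γ t, covAcceleration γ t⟫) t := by
  have hp : γ t ∈ (extChartAt (𝓡 2) (γ t)).source := mem_extChartAt_source _
  have hy := (extChartAt (𝓡 2) (γ t)).map_source hp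
  have h2 : ContMDiffAt 𝓘(ℝ, ℝ) (𝓡 2) 2 γ t := hγ.of_le ENat.LEInfty.out
  set x : ℝ → Plane := fun z => extChartAt (𝓡 2) (γ t) (γ z) with hxdef
  have hx : ContDiffAt ℝ 2 x t := contDiffAt_chart_comp ENat.LEInfty.out h2 hp
  have hX := differentiableAt_fderiv_apply hx 1
  have hxd := hx.differentiableAt (by simp)
  have hg : ∀ i j, DifferentiableAt ℝ (fun z => metricMatrix (γ t) z i j) (x t) := fun i j =>
    (contDiffAt_metricMatrix hy i j).differentiableAt (by simp)
  have h3 := fderiv_quad (x := x) (q := t) (metricMatrix_symm (γ t)) (det_metricMatrix_pos hy).ne' hg hxd hX hX 1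
  have h4 : DifferentiableAt ℝ (fun s => quad (metricMatrix (γ t) (x s)) (fderiv ℝ x s 1)
      (fderiv ℝ x s 1)) t := by
    have hx1 : ContDiffAt ℝ 1 (fun s => fderiv ℝ x s 1) t :=
      (hx.fderiv_right (m := 1) (by norm_num)).clm_apply contDiffAt_const
    exact (contDiffAt_quad (n := 1) (x := x) (q := t) (fun i j => (contDiffAt_metricMatrix hy i j).of_le
      ENat.LEInfty.out) (hx.of_le (by norm_num)) hx1 hx1).differentiableAt one_ne_zero
  have h5 := h4.hasDerivAt
  rw [← fderiv_apply_one_eq_deriv, h3] at h5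
  have h6 : chartD (γ t) (γ t) (covAcceleration γ t)
      = covD (metricMatrix (γ t)) x (fun z => fderiv ℝ x z 1) t 1 := by
    rw [covAcceleration_eq, chartD_covDeriv h2 hp]
  have h7 : chartD (γ t) (γ t) (velocity γ t) = fderiv ℝ x t 1 :=
    chartD_velocity (h2.mdifferentiableAt (by simp)) hp
  have h8 : ⟪velocity γ t, covAcceleration γ t⟫ = quad (metricMatrix (γ t) (x t))
      (fderiv ℝ x t 1) (covD (metricMatrix (γ t)) x (fun z => fderiv ℝ x z 1) t 1) := by
    rw [inner_eq_quad hp, h6, h7]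
  refine (h5.congr_of_eventuallyEq (eventually_norm_velocity_sq_eq hγ)).congr_deriv ?_
  rw [h8, quad_comm (metricMatrix_symm (γ t))]
  ring

theorem contDiffAt_norm_velocity (hγ : ContMDiffAt 𝓘(ℝ, ℝ) (𝓡 2) ∞ γ t) (hv : velocity γ t ≠ 0) :
    ContDiffAt ℝ ∞ (fun s => ‖velocity γ s‖) t := by
  have hp : γ t ∈ (extChartAt (𝓡 2) (γ t)).source := mem_extChartAt_source _
  have hx := contDiffAt_chart_comp le_rfl hγ hp
  have hx1 := (hx.fderiv_right (m := ∞) (by simp)).clm_apply (contDiffAt_const (c := (1 : ℝ)))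
  have h1 := (contDiffAt_quad (x := fun z => extChartAt (𝓡 2) (γ t) (γ z)) (q := t) (fun i j => contDiffAt_metricMatrix
    ((extChartAt (𝓡 2) (γ t)).map_source hp) i j) hx hx1 hx1).congr_of_eventuallyEq
    (eventually_norm_velocity_sq_eq hγ)
  have h2 := h1.sqrt (pow_ne_zero 2 (norm_ne_zero_iff.2 hv))
  exact h2.congr_of_eventuallyEq (Filter.Eventually.of_forall fun s =>
    (Real.sqrt_sq (norm_nonneg _)).symm)

/-- |γ'|² has derivative 2⟨γ', ∇γ'⟩ and is constant on K. At an end of an interval the speed is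
known on one side only, hence the derivative within K and its uniqueness. -/
theorem inner_velocity_covAcceleration_eq_zero {K : Set ℝ} (hK : UniqueDiffWithinAt ℝ K t)
    (ht : t ∈ K) (hγ : ContMDiffAt 𝓘(ℝ, ℝ) (𝓡 2) ∞ γ t) (h : HasUnitSpeedOn K γ) :
    ⟪velocity γ t, covAcceleration γ t⟫ = 0 := by
  have h1 := (hasDerivAt_norm_velocity_sq hγ).hasDerivWithinAt (s := K)
  have h2 : HasDerivWithinAt (fun s => ‖velocity γ s‖ ^ 2) 0 K t :=
    (hasDerivWithinAt_const t K (1 : ℝ)).congr (fun s hs => by rw [h s hs, one_pow])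
      (by rw [h t ht, one_pow])
  have := hK.eq_deriv _ h1 h2
  linarith

/-- At unit speed the acceleration and the Lorentz force are both normal to γ', so they agree
exactly when their areas with γ', which are κ and G/m, agree. -/
theorem isNormalFlowlineOn_iff {o : ∀ x : M, Orientation ℝ (TangentSpace (𝓡 2) x) (Fin 2)} {m : ℝ}
    (hm : m ≠ 0) {K : Set ℝ} (hK : UniqueDiffOn ℝ K)
    (hγ : ∀ t ∈ K, ContMDiffAt 𝓘(ℝ, ℝ) (𝓡 2) ∞ γ t) :
    IsNormalFlowlineOn (gaussMagneticField o m) K γ ↔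
      HasUnitSpeedOn K γ ∧ ∀ t ∈ K, gaussCurvature (γ t) = m * geodesicCurvature o γ t := by
  rw [IsNormalFlowlineOn, and_comm]
  refine and_congr_right fun h => forall₂_congr fun t ht => ?_
  rw [and_iff_right (hγ t ht)]
  have h0 := inner_velocity_covAcceleration_eq_zero (hK t ht) ht (hγ t ht) h
  have h1 := h t ht
  have hκ : geodesicCurvature o γ t
      = (o (γ t)).areaForm (velocity γ t) (covAcceleration γ t) := by
    rw [geodesicCurvature, real_inner_comm, Orientation.inner_rightAngleRotation_left, h1]
    simp
  generalize velocity γ t = v at *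
  generalize covAcceleration γ t = w at *
  set Φ := lorentzForce (gaussMagneticField o m) (γ t) v
  have h2 : (o (γ t)).areaForm v Φ = gaussCurvature (γ t) / m := by
    rw [← Orientation.inner_rightAngleRotation_left, real_inner_comm, inner_lorentzForce,
      gaussMagneticField, LinearMap.smul_apply, LinearMap.smul_apply,
      Orientation.areaForm_rightAngleRotation_right, real_inner_self_eq_norm_sq, h1]
    simp
  have h3 : ⟪v, Φ⟫ = 0 := by
    rw [real_inner_comm, inner_lorentzForce, gaussMagneticField, LinearMap.smul_apply,
      LinearMap.smul_apply, Orientation.areaForm_apply_self, smul_zero]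
  constructor
  · intro h4
    rw [hκ, h4, h2]
    field_simp
  · intro h4
    -- ⟨v, z⟩² + Ω₂(v, z)² = |v|²|z|² with z = w - Φ: both terms on the left vanish and |v| = 1.
    have h5 := (o (γ t)).inner_mul_inner_add_areaForm_mul_areaForm v (w - Φ) (w - Φ)
    rw [inner_sub_right, h0, h3, map_sub, h2, ← hκ, h4, h1, mul_div_cancel_left₀ _ hm,
      real_inner_self_eq_norm_sq] at h5
    refine sub_eq_zero.1 (norm_eq_zero.1 (pow_eq_zero_iff (n := 2) two_ne_zero |>.1 ?_))
    linarith

end Speed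

/-! ### Primitives, smooth inverses and lifts of circle maps -/

section Inverse

variable {w : ℝ → ℝ} {U : Set ℝ} {a t : ℝ}

theorem hasDerivAt_integral_of_continuousOn (hU : IsOpen U) (hc : U.OrdConnected)
    (hw : ContinuousOn w U) (ha : a ∈ U) (ht : t ∈ U) :
    HasDerivAt (fun t => ∫ s in a..t, w s) (w t) t := by
  refine intervalIntegral.integral_hasDerivAt_right
    (hw.mono (hc.uIcc_subset ha ht)).intervalIntegrable
    (hw.stronglyMeasurableAtFilter hU t ht) (hw.continuousAt (hU.mem_nhds ht))

theorem strictMonoOn_integral (hU : IsOpen U) (hc : U.OrdConnected) (hw : ContinuousOn w U)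
    (hpos : ∀ t ∈ U, 0 < w t) (ha : a ∈ U) : StrictMonoOn (fun t => ∫ s in a..t, w s) U := by
  refine strictMonoOn_of_deriv_pos hc.convex (fun t ht =>
    (hasDerivAt_integral_of_continuousOn hU hc hw ha ht).continuousAt.continuousWithinAt) ?_
  intro t ht
  rw [(hasDerivAt_integral_of_continuousOn hU hc hw ha (interior_subset ht)).deriv]
  exact hpos t (interior_subset ht)

/-- On U the derivative is `w`, so the primitive is C^(n+1) at `t` as soon as `w` is Cⁿ there;
continuity on the rest of U suffices. -/
theorem contDiffAt_integral (hU : IsOpen U) (hc : U.OrdConnected) (hw : ContinuousOn w U)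
    (ha : a ∈ U) (ht : t ∈ U) (hwt : ContDiffAt ℝ ∞ w t) :
    ContDiffAt ℝ ∞ (fun t => ∫ s in a..t, w s) t := by
  rw [contDiffAt_infty]
  intro n
  refine ContDiffAt.of_le (n := ((n + 1 : ℕ) : WithTop ℕ∞)) ?_ (by exact_mod_cast n.le_succ)
  rw [Nat.cast_add, Nat.cast_one, contDiffAt_succ_iff_hasFDerivAt]
  refine ⟨fun s => ContinuousLinearMap.toSpanSingleton ℝ (w s), ⟨U, hU.mem_nhds ht, fun s hs =>
    (hasDerivAt_integral_of_continuousOn hU hc hw ha hs).hasFDerivAt⟩, ?_⟩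
  exact (ContinuousLinearMap.toSpanSingletonCLE (𝕜 := ℝ) (E := ℝ)).contDiff.contDiffAt.comp t
    (hwt.of_le ENat.LEInfty.out)

/-- The inverse of a smooth increasing function is smooth. -/
theorem contDiffAt_invFunOn {σ : ℝ → ℝ} (hU : IsOpen U) (hσ : InjOn σ U) (ht : t ∈ U)
    (hsm : ContDiffAt ℝ ∞ σ t) {c : ℝ} (hd : HasDerivAt σ c t) (hc : c ≠ 0) :
    ContDiffAt ℝ ∞ (Function.invFunOn σ U) (σ t) ∧ deriv (Function.invFunOn σ U) (σ t) = c⁻¹ := by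
  set e : ℝ ≃L[ℝ] ℝ := ContinuousLinearEquiv.unitsEquivAut ℝ (Units.mk0 c hc)
  have he : HasFDerivAt σ (e : ℝ →L[ℝ] ℝ) t := by
    refine hd.hasFDerivAt.congr_fderiv ?_
    ext
    simp [e]
  have hinf : (∞ : WithTop ℕ∞) ≠ 0 := by simp
  have hstrict := hsm.hasStrictFDerivAt' he hinf
  have h1 := hsm.to_localInverse he hinf
  have h2 : ∀ᶠ y in 𝓝 (σ t), σ (hsm.localInverse he hinf y) = y :=
    hstrict.eventually_right_inverse
  have h3 : hsm.localInverse he hinf (σ t) = t := hsm.localInverse_apply_image he hinf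
  have h4 : ∀ᶠ y in 𝓝 (σ t), hsm.localInverse he hinf y ∈ U :=
    h1.continuousAt.eventually (by rw [h3]; exact hU.mem_nhds ht)
  -- The local inverse takes values in U near σ t, where injectivity forces it to agree with the
  -- global one.
  have h5 : Function.invFunOn σ U =ᶠ[𝓝 (σ t)] hsm.localInverse he hinf := by
    filter_upwards [h2, h4] with y hy hy'
    have := hσ.leftInvOn_invFunOn hy'
    rwa [hy] at this
  have h6 := h1.congr_of_eventuallyEq h5
  refine ⟨h6, ?_⟩
  have h7 := ((h6.differentiableAt hinf).hasDerivAt).comp t hd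
  have h8 : Function.invFunOn σ U ∘ σ =ᶠ[𝓝 t] id :=
    Filter.mem_of_superset (hU.mem_nhds ht) fun s hs => hσ.leftInvOn_invFunOn hs
  have h9 := h7.unique ((hasDerivAt_id t).congr_of_eventuallyEq h8)
  exact eq_inv_of_mul_eq_one_left h9

/-- Subtracting the linear function of slope L/ℓ leaves a periodic function, so f(kℓ) = f(0) + kL is
unbounded in both directions; then the intermediate value theorem applies. -/
theorem surjective_of_add_eq {f : ℝ → ℝ} {ℓ L : ℝ} (hℓ : 0 < ℓ) (hL : 0 < L) (hf : Continuous f)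
    (h : ∀ s, f (s + ℓ) = f s + L) : Function.Surjective f := by
  have h1 : Function.Periodic (fun s => f s - s * (L / ℓ)) ℓ := by
    intro s
    simp only [h]
    field_simp
    ring
  have h2 : ∀ k : ℤ, f (k * ℓ) = f 0 + k * L := by
    intro k
    have := h1.int_mul k 0
    simp only [zero_add, zero_mul, sub_zero] at this
    have h3 : (k : ℝ) * ℓ * (L / ℓ) = k * L := by field_simp
    linarith
  intro y
  obtain ⟨n, hn⟩ := exists_nat_ge (|y - f 0| / L)
  rw [div_le_iff₀ hL] at hn
  have h4 := h2 n
  have h5 := h2 (-n)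
  push_cast at h4 h5
  exact mem_range_of_exists_le_of_exists_ge hf ⟨_, by rw [h5]; linarith [neg_abs_le (y - f 0)]⟩
    ⟨_, by rw [h4]; linarith [le_abs_self (y - f 0)]⟩

end Inverse

/-! ### Parametrization by arc length -/

section ChangeOfParameter

variable {M : Type*} [TopologicalSpace M] [ChartedSpace Plane M]
  [RiemannianBundle (fun x : M => TangentSpace (𝓡 2) x)] [IsManifold (𝓡 2) ∞ M]
  [IsContMDiffRiemannianBundle (𝓡 2) ∞ Plane (fun x : M => TangentSpace (𝓡 2) x)]
  {o : ∀ x : M, Orientation ℝ (TangentSpace (𝓡 2) x) (Fin 2)} {m : ℝ} {γ : ℝ → M} {φ : ℝ → ℝ}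
  {K K' : Set ℝ}

/-- The equation G = mκ does not see the parameter, so the only condition on φ is unit speed. -/
theorem isNormalFlowlineOn_comp_iff (hm : m ≠ 0) (hK' : UniqueDiffOn ℝ K')
    (hγ : IsImmersedOn K γ) (hφ : ∀ s ∈ K', ContDiffAt ℝ ∞ φ s ∧ 0 < deriv φ s)
    (himage : φ '' K' = K) :
    IsNormalFlowlineOn (gaussMagneticField o m) K' (γ ∘ φ) ↔
      (∀ s ∈ K', deriv φ s * ‖velocity γ (φ s)‖ = 1) ∧
        ∀ t ∈ K, gaussCurvature (γ t) = m * geodesicCurvature o γ t := by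
  have hmem : ∀ s ∈ K', φ s ∈ K := fun s hs => himage ▸ mem_image_of_mem φ hs
  rw [isNormalFlowlineOn_iff hm hK' fun s hs => ContMDiffAt.comp s (hγ _ (hmem s hs)).1
    (contMDiffAt_iff_contDiffAt.2 (hφ s hs).1), ← himage, forall_mem_image]
  refine and_congr (forall₂_congr fun s hs => ?_) (forall₂_congr fun s hs => ?_)
  · rw [velocity_comp ((hγ _ (hmem s hs)).1.mdifferentiableAt (by simp))
      ((hφ s hs).1.differentiableAt (by simp))]
    have : ‖deriv φ s • velocity γ (φ s)‖ = deriv φ s * ‖velocity γ (φ s)‖ := by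
      rw [norm_smul, Real.norm_of_nonneg (hφ s hs).2.le]
    exact ⟨fun h => this.symm.trans h, fun h => this.trans h⟩
  · rw [geodesicCurvature_comp ((hγ _ (hmem s hs)).1.of_le ENat.LEInfty.out)
      ((hφ s hs).1.of_le ENat.LEInfty.out) (hφ s hs).2]
    rfl

theorem image_Icc_of_isIntervalReparam {a b c d : ℝ} (h : IsIntervalReparam c d a b φ) :
    φ '' Icc c d = Icc a b := by
  obtain ⟨hcd, hc, hd, hφ⟩ := h
  have hcont : ContinuousOn φ (Icc c d) := fun s hs => (hφ s hs).1.continuousAt.continuousWithinAt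
  have hmono : StrictMonoOn φ (Icc c d) :=
    strictMonoOn_of_deriv_pos (convex_Icc c d) hcont fun s hs => (hφ s (interior_subset hs)).2
  refine Subset.antisymm ?_ ?_
  · rintro _ ⟨s, hs, rfl⟩
    exact ⟨hc ▸ hmono.monotoneOn (left_mem_Icc.2 hcd.le) hs hs.1,
      hd ▸ hmono.monotoneOn hs (right_mem_Icc.2 hcd.le) hs.2⟩
  · have := intermediate_value_Icc hcd.le hcont
    rwa [hc, hd] at this

theorem exists_arclength_Icc {a b : ℝ} (hab : a < b) (hγ : IsImmersedOn (Icc a b) γ) :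
    ∃ (c d : ℝ) (φ : ℝ → ℝ), IsIntervalReparam c d a b φ ∧
      ∀ s ∈ Icc c d, deriv φ s * ‖velocity γ (φ s)‖ = 1 := by
  set w : ℝ → ℝ := fun t => ‖velocity γ t‖ with hw
  have hsm : ∀ t ∈ Icc a b, ContDiffAt ℝ ∞ w t := fun t ht =>
    contDiffAt_norm_velocity (hγ t ht).1 (hγ t ht).2
  have hnear : ∀ t ∈ Icc a b, ∀ᶠ s in 𝓝 t, ContinuousAt w s ∧ 0 < w s := by
    intro t ht
    have h1 : ContDiffAt ℝ 1 w t := (hsm t ht).of_le ENat.LEInfty.out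
    filter_upwards [h1.eventually (by simp), (hsm t ht).continuousAt.eventually
      (lt_mem_nhds (norm_pos_iff.2 (hγ t ht).2))] with s hs hs'
    exact ⟨hs.continuousAt, hs'⟩
  have ha := left_mem_Icc.2 hab.le
  have hb := right_mem_Icc.2 hab.le
  -- The new parameter must be smooth in a neighbourhood of each end, so arc length is taken on an
  -- open interval slightly larger than [a, b], where the speed is still continuous and positive.
  obtain ⟨α, hα, hα'⟩ := Metric.eventually_nhds_iff.1 (hnear a ha)
  obtain ⟨β, hβ, hβ'⟩ := Metric.eventually_nhds_iff.1 (hnear b hb)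
  set U := Ioo (a - α) (b + β)
  have hU : IsOpen U := isOpen_Ioo
  have hc : U.OrdConnected := ordConnected_Ioo
  have hKU : Icc a b ⊆ U := fun t ht => ⟨by linarith [ht.1], by linarith [ht.2]⟩
  have hwU : ∀ s ∈ U, ContinuousAt w s ∧ 0 < w s := by
    intro s hs
    rcases lt_or_ge s a with h | h
    · refine hα' ?_
      rw [Real.dist_eq, abs_lt]
      constructor <;> linarith [hs.1]
    rcases le_or_gt s b with h' | h'
    · exact (hnear s ⟨h, h'⟩).self_of_nhds
    · refine hβ' ?_
      rw [Real.dist_eq, abs_lt]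
      constructor <;> linarith [hs.2]
  have hwc : ContinuousOn w U := fun s hs => (hwU s hs).1.continuousWithinAt
  set σ : ℝ → ℝ := fun t => ∫ s in a..t, w s with hσ
  have hmono : StrictMonoOn σ U := strictMonoOn_integral hU hc hwc (fun s hs => (hwU s hs).2) (hKU ha)
  have hinv : ∀ t ∈ U, Function.invFunOn σ U (σ t) = t := fun t ht =>
    hmono.injOn.leftInvOn_invFunOn ht
  have hcont : ContinuousOn σ (Icc a b) := fun t ht =>
    (contDiffAt_integral hU hc hwc (hKU ha) (hKU ht)
      (hsm t ht)).continuousAt.continuousWithinAt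
  have hφ : ∀ t ∈ Icc a b, ContDiffAt ℝ ∞ (Function.invFunOn σ U) (σ t) ∧
      deriv (Function.invFunOn σ U) (σ t) = (w t)⁻¹ := fun t ht =>
    contDiffAt_invFunOn hU hmono.injOn (hKU ht)
      (contDiffAt_integral hU hc hwc (hKU ha) (hKU ht) (hsm t ht))
      (hasDerivAt_integral_of_continuousOn hU hc hwc (hKU ha) (hKU ht)) (hwU t (hKU ht)).2.ne'
  refine ⟨σ a, σ b, Function.invFunOn σ U, ⟨hmono (hKU ha) (hKU hb) hab, hinv a (hKU ha),
    hinv b (hKU hb), fun s hs => ?_⟩, fun s hs => ?_⟩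
  · obtain ⟨t, ht, rfl⟩ := intermediate_value_Icc hab.le hcont hs
    refine ⟨(hφ t ht).1, ?_⟩
    rw [(hφ t ht).2]
    exact inv_pos.2 (hwU t (hKU ht)).2
  · obtain ⟨t, ht, rfl⟩ := intermediate_value_Icc hab.le hcont hs
    rw [(hφ t ht).2, hinv t (hKU ht)]
    exact inv_mul_cancel₀ (hwU t (hKU ht)).2.ne'

/-- Arc length σ satisfies σ(t + L) = σ(t) + σ(L), so its inverse descends to circles, the new one
having the length σ(L) of the curve. -/
theorem exists_arclength_periodic {L : ℝ} (hL : 0 < L) (hγ : γ ∈ closedCurves M L) :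
    ∃ (ℓ : ℝ) (φ : ℝ → ℝ), IsPeriodicReparam ℓ L φ ∧
      ∀ s, deriv φ s * ‖velocity γ (φ s)‖ = 1 := by
  set w : ℝ → ℝ := fun t => ‖velocity γ t‖ with hw
  have hsm : ∀ t, ContDiffAt ℝ ∞ w t := fun t =>
    contDiffAt_norm_velocity (hγ.1 t (mem_univ t)).1 (hγ.1 t (mem_univ t)).2
  have hpos : ∀ t, 0 < w t := fun t => norm_pos_iff.2 (hγ.1 t (mem_univ t)).2
  have hwcont : Continuous w := continuous_iff_continuousAt.2 fun t => (hsm t).continuousAt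
  have hwper : Function.Periodic w L := by
    intro t
    have h1 := velocity_comp (γ := γ) (φ := fun s => s + L) (t := t)
      ((hγ.1 _ (mem_univ _)).1.mdifferentiableAt (by simp)) (by fun_prop)
    have h2 : γ ∘ (fun s => s + L) = γ := funext hγ.2
    have h3 : deriv (fun s => s + L) t = 1 := by simp
    rw [h3, one_smul] at h1
    -- The velocities at t and t + L lie in tangent spaces that are equal only through γ (t + L) = γ
    -- t; `normPlane` makes the base point a variable that can be rewritten.
    have h4 : normPlane (γ (t + L)) (velocity (γ ∘ fun s => s + L) t)
        = normPlane (γ (t + L)) (velocity γ (t + L)) := congrArg (normPlane (γ (t + L))) h1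
    rw [h2, hγ.2 t] at h4
    refine Eq.trans ?_ h4.symm
    exact congrArg (fun p => normPlane p (velocity γ (t + L))) (hγ.2 t)
  have hU : IsOpen (univ : Set ℝ) := isOpen_univ
  have hc : (univ : Set ℝ).OrdConnected := ordConnected_univ
  have hwc : ContinuousOn w univ := hwcont.continuousOn
  set σ : ℝ → ℝ := fun t => ∫ s in (0 : ℝ)..t, w s with hσ
  have hmono : StrictMonoOn σ univ :=
    strictMonoOn_integral hU hc hwc (fun s _ => hpos s) (mem_univ 0)
  have hinv : ∀ t, Function.invFunOn σ univ (σ t) = t := fun t =>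
    hmono.injOn.leftInvOn_invFunOn (mem_univ t)
  have hσsm := fun t => contDiffAt_integral hU hc hwc (mem_univ 0) (mem_univ t) (hsm t)
  have hσcont : Continuous σ := continuous_iff_continuousAt.2 fun t => (hσsm t).continuousAt
  have hφ := fun t => contDiffAt_invFunOn hU hmono.injOn (mem_univ t) (hσsm t)
    (hasDerivAt_integral_of_continuousOn hU hc hwc (mem_univ 0) (mem_univ t)) (hpos t).ne'
  have hσ0 : σ 0 = 0 := intervalIntegral.integral_same
  have hℓ : 0 < σ L := hσ0 ▸ hmono (mem_univ 0) (mem_univ L) hL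
  have hadd : ∀ t, σ (t + L) = σ t + σ L := by
    intro t
    have h1 := intervalIntegral.integral_add_adjacent_intervals
      (hwcont.intervalIntegrable (μ := volume) 0 t) (hwcont.intervalIntegrable t (t + L))
    have h2 := hwper.intervalIntegral_add_eq t 0
    rw [zero_add] at h2
    simp only [hσ]
    rw [← h1, h2]
  have hsurj := surjective_of_add_eq hL hℓ hσcont hadd
  refine ⟨σ L, Function.invFunOn σ univ, ⟨hℓ, contDiff_iff_contDiffAt.2 fun s => ?_, fun s => ?_,
    fun s => ?_⟩, fun s => ?_⟩ <;> obtain ⟨t, rfl⟩ := hsurj s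
  · exact (hφ t).1
  · rw [← hadd, hinv, hinv]
  · rw [(hφ t).2]
    exact inv_pos.2 (hpos t)
  · rw [(hφ t).2, hinv t]
    exact inv_mul_cancel₀ (hpos t).ne'

end ChangeOfParameter

end GaussLandauHall

end

/-! ### The theorem -/

open GaussLandauHall in
theorem mainTheorem1 {M : Type*} [TopologicalSpace M] [T2Space M] [ChartedSpace Plane M]
    [IsManifold (𝓡 2) ∞ M] [RiemannianBundle (fun x : M => TangentSpace (𝓡 2) x)]
    [IsContMDiffRiemannianBundle (𝓡 2) ∞ Plane (fun x : M => TangentSpace (𝓡 2) x)]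
    (o : ∀ x : M, Orientation ℝ (TangentSpace (𝓡 2) x) (Fin 2))
    (ho : IsContinuousOrientation o) (m : ℝ) (hm : m ≠ 0) :
    (∀ a b : ℝ, a < b → ∀ x₁ x₂ : TangentBundle (𝓡 2) M, ∀ γ ∈ clampedCurves a b x₁ x₂,
      (IsNormalFlowlineOn (gaussMagneticField o m) (Icc a b) γ ↔
        HasUnitSpeedOn (Icc a b) γ ∧
          IsCriticalPoint (clampedCurves a b x₁ x₂) (Icc a b) (action o m a b) γ) ∧
      ((∃ (c d : ℝ) (φ : ℝ → ℝ), IsIntervalReparam c d a b φ ∧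
          IsNormalFlowlineOn (gaussMagneticField o m) (Icc c d) (γ ∘ φ)) ↔
        IsCriticalPoint (clampedCurves a b x₁ x₂) (Icc a b) (action o m a b) γ) ∧
      (IsCriticalPoint (clampedCurves a b x₁ x₂) (Icc a b) (action o m a b) γ ↔
        ∀ t ∈ Icc a b, gaussCurvature (γ t) = m * geodesicCurvature o γ t)) ∧
    (∀ L : ℝ, 0 < L → ∀ γ ∈ closedCurves M L,
      (IsNormalFlowlineOn (gaussMagneticField o m) univ γ ↔
        HasUnitSpeedOn univ γ ∧
          IsCriticalPoint (closedCurves M L) univ (action o m 0 L) γ) ∧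
      ((∃ (ℓ : ℝ) (φ : ℝ → ℝ), IsPeriodicReparam ℓ L φ ∧
          IsNormalFlowlineOn (gaussMagneticField o m) univ (γ ∘ φ)) ↔
        IsCriticalPoint (closedCurves M L) univ (action o m 0 L) γ) ∧
      (IsCriticalPoint (closedCurves M L) univ (action o m 0 L) γ ↔
        ∀ t : ℝ, gaussCurvature (γ t) = m * geodesicCurvature o γ t)) := by
  refine ⟨fun a b hab x₁ x₂ γ hγ => ?_, fun L hL γ hγ => ?_⟩
  · have h3 := isCriticalPoint_clamped_iff (m := m) ho hab hγ
    refine ⟨?_, ?_, h3⟩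
    -- Once criticality is replaced by G = mκ, both sides become the same pair of conditions.
    · rw [h3, isNormalFlowlineOn_iff hm (uniqueDiffOn_Icc hab) fun t ht => (hγ.1 t ht).1]
    · rw [h3]
      constructor
      · rintro ⟨c, d, φ, hφ, h⟩
        exact ((isNormalFlowlineOn_comp_iff hm (uniqueDiffOn_Icc hφ.1) hγ.1 hφ.2.2.2
          (image_Icc_of_isIntervalReparam hφ)).1 h).2
      · intro h
        obtain ⟨c, d, φ, hφ, h1⟩ := exists_arclength_Icc hab hγ.1
        exact ⟨c, d, φ, hφ, (isNormalFlowlineOn_comp_iff hm (uniqueDiffOn_Icc hφ.1) hγ.1 hφ.2.2.2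
          (image_Icc_of_isIntervalReparam hφ)).2 ⟨h1, h⟩⟩
  · have h3 := isCriticalPoint_closed_iff (m := m) ho hL hγ
    have himage : ∀ {ℓ φ}, IsPeriodicReparam ℓ L φ → φ '' univ = univ := fun hφ => by
      rw [image_univ]
      exact (surjective_of_add_eq hφ.1 hL hφ.2.1.continuous hφ.2.2.1).range_eq
    refine ⟨?_, ?_, h3⟩
    · rw [h3, isNormalFlowlineOn_iff hm uniqueDiffOn_univ fun t ht => (hγ.1 t ht).1]
      simp only [mem_univ, forall_const]
    · rw [h3]
      constructor
      · rintro ⟨ℓ, φ, hφ, h⟩ t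
        exact ((isNormalFlowlineOn_comp_iff hm uniqueDiffOn_univ hγ.1
          (fun s _ => ⟨hφ.2.1.contDiffAt, hφ.2.2.2 s⟩) (himage hφ)).1 h).2 t (mem_univ t)
      · intro h
        obtain ⟨ℓ, φ, hφ, h1⟩ := exists_arclength_periodic hL hγ
        exact ⟨ℓ, φ, hφ, (isNormalFlowlineOn_comp_iff hm uniqueDiffOn_univ hγ.1
          (fun s _ => ⟨hφ.2.1.contDiffAt, hφ.2.2.2 s⟩) (himage hφ)).2
          ⟨fun s _ => h1 s, fun t _ => h t⟩⟩
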